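/- Let $S^2\subset\mathbb R^3$ be the unit sphere with the round metric $\sigma_{AB}$, Levi-Civita connection $\nabla$, Laplacian $\Delta$ and volume form $\epsilon_{AB}$; indices are raised, lowered and contracted with $\sigma$, integrals over $S^2$ are with respect to the standard area measure, and $\tilde X^k$ ($k=1,2,3$) are the standard coordinate functions of $\mathbb R^3$ restricted to $S^2$. A smooth function $\phi$ on $S^2$ is of mode $\ell$ if $\Delta\phi=-\ell(\ell+1)\phi$; a function is supported in the modes $\ell\ge2$ if it is $L^2$-orthogonal to all functions of mode $0$ and $1$. A set of vacuum null infinity data on $\mathbb R\times S^2$ consists of a mass aspect $m(u,x)$, an angular momentum aspect $N_A(u,x)$ (a one-form on $S^2$) and a shear $C_{AB}(u,x)$ (a symmetric traceless 2-tensor on $S^2$), all smooth in $(u,x)$, such that, with the news $N_{AB}=\partial_uC_{AB}$, \[\partial_um=-\tfrac18N_{AB}N^{AB}+\tfrac14\nabla^A\nabla^BN_{AB},\] \[\partial_uN_A=\nabla_Am-\tfrac14\nabla^D(\nabla_D\nabla^EC_{EA}-\nabla_A\nabla^EC_{ED})+\tfrac14\nabla_A(C_{BE}N^{BE})-\tfrac14\nabla_B(C^{BD}N_{DA})+\tfrac12C_{AB}\nabla_DN^{DB}.\]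 The potentials of $C_{AB}$ are, for each $u$, smooth functions $c,\underline c$ on $S^2$ supported in the modes $\ell\ge2$ with \[C_{AB}=\nabla_A\nabla_Bc-\tfrac12\sigma_{AB}\Delta c+\underline F_{AB},\qquad \underline F_{AB}=\tfrac12(\epsilon_A{}^E\nabla_E\nabla_B\underline c+\epsilon_B{}^E\nabla_E\nabla_A\underline c).\] Put $E(u)=\int_{S^2}2m$, $P^k(u)=\int_{S^2}2m\tilde X^k$, and define the Chen-Wang-Yau (CWY) center of mass by \[\begin{aligned}C^k(u)=&\int_{S^2}\nabla^A\tilde X^k\Big[N_A-u\nabla_Am-\tfrac14C_{AB}\nabla_DC^{DB}-\tfrac1{16}\nabla_A(C^{DE}C_{DE})-c\nabla_Am+2\epsilon_{AB}(\nabla^B\underline c)\,m\Big]\\&+\int_{S^2}\Big[3\tilde X^kcm-\tfrac14\tilde X^k\nabla_A\underline F^{AB}\nabla^D\underline F_{DB}\Big].\end{aligned}\] **Theorem.** Let $(m,N_A,C_{AB})$ be vacuum null infinity data. Suppose that for some $\varepsilon>0$ the news satisfies $N_{AB}(u,x)=O(|u|^{-1-\varepsilon})$ as $u\to\pm\infty$,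 uniformly on $S^2$, together with its derivatives along $S^2$ of order at most two. Let $f$ be a smooth function on $S^2$, written as $f=\alpha_0+\sum_i\alpha_i\tilde X^i+f_{\ell\ge2}$ with constants $\alpha_0,\alpha_i$ and with $f_{\ell\ge2}$ supported in the modes $\ell\ge2$. Let $(\bar m,\bar N_A,\bar C_{AB})$ be the data in the supertranslated coordinates $(\bar u,x)$, $u=\bar u+f(x)$; that is, they are vacuum null infinity data with \[\bar C_{AB}(\bar u,x)=C_{AB}(\bar u+f,x)-2\nabla_A\nabla_Bf+\Delta f\,\sigma_{AB},\] \[\bar m(\bar u,x)=\Big(m+\tfrac12\nabla^BN_{BD}\nabla^Df+\tfrac14\partial_uN_{BD}\nabla^Bf\nabla^Df+\tfrac14N_{BD}\nabla^B\nabla^Df\Big)(\bar u+f,x).\] Let $C^k$ and $C^k_f$ be the CWY centers of mass of the two sets of data, as functions of $u$ and $\bar u$ respectively. Then $E$, $P^k$, $C^k$ and $C^k_f$ have finite limits $E(\pm)$, $P^k(\pm)$, $C^k(\pm)$, $C^k_f(\pm)$ at $\pm\infty$, and the total flux of $C^k$ is supertranslation invariant in the sense that, for $k=1,2,3$, \[\big(C^k_f(+)-C^k_f(-)\big)-\big(C^k(+)-C^k(-)\big)=\alpha_0\big(P^k(+)-P^k(-)\big)+\alpha_k\big(E(+)-E(-)\big).\]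 -/

import Mathlib

open MeasureTheory Filter Topology
open scoped Manifold ContDiff Matrix

noncomputable section

namespace NullInfinity

/-! ### Calculus on the round unit sphere

Tensor fields on the unit sphere of `ℝ³` are described by their Cartesian components: a one-form is
a family `w i` of functions with `∑ i, x i * w i x = 0`, and a 2-tensor is a family `T i j` which is
annihilated by the normal `x` in each slot. In this description the round metric is the restriction
of the Euclidean inner product, so that indices are raised, lowered and contracted by plain sums over
`Fin 3`, and the Levi-Civita connection is the tangential projection of the ambient derivative. -/

/-- Euclidean 3-space. -/
abbrev E3 : Type := EuclideanSpace ℝ (Fin 3)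

/-- The unit sphere. -/
abbrev S2 : Type := Metric.sphere (0 : E3) 1

/-- Smooth functions on the sphere. -/
def SmoothOnS2 (φ : S2 → ℝ) : Prop := ContMDiff (𝓡 2) 𝓘(ℝ, ℝ) ∞ φ

/-- Functions of `(u, x)`, smooth on `ℝ × S²`. -/
def SmoothOnScri (φ : ℝ → S2 → ℝ) : Prop :=
  ContMDiff (𝓘(ℝ, ℝ).prod (𝓡 2)) 𝓘(ℝ, ℝ) ∞ (fun p : ℝ × S2 => φ p.1 p.2)

/-- The extension of a function on the sphere that is constant along rays (and 0 at the origin). -/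
def radialExt (φ : S2 → ℝ) (y : E3) : ℝ :=
  if h : y = 0 then 0
  else φ ⟨‖y‖⁻¹ • y, by
    rw [mem_sphere_zero_iff_norm, norm_smul, norm_inv, norm_norm,
      inv_mul_cancel₀ (norm_ne_zero_iff.mpr h)]⟩

/-- The tangential derivative of a function: the `i`-th Cartesian component of its gradient
on the sphere. -/
def tder (i : Fin 3) (φ : S2 → ℝ) (x : S2) : ℝ :=
  fderiv ℝ (radialExt φ) (x : E3) (EuclideanSpace.single i 1)

/-- The standard coordinate functions restricted to the sphere. -/
def coord (k : Fin 3) (x : S2) : ℝ := (x : E3) k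

/-- The round metric, which is also the orthogonal projection to the tangent plane at `x`. -/
def roundMetric (i j : Fin 3) (x : S2) : ℝ :=
  (if i = j then 1 else 0) - coord i x * coord j x

/-- The volume form: `ε_x(v, w) = x · (v × w)`. -/
def volForm (i j : Fin 3) (x : S2) : ℝ :=
  (fun l => coord l x) ⬝ᵥ
    ((Pi.single i 1 : Fin 3 → ℝ) ⨯₃ (Pi.single j 1 : Fin 3 → ℝ))

/-- The gradient `∇_i φ`. -/
def grad (φ : S2 → ℝ) (i : Fin 3) (x : S2) : ℝ := tder i φ x

/-- The covariant derivative `∇_i w_j` of a one-form. -/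
def cov1 (w : Fin 3 → S2 → ℝ) (i j : Fin 3) (x : S2) : ℝ :=
  ∑ l, roundMetric j l x * tder i (w l) x

/-- The covariant derivative `∇_k T_{ij}` of a 2-tensor. -/
def cov2 (T : Fin 3 → Fin 3 → S2 → ℝ) (k i j : Fin 3) (x : S2) : ℝ :=
  ∑ l, ∑ n, roundMetric i l x * roundMetric j n x * tder k (T l n) x

/-- The divergence `∇^i w_i` of a one-form. -/
def div1 (w : Fin 3 → S2 → ℝ) (x : S2) : ℝ := ∑ i, cov1 w i i x

/-- The divergence `∇^i T_{ij}` of a 2-tensor. -/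
def div2 (T : Fin 3 → Fin 3 → S2 → ℝ) (j : Fin 3) (x : S2) : ℝ := ∑ i, cov2 T i i j x

/-- The Hessian `∇_i ∇_j φ`. -/
def hess (φ : S2 → ℝ) (i j : Fin 3) (x : S2) : ℝ := cov1 (grad φ) i j x

/-- The Laplacian. -/
def lap (φ : S2 → ℝ) (x : S2) : ℝ := ∑ i, hess φ i i x

/-- The full contraction `S_{ij} T^{ij}`. -/
def contract (S T : Fin 3 → Fin 3 → S2 → ℝ) (x : S2) : ℝ := ∑ i, ∑ j, S i j x * T i j x

/-- The integral over the unit sphere with respect to its surface measure (of total mass `4π`). -/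
def sphereInt (φ : S2 → ℝ) : ℝ := ∫ x, φ x ∂(volume : Measure E3).toSphere

/-- Functions of mode `ℓ`: smooth eigenfunctions with `Δ φ = -ℓ(ℓ+1) φ`. -/
def IsMode (ℓ : ℕ) (φ : S2 → ℝ) : Prop :=
  SmoothOnS2 φ ∧ ∀ x, lap φ x = -((ℓ : ℝ) * ((ℓ : ℝ) + 1)) * φ x

/-- Functions supported in the modes `≥ L`: orthogonal to every function of a lower mode. -/
def SupportedInModesGE (L : ℕ) (φ : S2 → ℝ) : Prop :=
  ∀ ℓ < L, ∀ ψ : S2 → ℝ, IsMode ℓ ψ → sphereInt (fun x => φ x * ψ x) = 0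

/-! ### Potentials -/

/-- The closed part `∇_i ∇_j c - ½ σ_{ij} Δ c`. -/
def closedPart (c : S2 → ℝ) (i j : Fin 3) (x : S2) : ℝ :=
  hess c i j x - 1 / 2 * roundMetric i j x * lap c x

/-- The co-closed part `½ (ε_i^e ∇_e ∇_j c + ε_j^e ∇_e ∇_i c)`. -/
def coclosedPart (c : S2 → ℝ) (i j : Fin 3) (x : S2) : ℝ :=
  1 / 2 * ∑ e, (volForm i e x * hess c e j x + volForm j e x * hess c e i x)

/-- `c` and `cc` are the (closed and co-closed) potentials of the tensor `T`, normalized to be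
supported in the modes `ℓ ≥ 2`. -/
structure IsPotentials (T : Fin 3 → Fin 3 → S2 → ℝ) (c cc : S2 → ℝ) : Prop where
  smooth_closed : SmoothOnS2 c
  smooth_coclosed : SmoothOnS2 cc
  modes_closed : SupportedInModesGE 2 c
  modes_coclosed : SupportedInModesGE 2 cc
  decomposition : ∀ i j x, T i j x = closedPart c i j x + coclosedPart cc i j x

/-! ### Data on future null infinity `ℝ × S²` -/

/-- Mass aspect `m`, angular momentum aspect `N_A` and shear `C_{AB}` in a Bondi-Sachs coordinate
system, with the retarded time `u` ranging over all of `ℝ`. -/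
structure ScriData where
  /-- mass aspect -/
  m : ℝ → S2 → ℝ
  /-- angular momentum aspect -/
  aspect : ℝ → Fin 3 → S2 → ℝ
  /-- shear tensor -/
  shear : ℝ → Fin 3 → Fin 3 → S2 → ℝ
  smooth_m : SmoothOnScri m
  smooth_aspect : ∀ i, SmoothOnScri (fun u => aspect u i)
  smooth_shear : ∀ i j, SmoothOnScri (fun u => shear u i j)
  aspect_tangent : ∀ u x, ∑ i, coord i x * aspect u i x = 0
  shear_tangent : ∀ u j x, ∑ i, coord i x * shear u i j x = 0
  shear_symm : ∀ u i j x, shear u i j x = shear u j i x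
  shear_traceless : ∀ u x, ∑ i, shear u i i x = 0

namespace ScriData

/-- The news tensor `N_{AB} = ∂_u C_{AB}`. -/
def news (D : ScriData) (u : ℝ) (i j : Fin 3) (x : S2) : ℝ :=
  deriv (fun s => D.shear s i j x) u

/-- The vacuum Einstein equations on null infinity:
`∂_u m = -⅛ N_{AB} N^{AB} + ¼ ∇^A ∇^B N_{AB}` and
`∂_u N_A = ∇_A m - ¼ ∇^D (∇_D ∇^E C_{EA} - ∇_A ∇^E C_{ED}) + ¼ ∇_A (C_{BE} N^{BE})
  - ¼ ∇_B (C^{BD} N_{DA}) + ½ C_{AB} ∇_D N^{DB}`. -/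
structure IsVacuum (D : ScriData) : Prop where
  evolution_m : ∀ u x, deriv (fun s => D.m s x) u =
    -(1 / 8) * contract (D.news u) (D.news u) x + 1 / 4 * div1 (div2 (D.news u)) x
  evolution_aspect : ∀ u a x, deriv (fun s => D.aspect s a x) u =
    grad (D.m u) a x
    - 1 / 4 * div2 (fun d b y =>
        cov1 (div2 (D.shear u)) d b y - cov1 (div2 (D.shear u)) b d y) a x
    + 1 / 4 * grad (contract (D.shear u) (D.news u)) a x
    - 1 / 4 * div2 (fun b e y => ∑ d, D.shear u b d y * D.news u d e y) a x
    + 1 / 2 * ∑ b, D.shear u a b x * div2 (D.news u) b x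

/-- The news and its angular derivatives of order at most two are `O(|u|^{-1-ε})`, uniformly on the
sphere, as `u → ±∞`, for some `ε > 0`. -/
def NewsDecay (D : ScriData) : Prop :=
  ∃ ε > (0 : ℝ), ∃ K R : ℝ, 0 < R ∧ ∀ (u : ℝ) (x : S2) (i j a b : Fin 3), R ≤ |u| →
    |D.news u i j x| ≤ K * |u| ^ (-1 - ε) ∧
    |tder a (D.news u i j) x| ≤ K * |u| ^ (-1 - ε) ∧
    |tder a (tder b (D.news u i j)) x| ≤ K * |u| ^ (-1 - ε)

/-- `D'` consists of the data in the coordinates `(ū, x)` with `u = ū + f(x)`, where `D` consists of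
the data in the coordinates `(u, x)`. (The angular momentum aspect of `D'` is only restricted by
its evolution equation, that is, when `D'` is also required to be vacuum.) -/
structure IsSupertranslate (f : S2 → ℝ) (D D' : ScriData) : Prop where
  shear_eq : ∀ u i j x, D'.shear u i j x =
    D.shear (u + f x) i j x - 2 * hess f i j x + lap f x * roundMetric i j x
  m_eq : ∀ u x, D'.m u x =
    D.m (u + f x) x
    + 1 / 2 * ∑ d, div2 (D.news (u + f x)) d x * grad f d x
    + 1 / 4 * ∑ b, ∑ d,
        deriv (fun s => D.news s b d x) (u + f x) * grad f b x * grad f d x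
    + 1 / 4 * ∑ b, ∑ d, D.news (u + f x) b d x * hess f b d x

/-- The energy `E = ∫ 2m`. -/
def energy (D : ScriData) (u : ℝ) : ℝ := sphereInt (fun x => 2 * D.m u x)

/-- The linear momentum `P^k = ∫ 2 m X^k`. -/
def momentum (D : ScriData) (k : Fin 3) (u : ℝ) : ℝ :=
  sphereInt (fun x => 2 * D.m u x * coord k x)

/-- The classical center of mass
`∫ ∇^A X^k [N_A - u ∇_A m - ¼ C_A^D ∇^B C_{DB} - 1/16 ∇_A (C_{DE} C^{DE})]`. -/
def classicalCenterOfMass (D : ScriData) (k : Fin 3) (u : ℝ) : ℝ :=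
  sphereInt (fun x => ∑ a, grad (coord k) a x *
    (D.aspect u a x - u * grad (D.m u) a x
      - 1 / 4 * ∑ d, D.shear u a d x * div2 (D.shear u) d x
      - 1 / 16 * grad (contract (D.shear u) (D.shear u)) a x))

/-- The Chen-Wang-Yau center of mass, for given potentials `c`, `cc` of the shear: the classical
center of mass plus
`∫ ∇^A X^k (-c ∇_A m + 2 ε_{AB} (∇^B cc) m) + ∫ (3 X^k c m - ¼ X^k ∇_A F^{AB} ∇^D F_{DB})`,
where `F` is the co-closed part of the shear. -/
def cwyCenterOfMass (D : ScriData) (c cc : ℝ → S2 → ℝ) (k : Fin 3) (u : ℝ) : ℝ :=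
  D.classicalCenterOfMass k u
  + sphereInt (fun x => ∑ a, grad (coord k) a x *
      (-(c u x) * grad (D.m u) a x
        + 2 * (∑ b, volForm a b x * grad (cc u) b x) * D.m u x))
  + sphereInt (fun x => 3 * coord k x * c u x * D.m u x
      - 1 / 4 * coord k x *
        ∑ b, div2 (coclosedPart (cc u)) b x * div2 (coclosedPart (cc u)) b x)

end ScriData

end NullInfinity

end

open NullInfinity

namespace NullInfinity

noncomputable section

/-! ### Smooth functions and their radial extensions -/

/-! Put M = m - ¼ ∇∇C (`MA`). The double divergence of the shear integrates to zero against 1 and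
X^k, so E and P^k see only M. The vacuum equation for m becomes ∂_u M = -⅛|N|², and the
transformation law of m becomes M' = M shifted by f, plus ½ ∇∇(Cl f): the correction terms in the
law for m are exactly what the chain rule produces when the shifted shear is differentiated twice
(`IsSupertranslate.MA_eq`).

The classical center of mass has u-derivative ∫ [(u/4) X^k |N|² + ¼ (C_{kb} ∇·N_b - N_{kb} ∇·C_b)]
(`hasDerivAt_classicalCenterOfMass`). Pointwise on the sphere, the density of the supertranslated
data is the shifted density plus the time derivative of an explicit boundary term
(`fluxA_supertranslate`). The proof uses that the square of a symmetric traceless tensor on a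
2-plane is pure trace (`STF.sq_eq`). A primitive of the density is uniformly Cauchy at each end, so
shifting by the bounded function f does not affect the limit of its integral. Hence, up to a
constant common to both ends, the classical centers of mass differ in the limit by the limit of the
boundary term. That limit contains the unwanted contribution of f_{ℓ≥2}, which `I_pair_Cl` expresses
through the first order operator `ell`.

After integration by parts the CWY correction is a bilinear expression in M, ∇·C and `ell` of the
potentials, plus a term in the co-closed part alone (`cwyCenterOfMass_eq`). In the limit a
supertranslation replaces c by c - 2 f_{ℓ≥2} and leaves the co-closed potential unchanged. The
resulting change of the correction cancels the contribution of f_{ℓ≥2} to the boundary term. Since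
X_k f + ∂_k f equals `ell k` of f_{ℓ≥2} plus α₀ X^k + α_k, what remains is α₀ P^k + α_k E
(`exists_limits`). Subtracting the two ends gives the theorem.

The analytic input is that the potentials converge when the shear does. Nothing is assumed about
their dependence on u, so this follows from an H² estimate by the L² norm of the tensor. The
estimate combines ∫|Cl c|² = ½‖Δc‖² + ∫ cΔc with the spectral gap -Δ ≥ 6 on modes ℓ ≥ 2, proved by
polynomial approximation. The tensor calculus takes place in the algebra of smooth functions with
derivations D_i satisfying D_i X_j = δ_ij - X_i X_j, Σ X_i D_i = 0 and [D_i, D_j] = X_i D_j - X_j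
D_i, which turns tensor identities into polynomial ones. -/

lemma norm_coe_S2 (x : S2) : ‖(x : E3)‖ = 1 := by simp

lemma coe_S2_ne_zero (x : S2) : (x : E3) ≠ 0 := by
  intro h
  have := norm_coe_S2 x
  simp [h] at this

/-- A base point of the sphere. -/
def basePoint : S2 := ⟨EuclideanSpace.single 0 1, by simp⟩

instance : Nonempty S2 := ⟨basePoint⟩

/-- The radial projection to the sphere, with a junk value at the origin. -/
def radialProj (y : E3) : S2 :=
  if h : y = 0 then basePoint
  else ⟨‖y‖⁻¹ • y, by
    rw [mem_sphere_zero_iff_norm, norm_smul, norm_inv, norm_norm,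
      inv_mul_cancel₀ (norm_ne_zero_iff.mpr h)]⟩

lemma radialProj_coe (x : S2) : radialProj (x : E3) = x := by
  have h := coe_S2_ne_zero x
  ext1
  simp [radialProj, h]

lemma coe_radialProj {y : E3} (h : y ≠ 0) : (radialProj y : E3) = ‖y‖⁻¹ • y := by
  simp [radialProj, h]

lemma radialExt_eq (φ : S2 → ℝ) {y : E3} (h : y ≠ 0) : radialExt φ y = φ (radialProj y) := by
  simp [radialExt, radialProj, h]

lemma radialExt_coe (φ : S2 → ℝ) (x : S2) : radialExt φ x = φ x := by
  rw [radialExt_eq _ (coe_S2_ne_zero x), radialProj_coe]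

lemma radialExt_eventuallyEq (φ : S2 → ℝ) {y : E3} (h : y ≠ 0) :
    radialExt φ =ᶠ[𝓝 y] fun z => φ (radialProj z) := by
  filter_upwards [isOpen_ne.mem_nhds h] with z hz using radialExt_eq φ hz

lemma fact_finrank_E3 : Fact (Module.finrank ℝ E3 = 2 + 1) := ⟨by simp⟩

lemma contMDiff_coe_S2 : ContMDiff (𝓡 2) 𝓘(ℝ, E3) ∞ (fun x : S2 => (x : E3)) :=
  haveI := fact_finrank_E3
  contMDiff_coe_sphere (n := 2)

lemma contMDiffAt_radialProj {y : E3} (h : y ≠ 0) :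
    ContMDiffAt 𝓘(ℝ, E3) (𝓡 2) ∞ radialProj y := by
  let U : TopologicalSpace.Opens E3 := ⟨{0}ᶜ, isOpen_compl_singleton⟩
  have hU : ∀ z : U, (z : E3) ≠ 0 := fun z => z.2
  have h1 : ContMDiff 𝓘(ℝ, E3) 𝓘(ℝ, E3) ∞ (fun z : U => ‖(z : E3)‖⁻¹ • (z : E3)) := by
    intro z
    have : ContDiffAt ℝ ∞ (fun w : E3 => ‖w‖⁻¹ • w) (z : E3) :=
      ((contDiffAt_norm ℝ (hU z)).inv (norm_ne_zero_iff.mpr (hU z))).smul contDiffAt_id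
    exact contMDiffAt_subtype_iff.mpr this.contMDiffAt
  have := fact_finrank_E3
  have h2 := h1.codRestrict_sphere (n := 2) (fun z => by
    rw [mem_sphere_zero_iff_norm, norm_smul, norm_inv, norm_norm,
      inv_mul_cancel₀ (norm_ne_zero_iff.mpr (hU z))])
  have h3 : (fun z : U => radialProj (z : E3)) =
      Set.codRestrict (fun z : U => ‖(z : E3)‖⁻¹ • (z : E3)) (Metric.sphere 0 1) (fun z => by
    rw [mem_sphere_zero_iff_norm, norm_smul, norm_inv, norm_norm,
      inv_mul_cancel₀ (norm_ne_zero_iff.mpr (hU z))]) := by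
    funext z
    ext1
    simp [coe_radialProj (hU z)]
  have h4 : ContMDiff 𝓘(ℝ, E3) (𝓡 2) ∞ (fun z : U => radialProj (z : E3)) := by
    rw [h3]; exact h2
  exact contMDiffAt_subtype_iff.mp (h4 ⟨y, h⟩)

/-- The extension of a function on `ℝ × S²` that is constant along rays. -/
def scriExt (φ : ℝ → S2 → ℝ) (p : ℝ × E3) : ℝ := φ p.1 (radialProj p.2)

/-- Composition with (u, y) ↦ (u, y/|y|) in one direction and restriction to ℝ × S² in the other.
All calculus is thereby moved from the manifold to `fderiv` on ℝ × ℝ³ away from the axis. -/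
lemma smoothOnScri_iff (φ : ℝ → S2 → ℝ) :
    SmoothOnScri φ ↔ ∀ p : ℝ × E3, p.2 ≠ 0 → ContDiffAt ℝ ∞ (scriExt φ) p := by
  constructor
  · intro h p hp
    have h1 : ContMDiffAt 𝓘(ℝ, ℝ × E3) (𝓘(ℝ, ℝ).prod (𝓡 2)) ∞
        (fun q : ℝ × E3 => (q.1, radialProj q.2)) p := by
      refine ContMDiffAt.prodMk (contDiff_fst.contDiffAt.contMDiffAt) ?_
      exact ContMDiffAt.comp p (contMDiffAt_radialProj hp) contDiff_snd.contDiffAt.contMDiffAt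
    exact (ContMDiffAt.comp p (h _) h1).contDiffAt
  · intro h p
    have h1 : ContMDiff (𝓘(ℝ, ℝ).prod (𝓡 2)) 𝓘(ℝ, ℝ × E3) ∞
        (fun p : ℝ × S2 => (p.1, (p.2 : E3))) :=
      ContMDiff.prodMk_space contMDiff_fst (contMDiff_coe_S2.comp contMDiff_snd)
    have h2 := ContMDiffAt.comp p
      (h (p.1, (p.2 : E3)) (coe_S2_ne_zero _)).contMDiffAt (h1 p)
    refine h2.congr_of_eventuallyEq (Eventually.of_forall fun q => ?_)
    simp [scriExt, radialProj_coe]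

lemma SmoothOnScri.of_contDiffAt {φ : ℝ → S2 → ℝ} {Ψ : ℝ × E3 → ℝ}
    (h : ∀ p : ℝ × E3, p.2 ≠ 0 → ContDiffAt ℝ ∞ Ψ p) (hφ : ∀ u x, φ u x = Ψ (u, (x : E3))) :
    SmoothOnScri φ := by
  intro p
  have h1 : ContMDiff (𝓘(ℝ, ℝ).prod (𝓡 2)) 𝓘(ℝ, ℝ × E3) ∞
      (fun p : ℝ × S2 => (p.1, (p.2 : E3))) :=
    ContMDiff.prodMk_space contMDiff_fst (contMDiff_coe_S2.comp contMDiff_snd)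
  have h2 := ContMDiffAt.comp p
    (h (p.1, (p.2 : E3)) (coe_S2_ne_zero _)).contMDiffAt (h1 p)
  refine h2.congr_of_eventuallyEq (Eventually.of_forall fun q => ?_)
  simp [hφ]

lemma SmoothOnS2.scri {φ : S2 → ℝ} (h : SmoothOnS2 φ) : SmoothOnScri (fun _ => φ) :=
  ContMDiff.comp (I' := 𝓡 2) h contMDiff_snd

lemma SmoothOnScri.slice {φ : ℝ → S2 → ℝ} (h : SmoothOnScri φ) (u : ℝ) : SmoothOnS2 (φ u) :=
  ContMDiff.comp (g := fun p : ℝ × S2 => φ p.1 p.2) (f := fun x : S2 => (u, x)) h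
    (contMDiff_const.prodMk contMDiff_id)

lemma SmoothOnScri.continuous {φ : ℝ → S2 → ℝ} (h : SmoothOnScri φ) :
    Continuous (fun p : ℝ × S2 => φ p.1 p.2) := ContMDiff.continuous h

lemma SmoothOnS2.continuous {φ : S2 → ℝ} (h : SmoothOnS2 φ) : Continuous φ :=
  ContMDiff.continuous h

/-- The `i`-th direction of `ℝ³`, as a direction of `ℝ × ℝ³`. -/
abbrev spaceDir (i : Fin 3) : ℝ × E3 := (0, EuclideanSpace.single i 1)

lemma fderiv_slice {Φ : ℝ × E3 → ℝ} {u : ℝ} {y : E3} (h : DifferentiableAt ℝ Φ (u, y)) (v : E3) :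
    fderiv ℝ (fun z => Φ (u, z)) y v = fderiv ℝ Φ (u, y) (0, v) := by
  have h1 : HasFDerivAt (fun z : E3 => (u, z)) (ContinuousLinearMap.inr ℝ ℝ E3) y :=
    hasFDerivAt_prodMk_right u y
  have h2 := (HasFDerivAt.comp (f := fun z : E3 => (u, z)) y h.hasFDerivAt h1).fderiv
  have h3 : fderiv ℝ (fun z => Φ (u, z)) y =
      (fderiv ℝ Φ (u, y)).comp (ContinuousLinearMap.inr ℝ ℝ E3) := h2
  rw [h3]; simp

lemma hasDerivAt_slice {Φ : ℝ × E3 → ℝ} {u : ℝ} {y : E3} (h : DifferentiableAt ℝ Φ (u, y)) :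
    HasDerivAt (fun s => Φ (s, y)) (fderiv ℝ Φ (u, y) (1, 0)) u := by
  have h1 : HasFDerivAt (fun s : ℝ => (s, y)) (ContinuousLinearMap.inl ℝ ℝ E3) u :=
    hasFDerivAt_prodMk_left u y
  have h2 := (HasFDerivAt.comp (f := fun s : ℝ => (s, y)) u h.hasFDerivAt h1).hasDerivAt
  simpa using! h2

lemma SmoothOnScri.differentiableAt {φ : ℝ → S2 → ℝ} (h : SmoothOnScri φ) (u : ℝ) {y : E3}
    (hy : y ≠ 0) : DifferentiableAt ℝ (scriExt φ) (u, y) :=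
  ((smoothOnScri_iff φ).mp h (u, y) hy).differentiableAt (by simp)

lemma SmoothOnScri.fderiv_radialExt {φ : ℝ → S2 → ℝ} (h : SmoothOnScri φ) (u : ℝ) {y : E3}
    (hy : y ≠ 0) (v : E3) :
    fderiv ℝ (radialExt (φ u)) y v = fderiv ℝ (scriExt φ) (u, y) (0, v) := by
  rw [(radialExt_eventuallyEq (φ u) hy).fderiv_eq, ← fderiv_slice (h.differentiableAt u hy)]
  rfl

lemma SmoothOnScri.tder_eq {φ : ℝ → S2 → ℝ} (h : SmoothOnScri φ) (i : Fin 3) (u : ℝ) (x : S2) :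
    tder i (φ u) x = fderiv ℝ (scriExt φ) (u, (x : E3)) (spaceDir i) :=
  h.fderiv_radialExt u (coe_S2_ne_zero x) _

lemma SmoothOnScri.hasDerivAt {φ : ℝ → S2 → ℝ} (h : SmoothOnScri φ) (u : ℝ) (x : S2) :
    HasDerivAt (fun s => φ s x) (fderiv ℝ (scriExt φ) (u, (x : E3)) (1, 0)) u := by
  have := hasDerivAt_slice (h.differentiableAt u (coe_S2_ne_zero x))
  simpa [scriExt, radialProj_coe] using this

lemma contDiffAt_fderiv_apply {Φ : ℝ × E3 → ℝ} {p v : ℝ × E3} (h : ContDiffAt ℝ ∞ Φ p) :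
    ContDiffAt ℝ ∞ (fun q => fderiv ℝ Φ q v) p :=
  (h.fderiv_right (m := ∞) (by simp)).clm_apply contDiffAt_const

lemma SmoothOnScri.tder {φ : ℝ → S2 → ℝ} (h : SmoothOnScri φ) (i : Fin 3) :
    SmoothOnScri (fun u => tder i (φ u)) :=
  .of_contDiffAt (fun p hp => contDiffAt_fderiv_apply (v := spaceDir i)
    ((smoothOnScri_iff φ).mp h p hp)) (fun u x => h.tder_eq i u x)

lemma SmoothOnScri.deriv {φ : ℝ → S2 → ℝ} (h : SmoothOnScri φ) :
    SmoothOnScri (fun u x => deriv (fun s => φ s x) u) :=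
  .of_contDiffAt (fun p hp => contDiffAt_fderiv_apply (v := (1, 0))
    ((smoothOnScri_iff φ).mp h p hp)) (fun u x => (h.hasDerivAt u x).deriv)

lemma SmoothOnS2.tder {φ : S2 → ℝ} (h : SmoothOnS2 φ) (i : Fin 3) : SmoothOnS2 (tder i φ) :=
  (h.scri.tder i).slice 0

lemma SmoothOnS2.contDiffAt {φ : S2 → ℝ} (h : SmoothOnS2 φ) {y : E3} (hy : y ≠ 0) :
    ContDiffAt ℝ ∞ (radialExt φ) y := by
  have h1 := (smoothOnScri_iff _).mp h.scri (0, y) hy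
  have h2 : ContDiffAt ℝ ∞ (fun z : E3 => ((0 : ℝ), z)) y := contDiffAt_const.prodMk contDiffAt_id
  exact (h1.comp y h2).congr_of_eventuallyEq (radialExt_eventuallyEq φ hy)

lemma SmoothOnS2.differentiableAt {φ : S2 → ℝ} (h : SmoothOnS2 φ) {y : E3} (hy : y ≠ 0) :
    DifferentiableAt ℝ (radialExt φ) y := (h.contDiffAt hy).differentiableAt (by simp)

lemma smoothOnS2_const (a : ℝ) : SmoothOnS2 (fun _ => a) := contMDiff_const

lemma SmoothOnS2.add {φ ψ : S2 → ℝ} (h : SmoothOnS2 φ) (h' : SmoothOnS2 ψ) :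
    SmoothOnS2 (φ + ψ) := ContMDiff.add h h'

lemma SmoothOnS2.mul {φ ψ : S2 → ℝ} (h : SmoothOnS2 φ) (h' : SmoothOnS2 ψ) :
    SmoothOnS2 (φ * ψ) := ContMDiff.mul h h'

lemma smoothOnS2_coord (k : Fin 3) : SmoothOnS2 (coord k) := by
  have h : ContMDiff 𝓘(ℝ, E3) 𝓘(ℝ, ℝ) ∞ (fun y : E3 => y k) :=
    (EuclideanSpace.proj (𝕜 := ℝ) k).contDiff.contMDiff
  exact h.comp contMDiff_coe_S2

lemma SmoothOnScri.add {φ ψ : ℝ → S2 → ℝ} (h : SmoothOnScri φ) (h' : SmoothOnScri ψ) :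
    SmoothOnScri (φ + ψ) := ContMDiff.add h h'

lemma SmoothOnScri.mul {φ ψ : ℝ → S2 → ℝ} (h : SmoothOnScri φ) (h' : SmoothOnScri ψ) :
    SmoothOnScri (φ * ψ) := ContMDiff.mul h h'

/-- The algebra of smooth functions on the sphere. -/
def smoothS2 : Subalgebra ℝ (S2 → ℝ) where
  carrier := {φ | SmoothOnS2 φ}
  mul_mem' h h' := h.mul h'
  add_mem' h h' := h.add h'
  algebraMap_mem' a := smoothOnS2_const a

/-! ### The tangential derivatives as derivations -/

lemma radialExt_add (φ ψ : S2 → ℝ) : radialExt (φ + ψ) = radialExt φ + radialExt ψ := by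
  funext y
  by_cases h : y = 0 <;> simp [radialExt, h]

lemma radialExt_mul (φ ψ : S2 → ℝ) : radialExt (φ * ψ) = radialExt φ * radialExt ψ := by
  funext y
  by_cases h : y = 0 <;> simp [radialExt, h]

lemma tder_add {φ ψ : S2 → ℝ} (h : SmoothOnS2 φ) (h' : SmoothOnS2 ψ) (i : Fin 3) :
    tder i (φ + ψ) = tder i φ + tder i ψ := by
  funext x
  have hx := coe_S2_ne_zero x
  simp [tder, radialExt_add, fderiv_add (h.differentiableAt hx) (h'.differentiableAt hx)]

lemma tder_mul {φ ψ : S2 → ℝ} (h : SmoothOnS2 φ) (h' : SmoothOnS2 ψ) (i : Fin 3) :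
    tder i (φ * ψ) = φ * tder i ψ + ψ * tder i φ := by
  funext x
  have hx := coe_S2_ne_zero x
  simp [tder, radialExt_mul, fderiv_mul (h.differentiableAt hx) (h'.differentiableAt hx),
    radialExt_coe]

lemma tder_const (a : ℝ) (i : Fin 3) : tder i (fun _ => a) = 0 := by
  funext x
  have : radialExt (fun _ => a) =ᶠ[𝓝 (x : E3)] fun _ => a := radialExt_eventuallyEq _
    (coe_S2_ne_zero x)
  simp [tder, this.fderiv_eq]

/-- The tangential derivative `D_i`, as a derivation of the algebra of smooth functions. -/
def D (i : Fin 3) : Derivation ℝ smoothS2 smoothS2 :=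
  Derivation.mk'
    { toFun := fun φ => ⟨tder i φ.1, SmoothOnS2.tder φ.2 i⟩
      map_add' := fun φ ψ => Subtype.ext (tder_add φ.2 ψ.2 i)
      map_smul' := fun a φ => Subtype.ext (by
        have h := tder_mul (smoothOnS2_const a) φ.2 i
        rw [tder_const, mul_zero, add_zero] at h
        exact h) }
    (fun φ ψ => Subtype.ext (tder_mul φ.2 ψ.2 i))

lemma coe_D (i : Fin 3) (φ : smoothS2) : ((D i φ : smoothS2) : S2 → ℝ) = tder i φ := rfl

/-- The standard coordinate functions, as smooth functions. -/
def X (k : Fin 3) : smoothS2 := ⟨coord k, smoothOnS2_coord k⟩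

lemma coe_X (k : Fin 3) : ((X k : smoothS2) : S2 → ℝ) = coord k := rfl

/-- The round metric, as a matrix of smooth functions. -/
def P (i j : Fin 3) : smoothS2 := (if i = j then 1 else 0) - X i * X j

lemma coe_P (i j : Fin 3) : ((P i j : smoothS2) : S2 → ℝ) = roundMetric i j := by
  funext x
  by_cases h : i = j <;> simp [P, roundMetric, h, coe_X]

lemma sum_coord_sq (x : S2) : ∑ i, coord i x * coord i x = 1 := by
  have h := norm_coe_S2 x
  rw [EuclideanSpace.norm_eq, Real.sqrt_eq_one] at h
  simpa [coord, sq] using h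

lemma sum_X_sq : ∑ i, X i * X i = 1 := by
  ext x
  simpa [coe_X] using sum_coord_sq x

lemma radialExt_coord (j : Fin 3) (y : E3) : radialExt (coord j) y = ‖y‖⁻¹ * y j := by
  by_cases h : y = 0 <;> simp [radialExt, coord, h]

lemma tder_coord (i j : Fin 3) (x : S2) : tder i (coord j) x = roundMetric i j x := by
  have hx := coe_S2_ne_zero x
  have h1 : radialExt (coord j) = fun y : E3 => ‖y‖⁻¹ * y j := funext (radialExt_coord j)
  have h2 : HasFDerivAt (fun y : E3 => ‖y‖) (innerSL ℝ (x : E3)) (x : E3) := by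
    have := (hasStrictFDerivAt_norm_sq (x : E3)).hasFDerivAt.sqrt (by simp)
    simp only [Real.sqrt_sq (norm_nonneg _), norm_coe_S2] at this
    convert! this using 1
    ext v; simp
  have h3 : HasFDerivAt (fun y : E3 => y j) (EuclideanSpace.proj (𝕜 := ℝ) j) (x : E3) :=
    (EuclideanSpace.proj (𝕜 := ℝ) j).hasFDerivAt
  have h4 := ((hasDerivAt_inv (norm_ne_zero_iff.mpr hx)).comp_hasFDerivAt _ h2).mul h3
  rw [tder, h1]
  erw [h4.fderiv]
  simp [roundMetric, coord, EuclideanSpace.inner_single_right, eq_comm]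
  ring

lemma D_X (i j : Fin 3) : D i (X j) = P i j := by
  ext x
  rw [coe_D, coe_X, tder_coord, coe_P]

lemma sum_coord_single (x : S2) :
    ∑ i, coord i x • (EuclideanSpace.single i 1 : E3) = (x : E3) := by
  ext j
  simp [coord, Pi.single_apply]

lemma radialExt_smul (φ : S2 → ℝ) {r : ℝ} (hr : 0 < r) (y : E3) :
    radialExt φ (r • y) = radialExt φ y := by
  by_cases h : y = 0
  · simp [h]
  · rw [radialExt_eq _ h, radialExt_eq _ (smul_ne_zero hr.ne' h)]
    congr 1
    ext1
    rw [coe_radialProj h, coe_radialProj (smul_ne_zero hr.ne' h), norm_smul, smul_smul,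
      Real.norm_of_nonneg hr.le]
    field_simp

/-- Euler's relation: the radial extension is homogeneous of degree zero. -/
lemma sum_coord_mul_tder {φ : S2 → ℝ} (h : SmoothOnS2 φ) (x : S2) :
    ∑ i, coord i x * tder i φ x = 0 := by
  have hx := coe_S2_ne_zero x
  have h1 : ∑ i, coord i x * tder i φ x = fderiv ℝ (radialExt φ) (x : E3) (x : E3) := by
    conv_rhs => rw [← congrArg (fderiv ℝ (radialExt φ) (x : E3)) (sum_coord_single x)]
    simp only [map_sum, map_smul, smul_eq_mul, tder]
  rw [h1]
  have h2 : HasDerivAt (fun r : ℝ => r • (x : E3)) (x : E3) 1 := by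
    simpa using (hasDerivAt_id (1 : ℝ)).smul_const (x : E3)
  have h3 : HasFDerivAt (radialExt φ) (fderiv ℝ (radialExt φ) (x : E3)) ((1 : ℝ) • (x : E3)) := by
    simpa using (h.differentiableAt hx).hasFDerivAt
  have h4 := h3.comp_hasDerivAt 1 h2
  have h5 : (radialExt φ ∘ fun r : ℝ => r • (x : E3)) =ᶠ[𝓝 1] fun _ => radialExt φ (x : E3) := by
    filter_upwards [lt_mem_nhds (zero_lt_one (α := ℝ))] with r hr
    exact radialExt_smul φ hr _
  exact h4.unique ((hasDerivAt_const 1 _).congr_of_eventuallyEq h5)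

lemma sum_X_D (φ : smoothS2) : ∑ i, X i * D i φ = 0 := by
  ext x
  simpa [coe_X, coe_D] using sum_coord_mul_tder φ.2 x

/-- Partial derivatives of a degree-zero homogeneous function have degree -1, so the factor ‖y‖
restores constancy along rays. This factor is the source of the curvature terms in second
derivatives. -/
lemma radialExt_tder {φ : S2 → ℝ} (i : Fin 3) {y : E3} (hy : y ≠ 0) :
    radialExt (tder i φ) y = ‖y‖ * fderiv ℝ (radialExt φ) y (EuclideanSpace.single i 1) := by
  have hr : 0 < ‖y‖⁻¹ := by positivity
  have h1 : (fun z : E3 => radialExt φ (‖y‖⁻¹ • z)) = radialExt φ := by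
    funext z; exact radialExt_smul φ hr z
  have h2 : fderiv ℝ (radialExt φ) y = ‖y‖⁻¹ • fderiv ℝ (radialExt φ) (‖y‖⁻¹ • y) := by
    have := fderiv_comp_smul (𝕜 := ℝ) (f := radialExt φ) (x := y) ‖y‖⁻¹
    rw [h1] at this
    exact this
  rw [radialExt_eq _ hy, tder, coe_radialProj hy, h2]
  have : ‖y‖ ≠ 0 := norm_ne_zero_iff.mpr hy
  simp
  field_simp

lemma tder_tder {φ : S2 → ℝ} (h : SmoothOnS2 φ) (i j : Fin 3) (x : S2) :
    tder i (tder j φ) x = coord i x * tder j φ x +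
      fderiv ℝ (fderiv ℝ (radialExt φ)) (x : E3) (EuclideanSpace.single i 1)
        (EuclideanSpace.single j 1) := by
  have hx := coe_S2_ne_zero x
  have h1 : radialExt (tder j φ) =ᶠ[𝓝 (x : E3)]
      fun y => ‖y‖ * fderiv ℝ (radialExt φ) y (EuclideanSpace.single j 1) := by
    filter_upwards [isOpen_ne.mem_nhds hx] with z hz using radialExt_tder j hz
  have h2 : HasFDerivAt (fun y : E3 => ‖y‖) (innerSL ℝ (x : E3)) (x : E3) := by
    have := (hasStrictFDerivAt_norm_sq (x : E3)).hasFDerivAt.sqrt (by simp)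
    simp only [Real.sqrt_sq (norm_nonneg _), norm_coe_S2] at this
    convert! this using 1
    ext v; simp
  have h3 : DifferentiableAt ℝ (fderiv ℝ (radialExt φ)) (x : E3) :=
    ((h.contDiffAt hx).fderiv_right (m := 1) (by norm_cast)).differentiableAt (by simp)
  have h4 := h2.mul (h3.hasFDerivAt.clm_apply (hasFDerivAt_const
    (EuclideanSpace.single j (1 : ℝ) : E3) (x : E3)))
  rw [tder, h1.fderiv_eq]
  erw [h4.fderiv]
  simp [coord, tder, EuclideanSpace.inner_single_right]
  ring

/-- Ambient second derivatives are symmetric. The first order terms come from differentiating the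
factor ‖y‖ of `radialExt_tder`. -/
lemma tder_comm {φ : S2 → ℝ} (h : SmoothOnS2 φ) (i j : Fin 3) (x : S2) :
    tder i (tder j φ) x =
      tder j (tder i φ) x + coord i x * tder j φ x - coord j x * tder i φ x := by
  have hs : IsSymmSndFDerivAt ℝ (radialExt φ) (x : E3) :=
    (h.contDiffAt (coe_S2_ne_zero x)).isSymmSndFDerivAt (by simp; norm_cast)
  rw [tder_tder h i j, tder_tder h j i, hs.eq]
  ring

lemma D_comm (i j : Fin 3) (φ : smoothS2) :
    D i (D j φ) = D j (D i φ) + X i * D j φ - X j * D i φ := by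
  ext x
  simpa [coe_D, coe_X] using tder_comm φ.2 i j x

/-! ### Time derivatives and shifts along the generators -/

lemma SmoothOnScri.hasDerivAt_deriv {φ : ℝ → S2 → ℝ} (h : SmoothOnScri φ) (u : ℝ) (x : S2) :
    HasDerivAt (fun s => φ s x) (_root_.deriv (fun s => φ s x) u) u :=
  (h.hasDerivAt u x).differentiableAt.hasDerivAt

/-- Symmetry of the mixed second derivative of the extension to ℝ × ℝ³. -/
lemma SmoothOnScri.hasDerivAt_tder {φ : ℝ → S2 → ℝ} (h : SmoothOnScri φ) (i : Fin 3) (u : ℝ)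
    (x : S2) :
    HasDerivAt (fun s => NullInfinity.tder i (φ s) x)
      (NullInfinity.tder i (fun y => _root_.deriv (fun s => φ s y) u) x) u := by
  have hx := coe_S2_ne_zero x
  have hp := (smoothOnScri_iff φ).mp h
  have hd : ∀ y : E3, y ≠ 0 → DifferentiableAt ℝ (fderiv ℝ (scriExt φ)) (u, y) := fun y hy =>
    ((hp (u, y) hy).fderiv_right (m := 1) (by norm_cast)).differentiableAt (by simp)
  have h1 : DifferentiableAt ℝ (fun q => fderiv ℝ (scriExt φ) q (spaceDir i)) (u, (x : E3)) :=
    (hd x hx).clm_apply (differentiableAt_const _)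
  have h2 := hasDerivAt_slice h1
  have h3 : (fun s => NullInfinity.tder i (φ s) x) =
      fun s => fderiv ℝ (scriExt φ) (s, (x : E3)) (spaceDir i) := by
    funext s; exact h.tder_eq i s x
  rw [h3]
  convert h2 using 1
  have h4 : radialExt (fun y => _root_.deriv (fun s => φ s y) u) =ᶠ[𝓝 (x : E3)]
      fun y => fderiv ℝ (scriExt φ) (u, y) (1, 0) := by
    filter_upwards [isOpen_ne.mem_nhds hx] with z hz
    rw [radialExt_eq _ hz]
    exact (hasDerivAt_slice (h.differentiableAt u hz)).deriv
  have h5 : DifferentiableAt ℝ (fun q => fderiv ℝ (scriExt φ) q (1, 0)) (u, (x : E3)) :=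
    (hd x hx).clm_apply (differentiableAt_const _)
  have hs : IsSymmSndFDerivAt ℝ (scriExt φ) (u, (x : E3)) := (hp _ hx).isSymmSndFDerivAt (by simp; norm_cast)
  rw [NullInfinity.tder, h4.fderiv_eq, fderiv_slice h5,
    fderiv_clm_apply (hd x hx) (differentiableAt_const _),
    fderiv_clm_apply (hd x hx) (differentiableAt_const _)]
  simpa using hs.eq _ _

lemma SmoothOnScri.shift {φ : ℝ → S2 → ℝ} (h : SmoothOnScri φ) {f : S2 → ℝ}
    (hf : SmoothOnS2 f) : SmoothOnScri (fun u x => φ (u + f x) x) := by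
  have h1 : ContMDiff (𝓘(ℝ, ℝ).prod (𝓡 2)) 𝓘(ℝ, ℝ) ∞ (fun p : ℝ × S2 => p.1 + f p.2) :=
    ContMDiff.add contMDiff_fst (ContMDiff.comp (I' := 𝓡 2) hf contMDiff_snd)
  exact ContMDiff.comp (g := fun p : ℝ × S2 => φ p.1 p.2)
    (f := fun p : ℝ × S2 => (p.1 + f p.2, p.2)) h (h1.prodMk contMDiff_snd)

lemma SmoothOnScri.tder_shift {φ : ℝ → S2 → ℝ} (h : SmoothOnScri φ) {f : S2 → ℝ}
    (hf : SmoothOnS2 f) (i : Fin 3) (u : ℝ) (x : S2) :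
    NullInfinity.tder i (fun y => φ (u + f y) y) x = NullInfinity.tder i (φ (u + f x)) x +
      _root_.deriv (fun s => φ s x) (u + f x) * NullInfinity.tder i f x := by
  have hx := coe_S2_ne_zero x
  have h1 : radialExt (fun y => φ (u + f y) y) =ᶠ[𝓝 (x : E3)]
      fun y => scriExt φ (u + radialExt f y, y) := by
    filter_upwards [isOpen_ne.mem_nhds hx] with z hz
    rw [radialExt_eq _ hz, radialExt_eq _ hz]; rfl
  have h2 : HasFDerivAt (fun y : E3 => (u + radialExt f y, y))
      ((fderiv ℝ (radialExt f) (x : E3)).prod (ContinuousLinearMap.id ℝ E3)) (x : E3) :=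
    ((hf.differentiableAt hx).hasFDerivAt.const_add u).prodMk (hasFDerivAt_id _)
  have h3 : HasFDerivAt (scriExt φ) (fderiv ℝ (scriExt φ) (u + f x, (x : E3)))
      (u + radialExt f x, (x : E3)) := by
    rw [radialExt_coe]
    exact (h.differentiableAt _ hx).hasFDerivAt
  have h4 := HasFDerivAt.comp (f := fun y : E3 => (u + radialExt f y, y)) (x : E3) h3 h2
  rw [NullInfinity.tder, h1.fderiv_eq, h.tder_eq, (h.hasDerivAt _ x).deriv]
  erw [h4.fderiv]
  set L := fderiv ℝ (scriExt φ) (u + f x, (x : E3))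
  simp only [ContinuousLinearMap.comp_apply, ContinuousLinearMap.prod_apply,
    ContinuousLinearMap.id_apply]
  have h5 : ((fderiv ℝ (radialExt f) (x : E3)) (EuclideanSpace.single i 1),
      (EuclideanSpace.single i 1 : E3)) =
      NullInfinity.tder i f x • ((1 : ℝ), (0 : E3)) + spaceDir i := by
    simp [NullInfinity.tder]
  rw [h5, map_add, map_smul, smul_eq_mul]
  ring

/-! ### Integration over the sphere -/

/-- The surface measure of the unit sphere. -/
abbrev σ : Measure S2 := (volume : Measure E3).toSphere

lemma continuousAt_radialProj {y : E3} (h : y ≠ 0) : ContinuousAt radialProj y :=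
  (contMDiffAt_radialProj h).continuousAt

/-- Polar coordinates: the exponent 2 in `Measure.volumeIoiPow` is the Jacobian r². -/
lemma integral_radial_mul (a : ℝ → ℝ) (ψ : S2 → ℝ) :
    ∫ y : E3, a ‖y‖ * ψ (radialProj y) =
      (∫ x, ψ x ∂σ) * ∫ r : Set.Ioi (0 : ℝ), a r ∂(Measure.volumeIoiPow 2) := by
  have h1 := (volume : Measure E3).measurePreserving_homeomorphUnitSphereProd.integral_comp
    (Homeomorph.measurableEmbedding _)
    (fun p : S2 × Set.Ioi (0 : ℝ) => ψ p.1 * a p.2)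
  have h2 : Module.finrank ℝ E3 - 1 = 2 := by simp
  rw [h2, integral_prod_mul ψ (fun r : Set.Ioi (0 : ℝ) => a r)] at h1
  have h0 : ∫ y : E3, a ‖y‖ * ψ (radialProj y) =
      ∫ y : ({0}ᶜ : Set E3), a ‖(y : E3)‖ * ψ (radialProj y) ∂((volume : Measure E3).comap (↑)) := by
    rw [integral_subtype_comap (measurableSet_singleton _).compl
      (fun y : E3 => a ‖y‖ * ψ (radialProj y)), restrict_compl_singleton]
  rw [← h1, h0]
  congr 1
  funext y
  have hy : (y : E3) ≠ 0 := y.2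
  have h3 : radialProj (y : E3) = (homeomorphUnitSphereProd E3 y).1 := by
    ext1
    rw [coe_radialProj hy]
    simp
  rw [h3, mul_comm]
  simp

lemma integrable_radial_mul {a : ℝ → ℝ} (ha : Continuous a) (ha' : ∀ r, r ∉ Set.Icc (1 : ℝ) 3 → a r = 0)
    {ψ : S2 → ℝ} (hψ : Continuous ψ) : Integrable (fun y : E3 => a ‖y‖ * ψ (radialProj y)) := by
  apply Continuous.integrable_of_hasCompactSupport
  · rw [continuous_iff_continuousAt]
    intro y
    by_cases hy : y = 0
    · have : (fun y : E3 => a ‖y‖ * ψ (radialProj y)) =ᶠ[𝓝 y] fun _ => 0 := by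
        filter_upwards [Metric.ball_mem_nhds y one_pos] with z hz
        rw [hy, mem_ball_zero_iff] at hz
        rw [ha' _ (fun h => by linarith [h.1]), zero_mul]
      exact this.continuousAt
    · exact (ha.comp continuous_norm).continuousAt.mul
        (hψ.continuousAt.comp (continuousAt_radialProj hy))
  · apply HasCompactSupport.intro (isCompact_closedBall (0 : E3) 3)
    intro y hy
    rw [mem_closedBall_zero_iff] at hy
    rw [ha' _ (fun h => hy h.2), zero_mul]

/-- A smooth cutoff in the radial direction. -/
def radialBump : ContDiffBump (2 : ℝ) := ⟨1 / 2, 1, by norm_num, by norm_num⟩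

lemma radialBump_eq_zero {r : ℝ} (hr : r ∉ Set.Icc (1 : ℝ) 3) : radialBump r = 0 := by
  apply radialBump.zero_of_le_dist
  by_contra h
  have h' : dist r 2 < 1 := not_le.mp h
  rw [Real.dist_eq, abs_lt] at h'
  exact hr ⟨by linarith, by linarith⟩

/-- The radial factor used for integrating by parts. -/
def radialFactor (r : ℝ) : ℝ := r * radialBump r

lemma contDiff_radialFactor : ContDiff ℝ ∞ radialFactor := contDiff_id.mul radialBump.contDiff

lemma radialFactor_eq_zero {r : ℝ} (hr : r ∉ Set.Icc (1 : ℝ) 3) : radialFactor r = 0 := by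
  simp [radialFactor, radialBump_eq_zero hr]

lemma deriv_radialFactor_eq_zero {r : ℝ} (hr : r ∉ Set.Icc (1 : ℝ) 3) :
    deriv radialFactor r = 0 := by
  have : radialFactor =ᶠ[𝓝 r] fun _ => 0 := by
    filter_upwards [isClosed_Icc.isOpen_compl.mem_nhds hr] with s hs using radialFactor_eq_zero hs
  rw [this.deriv_eq]; simp

/-- Integration by parts in ℝ³ of a radial cutoff against ∂_i of the radial extension; polar
coordinates then split off the radial integrals. The factor r in `radialFactor` absorbs the ‖y‖ of
`radialExt_tder`. -/
lemma integral_tder_aux (i : Fin 3) {φ : S2 → ℝ} (h : SmoothOnS2 φ) :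
    (∫ x, tder i φ x ∂σ) * ∫ r : Set.Ioi (0 : ℝ), radialBump r ∂(Measure.volumeIoiPow 2) =
    - ((∫ x, coord i x * φ x ∂σ) *
      ∫ r : Set.Ioi (0 : ℝ), deriv radialFactor r ∂(Measure.volumeIoiPow 2)) := by
  rw [← integral_radial_mul, ← integral_radial_mul]
  have e1 : (fun y : E3 => radialBump ‖y‖ * tder i φ (radialProj y)) =
      fun y => ContinuousLinearMap.mul ℝ ℝ (radialFactor ‖y‖)
        (fderiv ℝ (radialExt φ) y (EuclideanSpace.single i 1)) := by
    funext y
    by_cases hy : y = 0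
    · simp [hy, radialFactor, radialBump_eq_zero (r := 0) (by simp)]
    · have := radialExt_tder (φ := φ) i hy
      rw [radialExt_eq _ hy] at this
      simp [this, radialFactor]; ring
  have e2 : (fun y : E3 => deriv radialFactor ‖y‖ * (coord i (radialProj y) * φ (radialProj y))) =
      fun y => ContinuousLinearMap.mul ℝ ℝ (deriv radialFactor ‖y‖ * coord i (radialProj y))
        (radialExt φ y) := by
    funext y
    by_cases hy : y = 0
    · simp [hy, deriv_radialFactor_eq_zero (r := 0) (by simp)]
    · rw [radialExt_eq _ hy]; simp; ring
  rw [e1, e2]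
  -- The radial extension need not be differentiable at the origin, so the cutoff has to be
  -- supported away from it.
  have hc : ∀ r, r ∈ tsupport radialFactor → 1 ≤ r := by
    have : tsupport radialFactor ⊆ Set.Icc 1 3 := closure_minimal (fun r hr => by
      by_contra h'; exact hr (radialFactor_eq_zero h')) isClosed_Icc
    exact fun r hr => (this hr).1
  have hder : Continuous (deriv radialFactor) := contDiff_radialFactor.continuous_deriv (by simp)
  apply integral_bilinear_hasLineDerivAt_right_eq_neg_left_of_integrable
    (v := (EuclideanSpace.single i 1 : E3))
  · rw [← e2]
    exact integrable_radial_mul hder (fun r => deriv_radialFactor_eq_zero)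
      ((smoothOnS2_coord i).continuous.mul h.continuous)
  · rw [← e1]
    exact integrable_radial_mul radialBump.continuous (fun r => radialBump_eq_zero)
      (h.tder i).continuous
  · have := integrable_radial_mul contDiff_radialFactor.continuous
      (fun r => radialFactor_eq_zero) h.continuous
    convert! this using 2 with y
    by_cases hy : y = 0
    · simp [hy, radialFactor]
    · rw [radialExt_eq _ hy]; simp
  · intro y _
    by_cases hy : y = 0
    · have h0 : (fun y : E3 => radialFactor ‖y‖) =ᶠ[𝓝 y] fun _ => 0 := by
        filter_upwards [Metric.ball_mem_nhds y one_pos] with z hz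
        rw [hy, mem_ball_zero_iff] at hz
        exact radialFactor_eq_zero (fun h => by linarith [h.1])
      have h1 : HasFDerivAt (fun y : E3 => radialFactor ‖y‖) (0 : E3 →L[ℝ] ℝ) y :=
        (hasFDerivAt_const (0 : ℝ) y).congr_of_eventuallyEq h0
      have h2 := h1.hasLineDerivAt (EuclideanSpace.single i 1)
      simpa [hy, deriv_radialFactor_eq_zero (r := 0) (by simp)] using h2
    · have h1 : HasFDerivAt (fun z : E3 => ‖z‖) (‖y‖⁻¹ • innerSL ℝ y) y := by
        have := (hasStrictFDerivAt_norm_sq y).hasFDerivAt.sqrt (by simpa using hy)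
        simp only [Real.sqrt_sq (norm_nonneg _)] at this
        convert! this using 1
        ext v; simp; ring
      have h2 := ((contDiff_radialFactor.differentiable (by simp)) ‖y‖).hasDerivAt
      have h3 := (h2.comp_hasFDerivAt y h1).hasLineDerivAt (EuclideanSpace.single i 1)
      convert! h3 using 1
      simp [coord, coe_radialProj hy, EuclideanSpace.inner_single_right]
  · intro y hy
    have hy1 : ‖y‖ ∈ tsupport radialFactor :=
      tsupport_comp_subset_preimage radialFactor continuous_norm hy
    have hy0 : y ≠ 0 := by
      rintro rfl
      have := hc _ hy1
      simp at this
      linarith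
    exact (h.differentiableAt hy0).hasFDerivAt.hasLineDerivAt _

lemma integral_radialBump_ne_zero :
    ∫ r : Set.Ioi (0 : ℝ), radialBump r ∂(Measure.volumeIoiPow 2) ≠ 0 := by
  have h1 := integral_radial_mul radialBump (fun _ => 1)
  have h2 : 0 < ∫ y : E3, radialBump ‖y‖ * (1 : ℝ) := by
    simp only [mul_one]
    refine Continuous.integral_pos_of_hasCompactSupport_nonneg_nonzero
      (x := EuclideanSpace.single 0 2)
      (radialBump.continuous.comp continuous_norm) ?_ (fun y => radialBump.nonneg) ?_
    · apply HasCompactSupport.intro (isCompact_closedBall (0 : E3) 3)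
      intro y hy
      rw [mem_closedBall_zero_iff] at hy
      exact radialBump_eq_zero (fun h => hy h.2)
    · have : radialBump ‖(EuclideanSpace.single 0 2 : E3)‖ = 1 := by
        apply radialBump.one_of_mem_closedBall
        simp [radialBump]
      rw [this]; exact one_ne_zero
  intro h0
  rw [h1, h0, mul_zero] at h2
  exact lt_irrefl _ h2

lemma integrable_of_continuous {φ : S2 → ℝ} (h : Continuous φ) : Integrable φ σ :=
  h.integrable_of_hasCompactSupport (HasCompactSupport.of_compactSpace φ)

/-- Integration over the sphere, as a linear functional on smooth functions. -/
def I : smoothS2 →ₗ[ℝ] ℝ where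
  toFun φ := sphereInt φ
  map_add' φ ψ := integral_add (integrable_of_continuous (SmoothOnS2.continuous φ.2))
    (integrable_of_continuous (SmoothOnS2.continuous ψ.2))
  map_smul' a _ := integral_const_mul a _

lemma I_apply (φ : smoothS2) : I φ = sphereInt φ := rfl

lemma I_one_pos : 0 < I 1 := by
  have h : σ.real Set.univ = I 1 := by
    simp [I_apply, sphereInt]
  rw [← h]
  exact measureReal_univ_pos

/-- The divergence theorem on the sphere. -/
theorem I_D (i : Fin 3) (φ : smoothS2) : I (D i φ) = 2 * I (X i * φ) := by
  set a := ∫ r : Set.Ioi (0 : ℝ), deriv radialFactor r ∂(Measure.volumeIoiPow 2) with ha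
  set b := ∫ r : Set.Ioi (0 : ℝ), radialBump r ∂(Measure.volumeIoiPow 2) with hb
  have hb0 : b ≠ 0 := integral_radialBump_ne_zero
  have key : ∀ (i : Fin 3) (φ : smoothS2), I (D i φ) * b = - (I (X i * φ) * a) :=
    fun i φ => integral_tder_aux i φ.2
  -- The ratio a/b of radial integrals does not depend on φ, so it is read off from φ = X_i summed
  -- over i, where Σ D_i X_i = 3 - 1 = 2 and Σ X_i² = 1.
  have h1 : ∑ i, I (D i (X i)) * b = ∑ i, - (I (X i * X i) * a) :=
    Finset.sum_congr rfl fun i _ => key i (X i)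
  have h2 : ∑ i, I (D i (X i)) = 2 * I 1 := by
    rw [← map_sum]
    have : ∑ i, D i (X i) = (3 : ℝ) • (1 : smoothS2) - ∑ i, X i * X i := by
      simp only [D_X, P, if_true, Finset.sum_sub_distrib]
      congr 1
      simp only [Finset.sum_const, Finset.card_univ, Fintype.card_fin]
      rw [← Nat.cast_smul_eq_nsmul ℝ]; norm_num
    rw [this, sum_X_sq, map_sub, map_smul, smul_eq_mul]; ring
  have h3 : ∑ i, I (X i * X i) = I 1 := by rw [← map_sum, sum_X_sq]
  rw [← Finset.sum_mul, Finset.sum_neg_distrib, ← Finset.sum_mul, h2, h3] at h1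
  have h4 : a = -2 * b := by
    have := I_one_pos.ne'
    apply mul_left_cancel₀ this
    linarith
  have h5 := key i φ
  rw [h4] at h5
  apply mul_right_cancel₀ hb0
  linarith

/-! ### Tensor calculus in the algebra of smooth functions -/

/-- The constant function `1/2`. -/
def half : smoothS2 := algebraMap ℝ smoothS2 (1 / 2)

lemma two_mul_half : 2 * half = 1 := by
  ext x
  change (2 : ℝ) * (1 / 2) = 1
  norm_num

lemma D_half (i : Fin 3) : D i half = 0 := (D i).map_algebraMap _

lemma I_half_mul (φ : smoothS2) : I (half * φ) = 1 / 2 * I φ := by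
  rw [half, ← Algebra.smul_def, map_smul, smul_eq_mul]

/-- The Laplacian. -/
def Lap (φ : smoothS2) : smoothS2 := ∑ i, D i (D i φ)

/-- The divergence of a symmetric traceless tangential tensor. -/
def Dv (T : Fin 3 → Fin 3 → smoothS2) (j : Fin 3) : smoothS2 := ∑ i, D i (T i j)

/-- The double divergence of a symmetric traceless tangential tensor. -/
def DDv (T : Fin 3 → Fin 3 → smoothS2) : smoothS2 := ∑ j, D j (Dv T j)

/-- The closed part of a symmetric traceless tensor with potential `φ`. -/
def Cl (φ : smoothS2) (i j : Fin 3) : smoothS2 :=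
  D i (D j φ) + X j * D i φ - half * P i j * Lap φ

/-- The volume form. -/
def eps : Fin 3 → Fin 3 → smoothS2 := ![![0, X 2, -X 1], ![-X 2, 0, X 0], ![X 1, -X 0, 0]]

/-- The co-closed part of a symmetric traceless tensor with potential `φ`. -/
def Co (φ : smoothS2) (i j : Fin 3) : smoothS2 := ∑ e, eps i e * Cl φ e j

/-- Symmetric traceless tangential 2-tensors. -/
structure STF (T : Fin 3 → Fin 3 → smoothS2) : Prop where
  tangent : ∀ j, ∑ i, X i * T i j = 0
  symm : ∀ i j, T i j = T j i
  traceless : ∑ i, T i i = 0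

/-- The full contraction of two tensors. -/
def dot (S T : Fin 3 → Fin 3 → smoothS2) : smoothS2 := ∑ i, ∑ j, S i j * T i j

lemma sum_X_sq' : X 0 * X 0 + X 1 * X 1 + X 2 * X 2 = 1 := by
  simpa [Fin.sum_univ_three] using sum_X_sq

lemma sum_X_D' (φ : smoothS2) : X 0 * D 0 φ + X 1 * D 1 φ + X 2 * D 2 φ = 0 := by
  simpa [Fin.sum_univ_three] using sum_X_D φ

lemma P_symm (i j : Fin 3) : P i j = P j i := by
  simp only [P, eq_comm, mul_comm]

lemma P_mul_D (j : Fin 3) (φ : smoothS2) : ∑ i, P i j * D i φ = D j φ := by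
  have h := sum_X_D φ
  simp only [P, sub_mul, Finset.sum_sub_distrib, ite_mul, one_mul, zero_mul, Finset.sum_ite_eq',
    Finset.mem_univ, if_true]
  have h2 : ∑ i, X i * X j * D i φ = X j * ∑ i, X i * D i φ := by
    rw [Finset.mul_sum]; exact Finset.sum_congr rfl fun i _ => by ring
  rw [h2, h]; ring

lemma P_diag : P 0 0 + P 1 1 + P 2 2 = 2 := by
  have := sum_X_sq'
  simp only [P, if_true]
  linear_combination -this

lemma D_P (k i j : Fin 3) : D k (P i j) = - (X j * P k i + X i * P k j) := by
  have h : D k (if i = j then (1 : smoothS2) else 0) = 0 := by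
    split_ifs <;> simp
  rw [P, map_sub, h, Derivation.leibniz, D_X, D_X, smul_eq_mul, smul_eq_mul]
  ring

lemma sum_X_P (j : Fin 3) : X 0 * P 0 j + X 1 * P 1 j + X 2 * P 2 j = 0 := by
  have h := sum_X_sq'
  fin_cases j <;> simp [P] <;> [linear_combination - X 0 * h; linear_combination - X 1 * h;
    linear_combination - X 2 * h]

lemma sum_X_D_D (j : Fin 3) (φ : smoothS2) :
    X 0 * D j (D 0 φ) + X 1 * D j (D 1 φ) + X 2 * D j (D 2 φ) = - D j φ := by
  have h := congrArg (D j) (sum_X_D' φ)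
  have h2 := P_mul_D j φ
  simp only [map_add, Derivation.leibniz, smul_eq_mul, D_X, map_zero, P_symm j] at h
  simp only [Fin.sum_univ_three] at h2
  linear_combination h - h2

lemma Cl_eq (φ : smoothS2) (i j : Fin 3) :
    Cl φ i j = D j (D i φ) + X i * D j φ - half * P i j * Lap φ := by
  rw [Cl, D_comm i j]; ring

/-- Commuting derivatives gives ∇^i∇_i∇_j φ = ∇_j(Δφ + φ), the last term being the Ricci curvature
of the unit sphere. Removing the trace subtracts ½∇_jΔφ. That the divergence is a gradient is used
throughout. -/
lemma Dv_Cl (φ : smoothS2) (j : Fin 3) : Dv (Cl φ) j = D j (half * Lap φ + φ) := by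
  have h := fun i => D_comm i j (D i φ)
  have h1 := sum_X_D_D j φ
  have h2 := sum_X_D' (D j φ)
  have h3 := P_diag
  have h4 := sum_X_P j
  have h5 := P_mul_D j (Lap φ)
  have h6 : Lap φ = D 0 (D 0 φ) + D 1 (D 1 φ) + D 2 (D 2 φ) := by simp [Lap, Fin.sum_univ_three]
  have h7 := congrArg (D j) h6
  have h8 := two_mul_half
  simp only [Fin.sum_univ_three, map_add] at h5 h7
  simp only [Dv, Fin.sum_univ_three, Cl_eq, map_add, map_sub, Derivation.leibniz, smul_eq_mul, D_X,
    D_P, D_half]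
  linear_combination h 0 + h 1 + h 2 + h1 + h2 + (D j φ + half * X j * Lap φ) * h3
    - half * h5 + half * Lap φ * h4 - h7 + X j * h6 - D j (Lap φ) * h8 + X j * Lap φ * h8

lemma stf_Cl (φ : smoothS2) : STF (Cl φ) where
  tangent j := by
    have h1 := sum_X_D' (D j φ)
    have h2 := sum_X_D' φ
    have h3 := sum_X_P j
    simp only [Fin.sum_univ_three, Cl]
    linear_combination h1 + X j * h2 - half * Lap φ * h3
  symm i j := by rw [Cl_eq, Cl, P_symm i j]
  traceless := by
    have h2 := sum_X_D' φ
    have h3 := P_diag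
    have h6 : Lap φ = D 0 (D 0 φ) + D 1 (D 1 φ) + D 2 (D 2 φ) := by simp [Lap, Fin.sum_univ_three]
    have h8 := two_mul_half
    simp only [Fin.sum_univ_three, Cl]
    linear_combination h2 - half * Lap φ * h3 - h6 - Lap φ * h8

variable {T : Fin 3 → Fin 3 → smoothS2}

lemma STF.tangent' (h : STF T) (j : Fin 3) : X 0 * T 0 j + X 1 * T 1 j + X 2 * T 2 j = 0 := by
  simpa [Fin.sum_univ_three] using h.tangent j

lemma STF.tangent_right (h : STF T) (j : Fin 3) :
    X 0 * T j 0 + X 1 * T j 1 + X 2 * T j 2 = 0 := by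
  rw [h.symm j 0, h.symm j 1, h.symm j 2]
  exact h.tangent' j

lemma STF.traceless' (h : STF T) : T 0 0 + T 1 1 + T 2 2 = 0 := by
  simpa [Fin.sum_univ_three] using h.traceless

lemma STF.P_mul (h : STF T) (k j : Fin 3) : P k 0 * T 0 j + P k 1 * T 1 j + P k 2 * T 2 j = T k j := by
  have h1 := h.tangent' j
  fin_cases k <;> simp [P] <;> [linear_combination - X 0 * h1; linear_combination - X 1 * h1;
    linear_combination - X 2 * h1]

lemma STF.Dv_eq (h : STF T) (j : Fin 3) : Dv T j = ∑ i, D i (T j i) :=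
  Finset.sum_congr rfl fun i _ => by rw [h.symm]

lemma STF.tangent_Dv (h : STF T) : X 0 * Dv T 0 + X 1 * Dv T 1 + X 2 * Dv T 2 = 0 := by
  have h1 := fun i => congrArg (D i) (h.tangent' i)
  have h2 := h.P_mul
  have h3 := h.traceless'
  simp only [map_add, Derivation.leibniz, smul_eq_mul, D_X, map_zero] at h1
  simp only [h.Dv_eq, Fin.sum_univ_three]
  linear_combination h1 0 + h1 1 + h1 2 - h2 0 0 - h2 1 1 - h2 2 2 - h3

/-- Integration by parts against a tangential vector field. -/
lemma I_mul_D (V : Fin 3 → smoothS2) (hV : X 0 * V 0 + X 1 * V 1 + X 2 * V 2 = 0) (φ : smoothS2) :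
    I (∑ i, V i * D i φ) = - I (φ * ∑ i, D i (V i)) := by
  have h1 : ∑ i, D i (V i * φ) = ∑ i, V i * D i φ + φ * ∑ i, D i (V i) := by
    simp [Fin.sum_univ_three]; ring
  have h2 : ∑ i, X i * (V i * φ) = 0 := by
    simp only [Fin.sum_univ_three]; linear_combination φ * hV
  have h3 : I (∑ i, D i (V i * φ)) = 2 * I (∑ i, X i * (V i * φ)) := by
    simp only [map_sum, I_D, Finset.mul_sum]
  rw [h1, h2, map_add, map_zero] at h3
  linarith

lemma I_Lap_mul (φ ψ : smoothS2) : I (Lap φ * ψ) = - I (∑ i, D i φ * D i ψ) := by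
  rw [I_mul_D (fun i => D i φ) (sum_X_D' φ), neg_neg, Lap, mul_comm]

lemma I_Lap_symm (φ ψ : smoothS2) : I (Lap φ * ψ) = I (φ * Lap ψ) := by
  rw [I_Lap_mul, mul_comm φ, I_Lap_mul]
  simp only [mul_comm]

lemma I_DDv_mul (h : STF T) (ψ : smoothS2) : I (ψ * DDv T) = - I (∑ j, Dv T j * D j ψ) := by
  rw [I_mul_D (Dv T) h.tangent_Dv ψ, neg_neg, DDv]

lemma I_Dv_mul (h : STF T) (V : Fin 3 → smoothS2) :
    I (∑ j, Dv T j * V j) = - I (∑ i, ∑ j, T i j * D i (V j)) := by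
  have h1 : ∑ j, Dv T j * V j = ∑ j, V j * ∑ i, D i (T i j) :=
    Finset.sum_congr rfl fun j _ => by rw [Dv, mul_comm]
  rw [h1, map_sum, Finset.sum_comm, map_sum, ← Finset.sum_neg_distrib]
  refine Finset.sum_congr rfl fun j _ => ?_
  rw [I_mul_D (fun i => T i j) (h.tangent' j), neg_neg]

lemma STF.dot_Cl (h : STF T) (ψ : smoothS2) : dot T (Cl ψ) = ∑ i, ∑ j, T i j * D i (D j ψ) := by
  have h1 := h.tangent_right
  have h2 := h.P_mul
  have h3 := h.traceless'
  simp only [dot, Cl, Fin.sum_univ_three]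
  linear_combination D 0 ψ * h1 0 + D 1 ψ * h1 1 + D 2 ψ * h1 2
    - half * Lap ψ * (h2 0 0 + h2 1 1 + h2 2 2 + h3 + (T 0 1 - T 1 0) * P_symm 0 1
      + (T 0 2 - T 2 0) * P_symm 0 2 + (T 1 2 - T 2 1) * P_symm 1 2)

/-- Two integrations by parts: on symmetric traceless tangential tensors `Cl` is the adjoint of the
double divergence, since the trace part and the normal correction of the Hessian pair to zero. -/
lemma I_dot_Cl (h : STF T) (ψ : smoothS2) : I (dot T (Cl ψ)) = I (ψ * DDv T) := by
  rw [h.dot_Cl, I_DDv_mul h, I_Dv_mul h, neg_neg]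

lemma DDv_Cl (φ : smoothS2) : DDv (Cl φ) = Lap (half * Lap φ + φ) := by
  simp only [DDv, Dv_Cl, Lap]

/-! ### The co-closed part -/

lemma eps_antisymm (i j : Fin 3) : eps i j = - eps j i := by
  fin_cases i <;> fin_cases j <;> simp [eps]

lemma sum_X_eps (j : Fin 3) : X 0 * eps 0 j + X 1 * eps 1 j + X 2 * eps 2 j = 0 := by
  fin_cases j <;> simp [eps] <;> ring

lemma eps_mul_eps (e f : Fin 3) :
    eps 0 e * eps 0 f + eps 1 e * eps 1 f + eps 2 e * eps 2 f = P e f := by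
  have h := sum_X_sq'
  fin_cases e <;> fin_cases f <;> simp [eps, P] <;> first | ring1 | linear_combination h

/-- ε is the quarter turn of the tangent plane. Composed with a symmetric traceless endomorphism it
is traceless by symmetry, and symmetric by tracelessness. -/
lemma STF.eps_mul (h : STF T) : STF (fun i j => ∑ e, eps i e * T e j) := by
  have h1 := h.tangent'
  have h3 := h.traceless'
  have h4 := fun i j => h.symm i j
  have hs : ∀ i j, ∑ e, eps i e * T e j = ∑ e, eps j e * T e i := by
    have h01 : ∑ e, eps 0 e * T e 1 = ∑ e, eps 1 e * T e 0 := by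
      simp [eps, Fin.sum_univ_three]
      linear_combination X 2 * h3 - h1 2 + X 0 * h4 0 2 + X 1 * h4 1 2
    have h02 : ∑ e, eps 0 e * T e 2 = ∑ e, eps 2 e * T e 0 := by
      simp [eps, Fin.sum_univ_three]
      linear_combination - X 1 * h3 + h1 1 - X 0 * h4 0 1 - X 2 * h4 2 1
    have h12 : ∑ e, eps 1 e * T e 2 = ∑ e, eps 2 e * T e 1 := by
      simp [eps, Fin.sum_univ_three]
      linear_combination X 0 * h3 - h1 0 + X 1 * h4 1 0 + X 2 * h4 2 0
    intro i j
    fin_cases i <;> fin_cases j <;> first | rfl | assumption | (symm; assumption)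
  refine ⟨fun j => ?_, hs, ?_⟩
  · simp only [Fin.sum_univ_three]
    have := sum_X_eps
    linear_combination T 0 j * this 0 + T 1 j * this 1 + T 2 j * this 2
  · simp [eps, Fin.sum_univ_three]
    linear_combination X 2 * h4 1 0 + X 1 * h4 0 2 + X 0 * h4 2 1

lemma stf_Co (φ : smoothS2) : STF (Co φ) := (stf_Cl φ).eps_mul

/-- The quarter turn is an isometry, so the co-closed and the closed part with the same potential
have the same norm. -/
lemma STF.dot_eps_mul (h : STF T) :
    dot (fun i j => ∑ e, eps i e * T e j) (fun i j => ∑ e, eps i e * T e j) = dot T T := by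
  have h1 := eps_mul_eps
  have h2 := h.P_mul
  have key : ∀ j, ∑ i, (∑ e, eps i e * T e j) * (∑ e, eps i e * T e j) = ∑ e, T e j * T e j := by
    intro j
    simp only [Fin.sum_univ_three]
    linear_combination T 0 j * T 0 j * h1 0 0 + T 1 j * T 1 j * h1 1 1 + T 2 j * T 2 j * h1 2 2
      + 2 * T 0 j * T 1 j * h1 0 1 + 2 * T 0 j * T 2 j * h1 0 2 + 2 * T 1 j * T 2 j * h1 1 2
      + T 0 j * h2 0 j + T 1 j * h2 1 j + T 2 j * h2 2 j
      + T 0 j * T 1 j * P_symm 0 1 + T 0 j * T 2 j * P_symm 0 2 + T 1 j * T 2 j * P_symm 1 2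
  simp only [dot]
  rw [Finset.sum_comm, Finset.sum_congr rfl fun j _ => key j, Finset.sum_comm]

/-- ε is parallel and hence commutes with the divergence. -/
lemma STF.Dv_eps_mul (h : STF T) (j : Fin 3) :
    Dv (fun i j => ∑ e, eps i e * T e j) j = ∑ e, eps j e * Dv T e := by
  have hs := h.symm
  have ht := h.tangent_right
  rw [h.eps_mul.Dv_eq]
  have d : ∀ i k, D i (X k) = (if i = k then 1 else 0) - X i * X k := fun i k => by rw [D_X, P]
  fin_cases j <;> simp [eps, Fin.sum_univ_three, h.Dv_eq, d]
  · linear_combination X 1 * ht 2 - X 2 * ht 1 + hs 1 2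
  · linear_combination X 2 * ht 0 - X 0 * ht 2 + hs 2 0
  · linear_combination X 0 * ht 1 - X 1 * ht 0 + hs 0 1

lemma Dv_Co (φ : smoothS2) (j : Fin 3) : Dv (Co φ) j = ∑ e, eps j e * Dv (Cl φ) e :=
  (stf_Cl φ).Dv_eps_mul j

/-- The curl of a gradient: the antisymmetric ε sees only the commutators of the D_i. With `Dv_Cl`
it makes the double divergence of the co-closed part vanish. -/
lemma sum_D_eps_D (w : smoothS2) : ∑ j, D j (∑ e, eps j e * D e w) = 0 := by
  have d : ∀ i k, D i (X k) = (if i = k then 1 else 0) - X i * X k := fun i k => by rw [D_X, P]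
  simp [eps, Fin.sum_univ_three, d]
  linear_combination X 2 * D_comm 0 1 w + X 0 * D_comm 1 2 w + X 1 * D_comm 2 0 w

lemma DDv_Co (φ : smoothS2) : DDv (Co φ) = 0 := by
  simp only [DDv, Dv_Co, Dv_Cl]
  exact sum_D_eps_D _

/-! ### The space `L²(S²)` -/

/-- Smooth functions as continuous functions. -/
def toC : smoothS2 →ₐ[ℝ] C(S2, ℝ) where
  toFun φ := ⟨φ, SmoothOnS2.continuous φ.2⟩
  map_one' := rfl
  map_mul' _ _ := rfl
  map_zero' := rfl
  map_add' _ _ := rfl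
  commutes' _ := rfl

lemma toC_apply (φ : smoothS2) (x : S2) : toC φ x = φ.1 x := rfl

/-- The Hilbert space of square integrable functions on the sphere. -/
abbrev H : Type := Lp ℝ 2 σ

/-- Smooth functions as square integrable functions. -/
def ι : smoothS2 →ₗ[ℝ] H :=
  (ContinuousMap.toLp (E := ℝ) 2 σ ℝ).toLinearMap ∘ₗ toC.toLinearMap

lemma inner_ι (φ ψ : smoothS2) : inner ℝ (ι φ) (ι ψ) = I (φ * ψ) := by
  have := ContinuousMap.inner_toLp (𝕜 := ℝ) σ (toC φ) (toC ψ)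
  refine this.trans (integral_congr_ae (Eventually.of_forall fun x => ?_))
  simp [toC_apply, mul_comm]

lemma I_mul_self (φ : smoothS2) : I (φ * φ) = ‖ι φ‖ ^ 2 := by
  rw [← inner_ι, real_inner_self_eq_norm_sq]

lemma I_mul_self_nonneg (φ : smoothS2) : 0 ≤ I (φ * φ) := by
  rw [I_mul_self]; positivity

lemma abs_I_mul_le (φ ψ : smoothS2) : |I (φ * ψ)| ≤ ‖ι φ‖ * ‖ι ψ‖ := by
  rw [← inner_ι]; exact abs_real_inner_le_norm _ _

lemma norm_ι_le_of_forall_abs_le {φ : smoothS2} {a : ℝ} (ha : 0 ≤ a) (h : ∀ x, |φ.1 x| ≤ a) :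
    ‖ι φ‖ ≤ Real.sqrt (I 1) * a := by
  rw [← Real.sqrt_sq (norm_nonneg (ι φ)), ← I_mul_self, ← Real.sqrt_sq ha,
    ← Real.sqrt_mul I_one_pos.le]
  apply Real.sqrt_le_sqrt
  have h1 : I 1 * a ^ 2 = ∫ _ : S2, a ^ 2 ∂σ := by
    have : σ.real Set.univ = I 1 := by simp [I_apply, sphereInt]
    rw [integral_const, this, smul_eq_mul]
  rw [h1]
  refine integral_mono (integrable_of_continuous (SmoothOnS2.continuous (φ * φ).2))
    (integrable_const _) (fun x => ?_)
  change φ.1 x * φ.1 x ≤ a ^ 2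
  rw [← abs_mul_abs_self]
  nlinarith [h x, abs_nonneg (φ.1 x)]

/-! ### Polynomials on the sphere and the spectral gap -/

/-- Polynomials of degree less than `n` in the standard coordinate functions. -/
def U : ℕ → Submodule ℝ smoothS2
  | 0 => ⊥
  | n + 1 => Submodule.span ℝ {1} ⊔ U n ⊔ ⨆ i, (U n).map (LinearMap.mulLeft ℝ (X i))

lemma U_succ_le {n : ℕ} {S : Submodule ℝ smoothS2} (h1 : 1 ∈ S) (h2 : ∀ φ ∈ U n, φ ∈ S)
    (h3 : ∀ φ ∈ U n, ∀ i, X i * φ ∈ S) : U (n + 1) ≤ S := by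
  refine sup_le (sup_le ?_ h2) (iSup_le fun i => ?_)
  · rw [Submodule.span_le]; simpa using h1
  · rintro _ ⟨φ, hφ, rfl⟩
    exact h3 φ hφ i

lemma one_mem_U (n : ℕ) : 1 ∈ U (n + 1) :=
  Submodule.mem_sup_left (Submodule.mem_sup_left (Submodule.mem_span_singleton_self 1))

lemma U_le_succ (n : ℕ) : U n ≤ U (n + 1) :=
  fun _ h => Submodule.mem_sup_left (Submodule.mem_sup_right h)

lemma U_mono : Monotone U := monotone_nat_of_le_succ U_le_succ

lemma X_mul_mem_U {n : ℕ} {φ : smoothS2} (h : φ ∈ U n) (i : Fin 3) : X i * φ ∈ U (n + 1) :=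
  Submodule.mem_sup_right (Submodule.mem_iSup_of_mem i ⟨φ, h, rfl⟩)

instance finiteDimensional_U : ∀ n, FiniteDimensional ℝ (U n)
  | 0 => inferInstanceAs (FiniteDimensional ℝ (⊥ : Submodule ℝ smoothS2))
  | n + 1 => by
    have := finiteDimensional_U n
    exact inferInstanceAs (FiniteDimensional ℝ (Submodule.span ℝ {1} ⊔ U n ⊔
      ⨆ i, (U n).map (LinearMap.mulLeft ℝ (X i)) : Submodule ℝ smoothS2))

lemma mul_mem_U {n : ℕ} {φ : smoothS2} (h : φ ∈ U n) {m : ℕ} {ψ : smoothS2} (h' : ψ ∈ U m) :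
    φ * ψ ∈ U (n + m) := by
  induction n generalizing φ with
  | zero =>
    rw [U, Submodule.mem_bot] at h
    rw [h, zero_mul]; exact zero_mem _
  | succ n ih =>
    have : U (n + 1) ≤ (U (n + 1 + m)).comap (LinearMap.mulRight ℝ ψ) := by
      refine U_succ_le ?_ (fun φ hφ => ?_) (fun φ hφ i => ?_)
      · simpa using U_mono (by omega) h'
      · exact U_mono (by omega) (ih hφ)
      · have := X_mul_mem_U (ih hφ) i
        rw [Submodule.mem_comap, LinearMap.mulRight_apply, mul_assoc]
        exact U_mono (by omega) this
    exact this h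

/-- The subalgebra of polynomials on the sphere. -/
def polyS2 : Subalgebra ℝ smoothS2 where
  carrier := {φ | ∃ n, φ ∈ U n}
  mul_mem' := fun ⟨_, h⟩ ⟨_, h'⟩ => ⟨_, mul_mem_U h h'⟩
  add_mem' := fun ⟨n, h⟩ ⟨m, h'⟩ => ⟨max n m, add_mem (U_mono (le_max_left _ _) h)
    (U_mono (le_max_right _ _) h')⟩
  algebraMap_mem' a := ⟨1, by
    rw [Algebra.algebraMap_eq_smul_one]
    exact Submodule.smul_mem _ _ (one_mem_U 0)⟩

/-- Stone–Weierstrass: the coordinates X_k separate points. -/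
lemma exists_poly_near (c : smoothS2) {δ : ℝ} (hδ : 0 < δ) :
    ∃ n, ∃ p ∈ U n, ∀ x, |p.1 x - c.1 x| ≤ δ := by
  have hsep : (polyS2.map toC).SeparatesPoints := by
    intro x y hxy
    by_contra hcon
    push Not at hcon
    apply hxy
    ext k
    have hk : toC (X k) ∈ polyS2.map toC :=
      ⟨X k, ⟨2, by simpa using X_mul_mem_U (one_mem_U 0) k⟩, rfl⟩
    exact hcon _ ⟨toC (X k), hk, rfl⟩
  obtain ⟨⟨_, p, ⟨n, hp⟩, rfl⟩, h⟩ :=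
    ContinuousMap.exists_mem_subalgebra_near_continuousMap_of_separatesPoints
      (polyS2.map toC) hsep (toC c) δ hδ
  refine ⟨n, p, hp, fun x => ?_⟩
  have h2 := (ContinuousMap.norm_lt_iff _ hδ).mp h x
  exact h2.le

/-- Since D_i X_j = δ_ij - X_i X_j, differentiating a polynomial of degree n can raise the degree by
one, and the part of degree n + 1 is -n X_i φ. -/
lemma D_add_mem_U {n : ℕ} {φ : smoothS2} (h : φ ∈ U (n + 1)) (i : Fin 3) :
    D i φ + (n : ℝ) • (X i * φ) ∈ U (n + 1) := by
  have key : U (n + 1) ≤ (U (n + 1)).comap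
      ((D i).toLinearMap + (n : ℝ) • LinearMap.mulLeft ℝ (X i)) := by
    clear h
    induction n with
    | zero =>
      refine U_succ_le ?_ (fun φ hφ => ?_) (fun φ hφ j => ?_)
      · simp
      · rw [U, Submodule.mem_bot] at hφ
        rw [hφ]; exact zero_mem _
      · rw [U, Submodule.mem_bot] at hφ
        rw [hφ, mul_zero]; exact zero_mem _
    | succ n ih =>
      have ih' : ∀ φ ∈ U (n + 1), D i φ + (n : ℝ) • (X i * φ) ∈ U (n + 1) := fun φ hφ => ih hφ
      refine U_succ_le ?_ (fun φ hφ => ?_) (fun φ hφ j => ?_)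
      · have h1 := X_mul_mem_U (one_mem_U n) i
        have h2 := Submodule.smul_mem _ ((n + 1 : ℕ) : ℝ) h1
        simpa using h2
      · have h1 := U_le_succ _ (ih' φ hφ)
        have h2 := add_mem h1 (X_mul_mem_U hφ i)
        simp only [Submodule.mem_comap, LinearMap.add_apply, LinearMap.smul_apply,
          LinearMap.mulLeft_apply] at h2 ⊢
        convert! h2 using 1
        push_cast
        module
      · have h1 := X_mul_mem_U (ih' φ hφ) j
        have h2 := U_le_succ _ (Submodule.smul_mem _ (if i = j then (1 : ℝ) else 0) hφ)
        have h3 := add_mem h1 h2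
        change D i (X j * φ) + ((n + 1 : ℕ) : ℝ) • (X i * (X j * φ)) ∈ U (n + 2)
        convert h3 using 1
        simp only [Derivation.leibniz, D_X, P, smul_eq_mul]
        have e1 : (if i = j then (1 : ℝ) else 0) • φ = (if i = j then (1 : smoothS2) else 0) * φ := by
          split_ifs <;> simp
        rw [e1]
        simp only [Algebra.smul_def, map_natCast]
        push_cast
        ring
  exact key h

lemma Lap_X_mul (i : Fin 3) (φ : smoothS2) :
    Lap (X i * φ) = X i * Lap φ + 2 * D i φ - 2 * (X i * φ) := by
  have h1 := P_mul_D i φ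
  have h2 := P_diag
  have h3 := sum_X_P i
  simp only [Fin.sum_univ_three] at h1
  simp only [Lap, Fin.sum_univ_three, Derivation.leibniz, map_add, smul_eq_mul, D_X, D_P]
  linear_combination 2 * h1 - φ * X i * h2 - φ * h3

/-- The Laplacian is triangular for the degree filtration with -n(n+1) as diagonal entry in degree
n. In the induction, multiplication by X_j adds 2n + 2 = (n+1)(n+2) - n(n+1), of which 2n comes from
2 D_j and 2 from Δ X_j = -2 X_j. -/
lemma Lap_add_mem_U {n : ℕ} {φ : smoothS2} (h : φ ∈ U (n + 1)) :
    Lap φ + ((n : ℝ) * (n + 1)) • φ ∈ U n := by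
  let L : smoothS2 →ₗ[ℝ] smoothS2 := ∑ i, (D i).toLinearMap ∘ₗ (D i).toLinearMap
  have hL : ∀ φ, L φ = Lap φ := fun φ => by simp [L, Lap]
  have h1 : Lap 1 = 0 := by simp [Lap]
  have key : U (n + 1) ≤ (U n).comap (L + ((n : ℝ) * (n + 1)) • LinearMap.id) := by
    clear h
    induction n with
    | zero =>
      refine U_succ_le ?_ (fun φ hφ => ?_) (fun φ hφ j => ?_)
      · simp [hL, h1]
      · rw [U, Submodule.mem_bot] at hφ
        rw [hφ]; exact zero_mem _
      · rw [U, Submodule.mem_bot] at hφ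
        rw [hφ, mul_zero]; exact zero_mem _
    | succ n ih =>
      have ih' := fun φ (hφ : φ ∈ U (n + 1)) => ih hφ
      simp only [Submodule.mem_comap, LinearMap.add_apply, LinearMap.smul_apply, hL,
        LinearMap.id_apply] at ih'
      refine U_succ_le ?_ (fun φ hφ => ?_) (fun φ hφ j => ?_) <;>
      simp only [Submodule.mem_comap, LinearMap.add_apply, LinearMap.smul_apply, hL,
        LinearMap.id_apply]
      · rw [h1, zero_add]
        exact Submodule.smul_mem _ _ (one_mem_U n)
      · have h2 := add_mem (U_le_succ _ (ih' φ hφ))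
          (Submodule.smul_mem _ (2 * (n : ℝ) + 2) hφ)
        convert! h2 using 1
        push_cast
        module
      · have h2 := add_mem (X_mul_mem_U (ih' φ hφ) j)
          (Submodule.smul_mem _ (2 : ℝ) (D_add_mem_U hφ j))
        convert! h2 using 1
        rw [Lap_X_mul]
        simp only [Algebra.smul_def, map_mul, map_add, map_natCast, map_ofNat, map_one]
        push_cast
        ring
  simpa [hL] using key h

lemma Lap_mem_U {n : ℕ} {φ : smoothS2} (h : φ ∈ U n) : Lap φ ∈ U n := by
  cases n with
  | zero =>
    rw [U, Submodule.mem_bot] at h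
    rw [h]; simp [Lap]
  | succ n =>
    have h1 := U_le_succ _ (Lap_add_mem_U h)
    have h2 := sub_mem h1 (Submodule.smul_mem _ ((n : ℝ) * (n + 1)) h)
    simpa using h2

lemma exists_proj (n : ℕ) (c : smoothS2) : ∃ v ∈ U n, ∀ w ∈ U n, I ((c - v) * w) = 0 := by
  obtain ⟨v, hv, hv'⟩ : (((U n).map ι).starProjection (ι c)) ∈ (U n).map ι :=
    Submodule.starProjection_apply_mem _ _
  refine ⟨v, hv, fun w hw => ?_⟩
  rw [← inner_ι, map_sub, hv']
  exact Submodule.starProjection_inner_eq_zero _ _ ⟨w, hw, rfl⟩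

/-- Peel off the top degree: write v = v' + w with v' in `U n` and w orthogonal to `U n`. Cross
terms vanish because Δ is symmetric and preserves `U n`. By `Lap_add_mem_U` the Rayleigh quotient of
w is exactly -n(n+1), which is at most -6 for n ≥ 2. -/
lemma spectral_gap_U {n : ℕ} {v : smoothS2} (hv : v ∈ U n) (h : ∀ w ∈ U 2, I (v * w) = 0) :
    I (v * Lap v) ≤ -6 * I (v * v) := by
  induction n generalizing v with
  | zero =>
    have hv2 := U_mono (by omega : 0 ≤ 2) hv
    rw [h v hv2, h _ (Lap_mem_U hv2)]; simp
  | succ n ih =>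
    -- In degree at most one, v is itself an admissible test function, so both sides vanish.
    rcases Nat.lt_or_ge n 2 with hn | hn
    · have hv2 := U_mono (by omega : n + 1 ≤ 2) hv
      rw [h v hv2, h _ (Lap_mem_U hv2)]; simp
    obtain ⟨v', hv', ho⟩ := exists_proj n v
    set w := v - v' with hw
    have hv_eq : v = v' + w := by rw [hw]; ring
    have hwU : w ∈ U (n + 1) := sub_mem hv (U_le_succ _ hv')
    have h1 := ih hv' (fun y hy => by
      have h1 := h y hy
      have h2 := ho y (U_mono hn hy)
      rw [hv_eq, add_mul, map_add, h2, add_zero] at h1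
      exact h1)
    have e0 : Lap v = Lap v' + Lap w := by
      rw [hv_eq]; simp [Lap, Finset.sum_add_distrib]
    have e1 : I (w * Lap v') = 0 := ho _ (Lap_mem_U hv')
    have e2 : I (v' * Lap w) = 0 := by rw [← I_Lap_symm, mul_comm, e1]
    have e3 : I (w * Lap w) + (n : ℝ) * (n + 1) * I (w * w) = 0 := by
      have := ho _ (Lap_add_mem_U hwU)
      rwa [mul_add, map_add, mul_smul_comm, map_smul, smul_eq_mul] at this
    have e4 : I (w * v') = 0 := ho _ hv'
    have e5 : I (v * Lap v) = I (v' * Lap v') + I (w * Lap w) := by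
      rw [e0, hv_eq, show (v' + w) * (Lap v' + Lap w) =
        v' * Lap v' + v' * Lap w + w * Lap v' + w * Lap w by ring]
      simp only [map_add, e1, e2]; ring
    have e6 : I (v * v) = I (v' * v') + I (w * w) := by
      rw [hv_eq, show (v' + w) * (v' + w) = v' * v' + w * v' + w * v' + w * w by ring]
      simp only [map_add, e4]; ring
    have hn' : (2 : ℝ) ≤ n := by exact_mod_cast hn
    rw [e5, e6]
    nlinarith [I_mul_self_nonneg w, mul_nonneg (by nlinarith : 0 ≤ (n : ℝ) * (n + 1) - 6)
      (I_mul_self_nonneg w)]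

/-- A function is supported in the modes `ℓ ≥ 2`, tested on the functions `1` and `X k`. -/
def Perp (c : smoothS2) : Prop := I c = 0 ∧ ∀ i, I (X i * c) = 0

lemma Perp.mul_eq_zero {c : smoothS2} (h : Perp c) {w : smoothS2} (hw : w ∈ U 2) :
    I (c * w) = 0 := by
  have h0 : ∀ w ∈ U 1, I (c * w) = 0 := fun w hw => by
    have : U 1 ≤ LinearMap.ker (I ∘ₗ LinearMap.mulLeft ℝ c) := by
      refine U_succ_le ?_ (fun φ hφ => ?_) (fun φ hφ i => ?_)
      · simpa using h.1
      · rw [U, Submodule.mem_bot] at hφ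
        rw [hφ]; exact zero_mem _
      · rw [U, Submodule.mem_bot] at hφ
        rw [hφ, mul_zero]; exact zero_mem _
    exact this hw
  have h1 : ∀ w ∈ U 1, ∃ a : ℝ, w = a • 1 := fun w hw => by
    have : U 1 ≤ Submodule.span ℝ {1} := by
      refine U_succ_le (Submodule.mem_span_singleton_self 1) (fun φ hφ => ?_) (fun φ hφ i => ?_)
      · rw [U, Submodule.mem_bot] at hφ
        rw [hφ]; exact zero_mem _
      · rw [U, Submodule.mem_bot] at hφ
        rw [hφ, mul_zero]; exact zero_mem _
    obtain ⟨a, ha⟩ := Submodule.mem_span_singleton.mp (this hw)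
    exact ⟨a, ha.symm⟩
  have : U 2 ≤ LinearMap.ker (I ∘ₗ LinearMap.mulLeft ℝ c) := by
    refine U_succ_le ?_ (fun φ hφ => h0 φ hφ) (fun φ hφ i => ?_)
    · simpa using h.1
    · obtain ⟨a, rfl⟩ := h1 φ hφ
      have := h.2 i
      simp [mul_comm c, this]
  exact this hw

/-- The spectral gap of the Laplacian on functions supported in the modes `ℓ ≥ 2`. -/
theorem Perp.spectral_gap {c : smoothS2} (h : Perp c) : I (c * Lap c) ≤ -6 * I (c * c) := by
  -- Approximation of c in L² is enough. With v the projection of c to polynomials and r = c - v,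
  -- symmetry of Δ gives ∫ cΔc = ∫ vΔv + ∫ rΔc, so no derivative falls on the remainder. The error
  -- is 6‖r‖² + ‖r‖‖Δc‖.
  have key : ∀ δ > 0, I (c * Lap c) ≤ -6 * I (c * c) + (6 * δ + ‖ι (Lap c)‖) * δ := by
    intro δ hδ
    set a := Real.sqrt (I 1) with ha
    have ha0 : 0 < a := Real.sqrt_pos.mpr I_one_pos
    obtain ⟨n, p, hp, hpc⟩ := exists_poly_near c (div_pos hδ ha0)
    wlog hn : 2 ≤ n generalizing n
    · exact this 2 (U_mono (by omega) hp) le_rfl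
    obtain ⟨v, hv, ho⟩ := exists_proj n c
    set r := c - v with hr
    have hc : c = v + r := by rw [hr]; ring
    have h1 : ‖ι (p - c)‖ ≤ δ := by
      have := norm_ι_le_of_forall_abs_le (φ := p - c) (div_pos hδ ha0).le hpc
      rwa [← ha, mul_div_cancel₀ _ ha0.ne'] at this
    have h2 : I (r * r) ≤ δ ^ 2 := by
      have e1 : I ((p - c) * (p - c)) = I ((p - v) * (p - v)) + I (r * r) := by
        rw [show (p - c) * (p - c) = (p - v) * (p - v) + r * r - r * (p - v) - r * (p - v) by
          rw [hr]; ring, map_sub, map_sub, map_add, ho _ (sub_mem hp hv)]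
        ring
      have e2 := I_mul_self_nonneg (p - v)
      rw [I_mul_self (p - c)] at e1
      nlinarith [norm_nonneg (ι (p - c))]
    have h3 : ‖ι r‖ ≤ δ := by
      rw [I_mul_self] at h2
      exact (sq_le_sq₀ (norm_nonneg _) hδ.le).mp h2
    have h4 := spectral_gap_U hv (fun w hw => by
      have e1 := h.mul_eq_zero hw
      have e2 := ho w (U_mono hn hw)
      rw [hc, add_mul, map_add, e2, add_zero] at e1
      exact e1)
    have h5 : I (c * Lap c) = I (v * Lap v) + I (r * Lap c) := by
      have e1 : I (v * Lap c) = I (v * Lap v) := by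
        rw [← I_Lap_symm, mul_comm, hc, add_mul, map_add, ho _ (Lap_mem_U hv), add_zero]
      rw [← e1, ← map_add, ← add_mul, ← hc]
    have h6 : I (c * c) = I (v * v) + I (r * r) := by
      have e1 := ho v hv
      rw [hc, show (v + r) * (v + r) = v * v + r * v + r * v + r * r by ring]
      simp only [map_add, e1]; ring
    have h7 := (le_abs_self _).trans (abs_I_mul_le r (Lap c))
    have h8 := mul_le_mul_of_nonneg_right h3 (norm_nonneg (ι (Lap c)))
    nlinarith
  have h2 : Tendsto (fun δ : ℝ => -6 * I (c * c) + (6 * δ + ‖ι (Lap c)‖) * δ) (𝓝[>] 0)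
      (𝓝 (-6 * I (c * c) + (6 * 0 + ‖ι (Lap c)‖) * 0)) := by
    apply tendsto_nhdsWithin_of_tendsto_nhds
    apply Continuous.tendsto
    fun_prop
  rw [mul_zero, add_zero] at h2
  exact ge_of_tendsto h2 (eventually_mem_nhdsWithin.mono fun δ hδ => key δ hδ)

/-! ### Estimates for the potentials -/

lemma exists_norm_ι_mul_le (a : smoothS2) : ∃ K, 0 ≤ K ∧ ∀ φ, ‖ι (a * φ)‖ ≤ K * ‖ι φ‖ := by
  refine ⟨‖toC a‖, norm_nonneg _, fun φ => ?_⟩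
  rw [← sq_le_sq₀ (norm_nonneg _) (by positivity), mul_pow, ← I_mul_self, ← I_mul_self]
  have h1 : ‖toC a‖ ^ 2 * I (φ * φ) = ∫ x, ‖toC a‖ ^ 2 * (φ.1 x * φ.1 x) ∂σ :=
    (integral_const_mul _ _).symm
  rw [h1]
  refine integral_mono (integrable_of_continuous (SmoothOnS2.continuous (a * φ * (a * φ)).2))
    ((integrable_of_continuous (SmoothOnS2.continuous (φ * φ).2)).const_mul _) (fun x => ?_)
  change a.1 x * φ.1 x * (a.1 x * φ.1 x) ≤ ‖toC a‖ ^ 2 * (φ.1 x * φ.1 x)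
  have h2 : |a.1 x| ≤ ‖toC a‖ := (toC a).norm_coe_le_norm x
  have h3 : a.1 x ^ 2 ≤ ‖toC a‖ ^ 2 := sq_le_sq' (by linarith [(abs_le.mp h2).1]) (abs_le.mp h2).2
  nlinarith [mul_self_nonneg (φ.1 x)]

lemma Perp.norm_le {c : smoothS2} (h : Perp c) : 6 * ‖ι c‖ ≤ ‖ι (Lap c)‖ := by
  have h1 := h.spectral_gap
  have h2 := (abs_le.mp (abs_I_mul_le c (Lap c))).1
  rw [I_mul_self] at h1
  by_contra! hlt
  nlinarith [norm_nonneg (ι c), norm_nonneg (ι (Lap c))]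

lemma Perp.norm_D_sq_le {c : smoothS2} (h : Perp c) (i : Fin 3) :
    6 * ‖ι (D i c)‖ ^ 2 ≤ ‖ι (Lap c)‖ ^ 2 := by
  have h1 := I_Lap_mul c c
  have h2 := (abs_le.mp (abs_I_mul_le (Lap c) c)).1
  have h3 : I (D i c * D i c) ≤ I (∑ i, D i c * D i c) := by
    rw [map_sum]
    exact Finset.single_le_sum (f := fun i => I (D i c * D i c))
      (fun i _ => I_mul_self_nonneg (D i c)) (Finset.mem_univ i)
  rw [I_mul_self] at h3
  nlinarith [h.norm_le, norm_nonneg (ι c), norm_nonneg (ι (Lap c))]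

lemma I_dot_Cl_self (c : smoothS2) :
    I (dot (Cl c) (Cl c)) = 1 / 2 * ‖ι (Lap c)‖ ^ 2 + I (c * Lap c) := by
  rw [I_dot_Cl (stf_Cl c), DDv_Cl, ← I_Lap_symm, mul_add, map_add, mul_left_comm, I_half_mul,
    I_mul_self, mul_comm c]

/-- The spectral gap gives |∫ cΔc| ≤ ‖Δc‖²/6, and ½ - 1/6 = 1/3 of ‖Δc‖² survives in
`I_dot_Cl_self`. -/
lemma Perp.norm_Lap_sq_le {c : smoothS2} (h : Perp c) :
    ‖ι (Lap c)‖ ^ 2 ≤ 3 * I (dot (Cl c) (Cl c)) := by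
  rw [I_dot_Cl_self]
  have h2 := (abs_le.mp (abs_I_mul_le c (Lap c))).1
  nlinarith [h.norm_le, norm_nonneg (ι c), norm_nonneg (ι (Lap c))]

lemma norm_sq_le_I_dot (T : Fin 3 → Fin 3 → smoothS2) (i j : Fin 3) :
    ‖ι (T i j)‖ ^ 2 ≤ I (dot T T) := by
  rw [← I_mul_self, dot, map_sum]
  have h1 : ∀ i, 0 ≤ I (∑ j, T i j * T i j) := fun i => by
    rw [map_sum]; exact Finset.sum_nonneg fun j _ => I_mul_self_nonneg _
  refine le_trans ?_ (Finset.single_le_sum (f := fun i => I (∑ j, T i j * T i j))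
    (fun i _ => h1 i) (Finset.mem_univ i))
  rw [map_sum]
  exact Finset.single_le_sum (f := fun j => I (T i j * T i j))
      (fun j _ => I_mul_self_nonneg _) (Finset.mem_univ j)

/-- The sum of the `L²` norms of the components of a tensor. -/
def size (T : Fin 3 → Fin 3 → smoothS2) : ℝ := ∑ i, ∑ j, ‖ι (T i j)‖

lemma size_nonneg (T : Fin 3 → Fin 3 → smoothS2) : 0 ≤ size T :=
  Finset.sum_nonneg fun _ _ => Finset.sum_nonneg fun _ _ => norm_nonneg _

lemma I_dot_le_size_sq (T : Fin 3 → Fin 3 → smoothS2) : I (dot T T) ≤ size T ^ 2 := by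
  have h1 : I (dot T T) = ∑ p : Fin 3 × Fin 3, ‖ι (T p.1 p.2)‖ ^ 2 := by
    rw [dot, map_sum, Fintype.sum_prod_type]
    simp only [map_sum, I_mul_self]
  have h2 : size T = ∑ p : Fin 3 × Fin 3, ‖ι (T p.1 p.2)‖ := by
    rw [size, Fintype.sum_prod_type]
  rw [h1, h2]
  exact Finset.sum_sq_le_sq_sum_of_nonneg fun _ _ => norm_nonneg _

/-- `c` and `cc` are the normalized potentials of `T`. -/
structure IsPot (T : Fin 3 → Fin 3 → smoothS2) (c cc : smoothS2) : Prop where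
  perp : Perp c
  perp' : Perp cc
  eq : ∀ i j, T i j = Cl c i j + Co cc i j

lemma Lap_add (φ ψ : smoothS2) : Lap (φ + ψ) = Lap φ + Lap ψ := by
  simp [Lap, Finset.sum_add_distrib]

lemma Lap_smul (a : ℝ) (φ : smoothS2) : Lap (a • φ) = a • Lap φ := by
  simp [Lap, Finset.smul_sum]

lemma Cl_add (φ ψ : smoothS2) (i j : Fin 3) : Cl (φ + ψ) i j = Cl φ i j + Cl ψ i j := by
  simp only [Cl, map_add, Lap_add]; ring

lemma Cl_smul (a : ℝ) (φ : smoothS2) (i j : Fin 3) : Cl (a • φ) i j = a • Cl φ i j := by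
  simp only [Cl, Derivation.map_smul, Lap_smul, mul_smul_comm, smul_sub, smul_add]

lemma Co_add (φ ψ : smoothS2) (i j : Fin 3) : Co (φ + ψ) i j = Co φ i j + Co ψ i j := by
  simp only [Co, Cl_add, mul_add, Finset.sum_add_distrib]

lemma Co_smul (a : ℝ) (φ : smoothS2) (i j : Fin 3) : Co (a • φ) i j = a • Co φ i j := by
  simp only [Co, Cl_smul, mul_smul_comm, Finset.smul_sum]

lemma Perp.add {c c' : smoothS2} (h : Perp c) (h' : Perp c') : Perp (c + c') :=
  ⟨by simp [h.1, h'.1], fun i => by simp [mul_add, h.2, h'.2]⟩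

lemma Perp.smul {c : smoothS2} (h : Perp c) (a : ℝ) : Perp (a • c) :=
  ⟨by simp [h.1], fun i => by simp [h.2]⟩

lemma perp_zero : Perp 0 := ⟨by simp, fun i => by simp⟩

/-! ### Pairs of potentials: orthogonality and elliptic estimates -/

section

variable {T T' : Fin 3 → Fin 3 → smoothS2} {c cc c' cc' : smoothS2}

lemma IsPot.add (h : IsPot T c cc) (h' : IsPot T' c' cc') :
    IsPot (fun i j => T i j + T' i j) (c + c') (cc + cc') :=
  ⟨h.perp.add h'.perp, h.perp'.add h'.perp', fun i j => by
    rw [h.eq, h'.eq, Cl_add, Co_add]; ring⟩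

lemma IsPot.smul (h : IsPot T c cc) (a : ℝ) :
    IsPot (fun i j => a • T i j) (a • c) (a • cc) :=
  ⟨h.perp.smul a, h.perp'.smul a, fun i j => by
    rw [h.eq, Cl_smul, Co_smul, smul_add]⟩

lemma IsPot.sub (h : IsPot T c cc) (h' : IsPot T' c' cc') :
    IsPot (fun i j => T i j - T' i j) (c - c') (cc - cc') := by
  have := h.add (h'.smul (-1))
  simpa [sub_eq_add_neg] using this

lemma isPot_Cl (h : Perp c) : IsPot (Cl c) c 0 :=
  ⟨h, perp_zero, fun i j => by simp [Co, Cl, Lap]⟩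

/-- Closed and co-closed parts are L²-orthogonal: their pairing is the closed potential against the
double divergence of the co-closed part, which is zero. -/
lemma I_dot_eq (T : Fin 3 → Fin 3 → smoothS2) (h : ∀ i j, T i j = Cl c i j + Co cc i j) :
    I (dot T T) = I (dot (Cl c) (Cl c)) + I (dot (Cl cc) (Cl cc)) := by
  have e1 : dot T T = dot (Cl c) (Cl c) + dot (Co cc) (Co cc) + 2 * dot (Co cc) (Cl c) := by
    simp only [dot, h, Finset.mul_sum, ← Finset.sum_add_distrib]
    refine Finset.sum_congr rfl fun i _ => Finset.sum_congr rfl fun j _ => ?_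
    ring
  have e2 : I (dot (Co cc) (Cl c)) = 0 := by
    rw [I_dot_Cl (stf_Co cc), DDv_Co, mul_zero, map_zero]
  have e3 : dot (Co cc) (Co cc) = dot (Cl cc) (Cl cc) := (stf_Cl cc).dot_eps_mul
  rw [e1, two_mul]
  simp only [map_add, e2, e3]; ring

lemma IsPot.norm_D_D_le_aux (hc : Perp c) {b : ℝ} (hb : 0 ≤ b)
    (h : I (dot (Cl c) (Cl c)) ≤ b ^ 2) :
    ‖ι (Lap c)‖ ≤ 2 * b ∧ ‖ι c‖ ≤ b ∧ (∀ i, ‖ι (D i c)‖ ≤ b) ∧ ∀ i j, ‖ι (Cl c i j)‖ ≤ b := by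
  have h1 : ‖ι (Lap c)‖ ≤ 2 * b := by
    rw [← sq_le_sq₀ (norm_nonneg _) (by positivity)]
    nlinarith [hc.norm_Lap_sq_le]
  refine ⟨h1, ?_, fun i => ?_, fun i j => ?_⟩
  · linarith [hc.norm_le]
  · rw [← sq_le_sq₀ (norm_nonneg _) hb]
    nlinarith [hc.norm_D_sq_le i, norm_nonneg (ι (Lap c))]
  · rw [← sq_le_sq₀ (norm_nonneg _) hb]
    exact (norm_sq_le_I_dot _ i j).trans h

/-- Second derivatives are read off algebraically from `Cl c`, the first derivatives and Δc, all of
which are already controlled. -/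
lemma exists_norm_D_D_le : ∃ K, 0 ≤ K ∧ ∀ (c : smoothS2) (b : ℝ), Perp c → 0 ≤ b →
    I (dot (Cl c) (Cl c)) ≤ b ^ 2 → ∀ i j, ‖ι (D i (D j c))‖ ≤ K * b := by
  choose KX hKX hX using fun j => exists_norm_ι_mul_le (X j)
  choose KP hKP hP using fun i j => exists_norm_ι_mul_le (half * P i j)
  refine ⟨1 + ∑ j, KX j + 2 * ∑ i, ∑ j, KP i j, ?_, fun c b hc hb h i j => ?_⟩
  · have h1 := Finset.sum_nonneg fun j (_ : j ∈ Finset.univ) => hKX j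
    have h2 := Finset.sum_nonneg fun i (_ : i ∈ Finset.univ) =>
      Finset.sum_nonneg fun j (_ : j ∈ Finset.univ) => hKP i j
    positivity
  obtain ⟨h1, h2, h3, h4⟩ := IsPot.norm_D_D_le_aux hc hb h
  have e : D i (D j c) = Cl c i j - X j * D i c + half * P i j * Lap c := by rw [Cl]; ring
  have t1 : KX j ≤ ∑ j, KX j := Finset.single_le_sum (fun j _ => hKX j) (Finset.mem_univ j)
  have t2 : KP i j ≤ ∑ i, ∑ j, KP i j :=
    (Finset.single_le_sum (f := KP i) (fun j _ => hKP i j) (Finset.mem_univ j)).trans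
    (Finset.single_le_sum (f := fun i => ∑ j, KP i j)
      (fun i _ => Finset.sum_nonneg fun j _ => hKP i j) (Finset.mem_univ i))
  calc ‖ι (D i (D j c))‖ ≤ ‖ι (Cl c i j)‖ + ‖ι (X j * D i c)‖ + ‖ι (half * P i j * Lap c)‖ := by
        rw [e, map_add, map_sub]
        exact (norm_add_le _ _).trans (add_le_add_left (norm_sub_le _ _) _)
    _ ≤ b + KX j * b + KP i j * (2 * b) :=
        add_le_add (add_le_add (h4 i j) ((hX j _).trans (mul_le_mul_of_nonneg_left (h3 i) (hKX j))))
          ((hP i j _).trans (mul_le_mul_of_nonneg_left h1 (hKP i j)))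
    _ ≤ (1 + ∑ j, KX j + 2 * ∑ i, ∑ j, KP i j) * b := by nlinarith

/-- The first order operator by which the potentials enter the center of mass. -/
def ell (k : Fin 3) (c cc : smoothS2) : smoothS2 :=
  D k c + X k * c + 2 * ∑ b, eps k b * D b cc

lemma ell_add (k : Fin 3) (c cc c' cc' : smoothS2) :
    ell k (c + c') (cc + cc') = ell k c cc + ell k c' cc' := by
  simp only [ell, map_add, mul_add, Finset.sum_add_distrib]; ring

lemma ell_smul (k : Fin 3) (a : ℝ) (c cc : smoothS2) :
    ell k (a • c) (a • cc) = a • ell k c cc := by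
  simp only [ell, Derivation.map_smul, mul_smul_comm, smul_add, ← Finset.smul_sum]

lemma ell_sub (k : Fin 3) (c cc c' cc' : smoothS2) :
    ell k (c - c') (cc - cc') = ell k c cc - ell k c' cc' := by
  have := ell_add k c cc ((-1 : ℝ) • c') ((-1 : ℝ) • cc')
  rw [ell_smul] at this
  simpa [sub_eq_add_neg] using this

lemma norm_ι_le_of_eq_add {φ ψ χ : smoothS2} {a b : ℝ} (h : φ = ψ + χ) (h1 : ‖ι ψ‖ ≤ a)
    (h2 : ‖ι χ‖ ≤ b) : ‖ι φ‖ ≤ a + b := by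
  rw [h, map_add]
  exact (norm_add_le _ _).trans (add_le_add h1 h2)

lemma norm_ι_sum_le {φ : Fin 3 → smoothS2} {a : Fin 3 → ℝ} (h : ∀ i, ‖ι (φ i)‖ ≤ a i) :
    ‖ι (∑ i, φ i)‖ ≤ ∑ i, a i := by
  rw [map_sum]
  exact norm_sum_le_of_le _ fun i _ => h i

/-- The potentials are controlled in the Sobolev space `H²` by the tensor in `L²`. -/
theorem exists_norm_ell_le (k : Fin 3) : ∃ K, 0 ≤ K ∧ ∀ T c cc, IsPot T c cc →
    ‖ι (ell k c cc)‖ ≤ K * size T ∧ ∀ j, ‖ι (D j (ell k c cc))‖ ≤ K * size T := by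
  obtain ⟨K₂, hK₂, h₂⟩ := exists_norm_D_D_le
  choose KX hKX hX using fun j => exists_norm_ι_mul_le (X j)
  choose KP hKP hP using fun i j => exists_norm_ι_mul_le (P i j)
  choose KE hKE hE using fun i j => exists_norm_ι_mul_le (2 * eps i j)
  choose KD hKD hD using fun l i j => exists_norm_ι_mul_le (2 * D l (eps i j))
  have n1 : 0 ≤ 1 + KX k + ∑ b, KE k b := by
    have := Finset.sum_nonneg fun j (_ : j ∈ Finset.univ) => hKE k j
    have := hKX k
    positivity
  have n2 : ∀ j, 0 ≤ K₂ + (KX k + KP j k) + ∑ b, (KE k b * K₂ + KD j k b) := fun j => by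
    have : 0 ≤ ∑ b, (KE k b * K₂ + KD j k b) := Finset.sum_nonneg fun b _ => by
      have := hKE k b
      have := hKD j k b
      positivity
    have := hKX k
    have := hKP j k
    positivity
  refine ⟨(1 + KX k + ∑ b, KE k b) + ∑ j, (K₂ + (KX k + KP j k) + ∑ b, (KE k b * K₂ + KD j k b)),
    add_nonneg n1 (Finset.sum_nonneg fun j _ => n2 j), fun T c cc h => ?_⟩
  have hb := size_nonneg T
  have hs := (I_dot_eq T h.eq).symm.le.trans (I_dot_le_size_sq T)
  have p1 : 0 ≤ I (dot (Cl c) (Cl c)) := (sq_nonneg _).trans (norm_sq_le_I_dot _ 0 0)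
  have p2 : 0 ≤ I (dot (Cl cc) (Cl cc)) := (sq_nonneg _).trans (norm_sq_le_I_dot _ 0 0)
  have b1 := (le_add_of_nonneg_right p2).trans hs
  have b2 := (le_add_of_nonneg_left p1).trans hs
  obtain ⟨-, c0, c1, -⟩ := IsPot.norm_D_D_le_aux h.perp hb b1
  obtain ⟨-, cc0, cc1, -⟩ := IsPot.norm_D_D_le_aux h.perp' hb b2
  have c2 := h₂ c _ h.perp hb b1
  have cc2 := h₂ cc _ h.perp' hb b2
  set b := size T
  have mono : ∀ {K x y : ℝ}, 0 ≤ K → x ≤ y → K * x ≤ K * y := fun hK h =>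
    mul_le_mul_of_nonneg_left h hK
  have q1 : ‖ι (ell k c cc)‖ ≤ (1 + KX k + ∑ b, KE k b) * b := by
    have e : ell k c cc = (D k c + X k * c) + ∑ b, (2 * eps k b) * D b cc := by
      simp only [ell, Finset.mul_sum, mul_assoc]
    have := norm_ι_le_of_eq_add e
      (norm_ι_le_of_eq_add rfl (c1 k) ((hX k _).trans (mono (hKX k) c0)))
      (norm_ι_sum_le fun i => (hE k i _).trans (mono (hKE k i) (cc1 i)))
    rw [← Finset.sum_mul] at this
    linarith
  have q2 : ∀ j, ‖ι (D j (ell k c cc))‖ ≤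
      (K₂ + (KX k + KP j k) + ∑ b, (KE k b * K₂ + KD j k b)) * b := fun j => by
    have e : D j (ell k c cc) = (D j (D k c) + (X k * D j c + P j k * c)) +
        ∑ b, ((2 * eps k b) * D j (D b cc) + (2 * D j (eps k b)) * D b cc) := by
      simp only [ell, map_add, Derivation.leibniz, smul_eq_mul, D_X, Fin.sum_univ_three,
        show D j (2 : smoothS2) = 0 from (D j).map_natCast 2]
      ring
    have := norm_ι_le_of_eq_add e
      (norm_ι_le_of_eq_add rfl (c2 j k) (norm_ι_le_of_eq_add rfl
        ((hX k _).trans (mono (hKX k) (c1 j))) ((hP j k _).trans (mono (hKP j k) c0))))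
      (norm_ι_sum_le fun i => norm_ι_le_of_eq_add rfl
        ((hE k i _).trans (mono (hKE k i) (cc2 j i)))
        ((hD j k i _).trans (mono (hKD j k i) (cc1 i))))
    have e2 : ∑ i, (KE k i * (K₂ * b) + KD j k i * b) = (∑ i, (KE k i * K₂ + KD j k i)) * b := by
      rw [Finset.sum_mul]; exact Finset.sum_congr rfl fun i _ => by ring
    rw [e2] at this
    linarith
  refine ⟨q1.trans (mul_le_mul_of_nonneg_right ?_ hb), fun j => (q2 j).trans
    (mul_le_mul_of_nonneg_right ?_ hb)⟩
  · exact le_add_of_nonneg_right (Finset.sum_nonneg fun j _ => n2 j)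
  · exact le_add_of_nonneg_of_le n1 (Finset.single_le_sum (fun j _ => n2 j) (Finset.mem_univ j))

/-- This divergence involves third derivatives of the potential, out of reach of the H² estimate.
Instead, the divergences of the two parts are a gradient and a rotated gradient, hence
L²-orthogonal, and Pythagoras bounds each by the divergence of T. -/
lemma IsPot.norm_Dv_Co_le (h : IsPot T c cc) (j : Fin 3) :
    ‖ι (Dv (Co cc) j)‖ ≤ ∑ j, ‖ι (Dv T j)‖ := by
  have e1 : ∀ j, Dv T j = Dv (Cl c) j + Dv (Co cc) j := fun j => by
    simp only [Dv, h.eq, map_add, Finset.sum_add_distrib]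
  have e2 : I (∑ j, Dv (Co cc) j * Dv (Cl c) j) = 0 := by
    simp only [Dv_Cl]
    have := I_DDv_mul (stf_Co cc) (half * Lap c + c)
    rw [DDv_Co, mul_zero, map_zero] at this
    linarith
  have e3 : ∑ j, ‖ι (Dv T j)‖ ^ 2 = ∑ j, ‖ι (Dv (Cl c) j)‖ ^ 2 + ∑ j, ‖ι (Dv (Co cc) j)‖ ^ 2 := by
    simp only [← I_mul_self, ← map_sum]
    have : ∑ j, Dv T j * Dv T j = ∑ j, Dv (Cl c) j * Dv (Cl c) j + ∑ j, Dv (Co cc) j * Dv (Co cc) j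
        + (∑ j, Dv (Co cc) j * Dv (Cl c) j + ∑ j, Dv (Co cc) j * Dv (Cl c) j) := by
      simp only [e1, ← Finset.sum_add_distrib]
      exact Finset.sum_congr rfl fun i _ => by ring
    rw [this]
    simp only [map_add, e2]; ring
  have e4 : ∑ j, ‖ι (Dv T j)‖ ^ 2 ≤ (∑ j, ‖ι (Dv T j)‖) ^ 2 :=
    Finset.sum_sq_le_sq_sum_of_nonneg fun _ _ => norm_nonneg _
  have e5 : 0 ≤ ∑ j, ‖ι (Dv (Cl c) j)‖ ^ 2 := Finset.sum_nonneg fun _ _ => sq_nonneg _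
  have e6 : ‖ι (Dv (Co cc) j)‖ ^ 2 ≤ ∑ j, ‖ι (Dv (Co cc) j)‖ ^ 2 :=
    Finset.single_le_sum (f := fun j => ‖ι (Dv (Co cc) j)‖ ^ 2) (fun _ _ => sq_nonneg _)
      (Finset.mem_univ j)
  rw [← sq_le_sq₀ (norm_nonneg _) (Finset.sum_nonneg fun _ _ => norm_nonneg _)]
  linarith

/-! ### The algebraic identity behind the invariance -/

/-- Pairing of two symmetric traceless tensors through their divergences. -/
def pair (k : Fin 3) (S T : Fin 3 → Fin 3 → smoothS2) : smoothS2 :=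
  ∑ b, (S k b * Dv T b - T k b * Dv S b)

/-- With w = ½Δg + g one has ∇·Cl g = ∇w and D_j(ell k g 0) = (Cl g)_{kj} + P_{jk} w.
Differentiating once more and contracting with T turns the antisymmetric pairing into the full
contraction of T with D D (ell k g 0), which is then integrated by parts twice. -/
theorem I_pair_Cl (hT : STF T) (k : Fin 3) (g : smoothS2) :
    I (pair k (Cl g) T) = - I (ell k g 0 * DDv T) := by
  set w := half * Lap g + g with hw
  have e1 : ∀ j, D j (ell k g 0) = Cl g k j + P j k * w := fun j => by
    have h1 := D_comm j k g
    simp only [ell, map_zero, mul_zero, Finset.sum_const_zero, add_zero, map_add,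
      Derivation.leibniz, smul_eq_mul, D_X, Cl, hw]
    linear_combination h1 + half * Lap g * P_symm k j
  have e2 : ∀ i j, D i (D j (ell k g 0)) = D i (Cl g k j) + P j k * D i w
      - w * (X k * P i j + X j * P i k) := fun i j => by
    rw [e1, map_add, Derivation.leibniz, D_P, smul_eq_mul, smul_eq_mul]; ring
  have h1 := hT.tangent_right
  have h2 := hT.P_mul
  have h3 := hT.traceless'
  have hP := P_symm
  have h4 : ∀ i, T i 0 * P 0 k + T i 1 * P 1 k + T i 2 * P 2 k = T i k := fun i => by
    have := h2 k i
    rw [hT.symm 0 i, hT.symm 1 i, hT.symm 2 i, hT.symm k i, hP k 0, hP k 1, hP k 2] at this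
    linear_combination this
  have e3 : ∑ i, ∑ j, T i j * D i (D j (ell k g 0)) =
      ∑ i, ∑ j, T i j * D i (Cl g k j) + ∑ b, T k b * Dv (Cl g) b := by
    simp only [e2, Dv_Cl, ← hw, Fin.sum_univ_three, hT.symm k]
    linear_combination (-w) * (X k * (h2 0 0 + h2 1 1 + h2 2 2 + h3 + (T 0 1 - T 1 0) * hP 0 1
      + (T 0 2 - T 2 0) * hP 0 2 + (T 1 2 - T 2 1) * hP 1 2)
      + P 0 k * h1 0 + P 1 k * h1 1 + P 2 k * h1 2)
      + D 0 w * h4 0 + D 1 w * h4 1 + D 2 w * h4 2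
  have e4 : pair k (Cl g) T = ∑ b, Dv T b * Cl g k b - ∑ b, T k b * Dv (Cl g) b := by
    simp only [pair, Finset.sum_sub_distrib, mul_comm]
  have e5 : ∑ i, ∑ j, T i j * D i (Cl g k j) =
      ∑ i, ∑ j, T i j * D i (D j (ell k g 0)) - ∑ b, T k b * Dv (Cl g) b := by
    rw [e3]; ring
  rw [e4, map_sub, I_Dv_mul hT, I_DDv_mul hT, I_Dv_mul hT, e5, map_sub]
  ring

end

/-! ### Tensor calculus on the sphere in terms of the algebra of smooth functions -/

/-- Evaluation at a point. -/
def ev (x : S2) : smoothS2 →ₐ[ℝ] ℝ where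
  toFun φ := φ.1 x
  map_one' := rfl
  map_mul' _ _ := rfl
  map_zero' := rfl
  map_add' _ _ := rfl
  commutes' _ := rfl

lemma ev_apply (x : S2) (φ : smoothS2) : ev x φ = φ.1 x := rfl

lemma ev_half (x : S2) : ev x half = 1 / 2 := rfl

lemma ev_ext {φ ψ : smoothS2} (h : ∀ x, ev x φ = ev x ψ) : φ = ψ :=
  Subtype.ext (funext h)

lemma ev_X (k : Fin 3) (x : S2) : ev x (X k) = coord k x := rfl

lemma ev_P (i j : Fin 3) (x : S2) : ev x (P i j) = roundMetric i j x :=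
  congrFun (coe_P i j) x

lemma ev_D (i : Fin 3) (φ : smoothS2) (x : S2) : ev x (D i φ) = tder i φ.1 x := rfl

lemma ev_eps (i j : Fin 3) (x : S2) : ev x (eps i j) = volForm i j x := by
  fin_cases i <;> fin_cases j <;>
    simp [eps, volForm, ev_X, crossProduct, dotProduct, Fin.sum_univ_three]

lemma grad_coe (φ : smoothS2) (i : Fin 3) (x : S2) : grad φ.1 i x = ev x (D i φ) := rfl

/-- The covariant derivative of a one-form. -/
def Cov (w : Fin 3 → smoothS2) (i j : Fin 3) : smoothS2 := ∑ l, P j l * D i (w l)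

lemma cov1_coe (w : Fin 3 → smoothS2) (i j : Fin 3) (x : S2) :
    cov1 (fun l => (w l).1) i j x = ev x (Cov w i j) := by
  simp [cov1, Cov, ev_P, ev_D]

lemma P_mul_D' (j : Fin 3) (φ : smoothS2) : ∑ i, P j i * D i φ = D j φ := by
  simp only [P_symm j, P_mul_D]

/-- The projection in the covariant derivative drops out of the trace, because Σ_i P_il D_i = D_l.
-/
lemma div1_coe (w : Fin 3 → smoothS2) (x : S2) :
    div1 (fun l => (w l).1) x = ev x (∑ i, D i (w i)) := by
  have h : ∑ i, Cov w i i = ∑ i, D i (w i) := by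
    simp only [Cov]
    rw [Finset.sum_comm]
    exact Finset.sum_congr rfl fun i _ => P_mul_D i (w i)
  simp only [div1, cov1_coe, ← map_sum, h]

/-- The divergence of a general 2-tensor. -/
def Dvg (T : Fin 3 → Fin 3 → smoothS2) (j : Fin 3) : smoothS2 := ∑ n, P j n * ∑ i, D i (T i n)

lemma div2_coe' (T : Fin 3 → Fin 3 → smoothS2) (j : Fin 3) (x : S2) :
    div2 (fun i j => (T i j).1) j x = ev x (Dvg T j) := by
  have h : Dvg T j = ∑ i, ∑ l, ∑ n, P i l * P j n * D i (T l n) := by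
    have e : ∀ n, P j n * ∑ i, D i (T i n) = ∑ i, ∑ l, P i l * P j n * D i (T l n) := fun n => by
      rw [Finset.sum_comm, Finset.mul_sum]
      refine Finset.sum_congr rfl fun l _ => ?_
      rw [← P_mul_D l (T l n), Finset.mul_sum]
      exact Finset.sum_congr rfl fun i _ => by ring
    simp only [Dvg, e]
    rw [Finset.sum_comm]
    exact Finset.sum_congr rfl fun i _ => Finset.sum_comm
  rw [h]
  simp [div2, cov2, ev_P, ev_D]

/-- The flat divergence of a symmetric traceless tangential tensor is already tangential, so the
outer projection does nothing. -/
lemma STF.Dvg_eq {T : Fin 3 → Fin 3 → smoothS2} (h : STF T) (j : Fin 3) : Dvg T j = Dv T j := by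
  have h1 := h.tangent_Dv
  simp only [Dvg, ← Dv.eq_1 T, Fin.sum_univ_three]
  fin_cases j <;> simp [P] <;> [linear_combination - X 0 * h1; linear_combination - X 1 * h1;
    linear_combination - X 2 * h1]

lemma STF.div2_coe {T : Fin 3 → Fin 3 → smoothS2} (h : STF T) (j : Fin 3) (x : S2) :
    div2 (fun i j => (T i j).1) j x = ev x (Dv T j) := by
  rw [div2_coe', h.Dvg_eq]

/-- The gradient is tangential; differentiating Σ_l X_l D_l φ = 0 shows that projecting the index j
of D_i D_j φ adds X_j D_i φ. -/
lemma hess_coe (φ : smoothS2) (i j : Fin 3) (x : S2) :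
    hess φ.1 i j x = ev x (D i (D j φ) + X j * D i φ) := by
  have h : Cov (fun l => D l φ) i j = D i (D j φ) + X j * D i φ := by
    have h1 := congrArg (D i) (sum_X_D' φ)
    have h2 := P_mul_D' i φ
    simp only [map_add, Derivation.leibniz, smul_eq_mul, D_X, map_zero] at h1
    simp only [Fin.sum_univ_three] at h2
    simp only [Cov, Fin.sum_univ_three]
    fin_cases j <;> simp [P] at * <;> [linear_combination X 0 * (h2 - h1);
      linear_combination X 1 * (h2 - h1); linear_combination X 2 * (h2 - h1)]
  rw [← h]
  exact cov1_coe (fun l => D l φ) i j x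

lemma lap_coe (φ : smoothS2) (x : S2) : lap φ.1 x = ev x (Lap φ) := by
  have h := sum_X_D φ
  simp only [lap, hess_coe, ← map_sum, Finset.sum_add_distrib, h, add_zero]
  rfl

lemma closedPart_coe (φ : smoothS2) (i j : Fin 3) (x : S2) :
    closedPart φ.1 i j x = ev x (Cl φ i j) := by
  simp only [closedPart, hess_coe, lap_coe, Cl, map_sub, map_mul, ev_P, ev_half]

/-- The symmetrized definition reduces to ε·Cl: the trace of the Hessian contributes a multiple of
ε, which symmetrization kills, and ε·Cl is symmetric by `STF.eps_mul`. -/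
lemma coclosedPart_coe (φ : smoothS2) (i j : Fin 3) (x : S2) :
    coclosedPart φ.1 i j x = ev x (Co φ i j) := by
  have h1 : ∀ i j, ∑ e, eps i e * P e j = eps i j := fun i j => by
    have h := sum_X_eps i
    simp only [eps_antisymm _ i] at h
    simp only [Fin.sum_univ_three]
    fin_cases j <;> simp [P] <;> [linear_combination X 0 * h;
      linear_combination X 1 * h; linear_combination X 2 * h]
  have h2 : ∀ i j, ∑ e, eps i e * (D e (D j φ) + X j * D e φ) =
      Co φ i j + half * Lap φ * eps i j := fun i j => by
    rw [← h1 i j, Finset.mul_sum, Co, ← Finset.sum_add_distrib]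
    refine Finset.sum_congr rfl fun e _ => ?_
    rw [Cl]; ring
  have h3 : half * ∑ e, (eps i e * (D e (D j φ) + X j * D e φ)
      + eps j e * (D e (D i φ) + X i * D e φ)) = Co φ i j := by
    rw [Finset.sum_add_distrib, h2, h2, (stf_Co φ).symm j i, eps_antisymm j i]
    linear_combination Co φ i j * two_mul_half
  rw [← h3]
  simp only [coclosedPart, hess_coe, map_mul, map_sum, map_add, ev_half, ev_eps]

lemma contract_coe (S T : Fin 3 → Fin 3 → smoothS2) (x : S2) :
    contract (fun i j => (S i j).1) (fun i j => (T i j).1) x = ev x (dot S T) := by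
  simp [contract, dot, ev_apply]

/-! ### Projection, integrated divergences and squares of tangential tensors -/

lemma P_mul_of_tangent {V : Fin 3 → smoothS2} (h : X 0 * V 0 + X 1 * V 1 + X 2 * V 2 = 0)
    (k : Fin 3) : P k 0 * V 0 + P k 1 * V 1 + P k 2 * V 2 = V k := by
  fin_cases k <;> simp [P] <;> [linear_combination - X 0 * h; linear_combination - X 1 * h;
    linear_combination - X 2 * h]

/-- Integrate ∇·T against ∇X_j by parts and use Hess X_j = -X_j σ: only the trace of T survives.
Symmetry of T is not required, because the curl-type term in the equation for N_A is antisymmetric.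
-/
lemma I_Dvg (T : Fin 3 → Fin 3 → smoothS2) (hl : ∀ n, X 0 * T 0 n + X 1 * T 1 n + X 2 * T 2 n = 0)
    (hr : ∀ n, X 0 * T n 0 + X 1 * T n 1 + X 2 * T n 2 = 0) (j : Fin 3) :
    I (Dvg T j) = I (X j * ∑ i, T i i) := by
  have e1 : I (Dvg T j) = - I (∑ n, ∑ i, T i n * D i (P j n)) := by
    rw [Dvg, map_sum, map_sum, ← Finset.sum_neg_distrib]
    refine Finset.sum_congr rfl fun n _ => ?_
    rw [I_mul_D (fun i => T i n) (hl n) (P j n), neg_neg]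
  rw [e1, ← map_neg]
  congr 1
  have e2 := fun n => P_mul_of_tangent (V := fun i => T i n) (hl n) n
  simp only [D_P, Fin.sum_univ_three]
  have hP := P_symm
  linear_combination X j * (e2 0 + e2 1 + e2 2 + T 0 1 * hP 0 1 + T 0 2 * hP 0 2 + T 1 0 * hP 1 0
    + T 1 2 * hP 1 2 + T 2 0 * hP 2 0 + T 2 1 * hP 2 1) + P 0 j * hr 0 + P 1 j * hr 1 + P 2 j * hr 2

/-- Cayley–Hamilton for a symmetric traceless endomorphism of the plane orthogonal to x. Up to
permuting coordinates there is one diagonal and one off-diagonal identity, `key` and `key'`. -/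
lemma sq_eq_aux (t : Fin 3 → Fin 3 → ℝ) (x : Fin 3 → ℝ)
    (hx : x 0 * x 0 + x 1 * x 1 + x 2 * x 2 = 1)
    (h : ∀ j, x 0 * t 0 j + x 1 * t 1 j + x 2 * t 2 j = 0)
    (hs : ∀ i j, t i j = t j i) (ht : t 0 0 + t 1 1 + t 2 2 = 0) (i j : Fin 3) :
    2 * ∑ d, t i d * t d j =
      (∑ i, ∑ j, t i j * t i j) * ((if i = j then 1 else 0) - x i * x j) := by
  have h0 := h 0
  have h1 := h 1
  have h2 := h 2
  clear h
  simp only [Fin.sum_univ_three]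
  rw [hs 1 0, hs 2 0] at *
  rw [hs 2 1] at *
  have key : ∀ a b c d e g x y z : ℝ, x * x + y * y + z * z = 1 → x * a + y * b + z * c = 0 →
      x * b + y * d + z * e = 0 → x * c + y * e + z * g = 0 → a + d + g = 0 →
      2 * (a * a + b * b + c * c) = (a * a + b * b + c * c + (b * b + d * d + e * e)
        + (c * c + e * e + g * g)) * (1 - x * x) := by
    intros; grind
  have key' : ∀ a b c d e g x y z : ℝ, x * x + y * y + z * z = 1 → x * a + y * b + z * c = 0 →
      x * b + y * d + z * e = 0 → x * c + y * e + z * g = 0 → a + d + g = 0 →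
      2 * (a * b + b * d + c * e) = (a * a + b * b + c * c + (b * b + d * d + e * e)
        + (c * c + e * e + g * g)) * (0 - x * y) := by
    intros; grind
  have k1 := key (t 0 0) (t 0 1) (t 0 2) (t 1 1) (t 1 2) (t 2 2) (x 0) (x 1) (x 2) hx
    (by linarith) (by linarith) (by linarith) (by linarith)
  have k2 := key (t 1 1) (t 0 1) (t 1 2) (t 0 0) (t 0 2) (t 2 2) (x 1) (x 0) (x 2) (by linarith)
    (by linarith) (by linarith) (by linarith) (by linarith)
  have k3 := key (t 2 2) (t 1 2) (t 0 2) (t 1 1) (t 0 1) (t 0 0) (x 2) (x 1) (x 0) (by linarith)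
    (by linarith) (by linarith) (by linarith) (by linarith)
  have k4 := key' (t 0 0) (t 0 1) (t 0 2) (t 1 1) (t 1 2) (t 2 2) (x 0) (x 1) (x 2) hx
    (by linarith) (by linarith) (by linarith) (by linarith)
  have k5 := key' (t 0 0) (t 0 2) (t 0 1) (t 2 2) (t 1 2) (t 1 1) (x 0) (x 2) (x 1) (by linarith)
    (by linarith) (by linarith) (by linarith) (by linarith)
  have k6 := key' (t 1 1) (t 1 2) (t 0 1) (t 2 2) (t 0 2) (t 0 0) (x 1) (x 2) (x 0) (by linarith)
    (by linarith) (by linarith) (by linarith) (by linarith)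
  have s1 := hs 1 0
  have s2 := hs 2 0
  have s3 := hs 2 1
  fin_cases i <;> fin_cases j <;> simp [s1, s2, s3] <;> linarith

/-- The square of a symmetric traceless tangential tensor is pure trace. -/
lemma STF.sq_eq {T : Fin 3 → Fin 3 → smoothS2} (h : STF T) (i j : Fin 3) :
    2 * ∑ d, T i d * T d j = dot T T * P i j := by
  refine ev_ext fun x => ?_
  have := sq_eq_aux (fun i j => ev x (T i j)) (fun i => ev x (X i))
    (by simpa using congrArg (ev x) sum_X_sq') (fun j => by simpa using congrArg (ev x) (h.tangent' j))
    (fun i j => by rw [h.symm]) (by simpa using congrArg (ev x) h.traceless') i j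
  simp only [map_mul, map_sum, dot, P, map_sub, map_ofNat, apply_ite (ev x), map_one, map_zero]
  exact this

/-! ### Families of smooth functions depending on time -/

lemma hasDerivAt_sphereInt {φ φ' : ℝ → S2 → ℝ} (hφ : ∀ u, Continuous (φ u))
    (hφ' : Continuous (fun p : ℝ × S2 => φ' p.1 p.2))
    (h : ∀ u x, HasDerivAt (fun s => φ s x) (φ' u x) u) (u : ℝ) :
    HasDerivAt (fun s => sphereInt (φ s)) (sphereInt (φ' u)) u := by
  obtain ⟨B, hB⟩ := ((isCompact_Icc (a := u - 1) (b := u + 1)).prod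
    (isCompact_univ (X := S2))).exists_bound_of_continuousOn hφ'.continuousOn
  refine (hasDerivAt_integral_of_dominated_loc_of_deriv_le (bound := fun _ => B)
    (Icc_mem_nhds (by linarith : u - 1 < u) (by linarith : u < u + 1))
    (Eventually.of_forall fun s => (hφ s).aestronglyMeasurable)
    (integrable_of_continuous (hφ u))
    (hφ'.comp (Continuous.prodMk_right u)).aestronglyMeasurable
    (Eventually.of_forall fun x s hs => hB (s, x) ⟨hs, Set.mem_univ x⟩)
    (integrable_const B) (Eventually.of_forall fun x s _ => h s x)).2

/-- `F` is a smooth family of functions on the sphere with time derivative `G`. -/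
structure TD (F G : ℝ → smoothS2) : Prop where
  smooth : SmoothOnScri (fun u => (F u).1)
  hasDerivAt : ∀ u x, HasDerivAt (fun s => ev x (F s)) (ev x (G u)) u

/-- Smooth functions as elements of the algebra of smooth functions. -/
def toA (φ : S2 → ℝ) : smoothS2 := open Classical in if h : SmoothOnS2 φ then ⟨φ, h⟩ else 0

lemma coe_toA {φ : S2 → ℝ} (h : SmoothOnS2 φ) : (toA φ).1 = φ := by
  rw [toA, dif_pos h]

lemma ev_toA {φ : S2 → ℝ} (h : SmoothOnS2 φ) (x : S2) : ev x (toA φ) = φ x :=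
  congrFun (coe_toA h) x

section

variable {F G F' G' : ℝ → smoothS2}

lemma TD.smooth' (h : TD F G) : SmoothOnScri (fun u => (G u).1) := by
  have := h.smooth.deriv
  convert this using 3 with u x
  exact (h.hasDerivAt u x).deriv.symm

lemma td_of_smooth (h : SmoothOnScri (fun u => (F u).1)) :
    TD F (fun u => toA (fun x => deriv (fun s => ev x (F s)) u)) :=
  ⟨h, fun u x => (h.hasDerivAt_deriv u x).congr_deriv (ev_toA (h.deriv.slice u) x).symm⟩

lemma TD.add (h : TD F G) (h' : TD F' G') : TD (fun u => F u + F' u) (fun u => G u + G' u) :=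
  ⟨h.smooth.add h'.smooth, fun u x => by
    simpa only [map_add] using (h.hasDerivAt u x).fun_add (h'.hasDerivAt u x)⟩

lemma TD.mul (h : TD F G) (h' : TD F' G') :
    TD (fun u => F u * F' u) (fun u => G u * F' u + F u * G' u) :=
  ⟨h.smooth.mul h'.smooth, fun u x => by
    simpa only [map_add, map_mul] using (h.hasDerivAt u x).fun_mul (h'.hasDerivAt u x)⟩

lemma td_const (a : smoothS2) : TD (fun _ => a) (fun _ => 0) :=
  ⟨SmoothOnS2.scri a.2, fun u x => by simpa using hasDerivAt_const u (ev x a)⟩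

lemma td_id : TD (fun u => algebraMap ℝ smoothS2 u) (fun _ => 1) :=
  ⟨(contMDiff_fst : ContMDiff (𝓘(ℝ, ℝ).prod (𝓡 2)) 𝓘(ℝ, ℝ) ∞ (fun p : ℝ × S2 => p.1)),
    fun u x => by simpa using! hasDerivAt_id u⟩

lemma TD.const_mul (h : TD F G) (a : smoothS2) : TD (fun u => a * F u) (fun u => a * G u) := by
  simpa using (td_const a).mul h

lemma TD.smul (h : TD F G) (a : ℝ) : TD (fun u => a • F u) (fun u => a • G u) := by
  simpa only [Algebra.smul_def] using h.const_mul (algebraMap ℝ smoothS2 a)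

lemma TD.sub (h : TD F G) (h' : TD F' G') : TD (fun u => F u - F' u) (fun u => G u - G' u) := by
  simpa [sub_eq_add_neg] using h.add (h'.smul (-1))

lemma TD.sum {F G : Fin 3 → ℝ → smoothS2} (h : ∀ i, TD (F i) (G i)) :
    TD (fun u => ∑ i, F i u) (fun u => ∑ i, G i u) := by
  simpa only [Fin.sum_univ_three] using ((h 0).add (h 1)).add (h 2)

lemma TD.D (h : TD F G) (i : Fin 3) : TD (fun u => D i (F u)) (fun u => D i (G u)) :=
  ⟨h.smooth.tder i, fun u x => by
    have := h.smooth.hasDerivAt_tder i u x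
    have e : (fun y => deriv (fun s => (F s).1 y) u) = (G u).1 :=
      funext fun y => (h.hasDerivAt u y).deriv
    rwa [e] at this⟩

lemma TD.Dv {T T' : Fin 3 → Fin 3 → ℝ → smoothS2} (h : ∀ i j, TD (T i j) (T' i j)) (j : Fin 3) :
    TD (fun u => Dv (fun i j => T i j u) j) (fun u => Dv (fun i j => T' i j u) j) :=
  TD.sum fun i => (h i j).D i

lemma TD.hasDerivAt_I (h : TD F G) (u : ℝ) : HasDerivAt (fun s => I (F s)) (I (G u)) u :=
  hasDerivAt_sphereInt (fun u => SmoothOnS2.continuous (F u).2) h.smooth'.continuous h.hasDerivAt u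

lemma TD.deriv_unique (h : TD F G) (h' : TD F G') : G = G' :=
  funext fun u => ev_ext fun x => (h.hasDerivAt u x).unique (h'.hasDerivAt u x)

/-- The shift `(u, x) ↦ F (u + f x, x)` of a family. -/
def sh (f : smoothS2) (F : ℝ → smoothS2) (u : ℝ) : smoothS2 :=
  toA (fun x => ev x (F (u + ev x f)))

variable (f : smoothS2)

lemma coe_sh (h : SmoothOnScri (fun u => (F u).1)) (u : ℝ) :
    (sh f F u).1 = fun x => ev x (F (u + ev x f)) :=
  coe_toA ((h.shift f.2).slice u)

lemma ev_sh (h : SmoothOnScri (fun u => (F u).1)) (u : ℝ) (x : S2) :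
    ev x (sh f F u) = ev x (F (u + ev x f)) := congrFun (coe_sh f h u) x

lemma TD.sh (h : TD F G) : TD (sh f F) (sh f G) :=
  ⟨by
    have := h.smooth.shift f.2
    simpa only [coe_sh f h.smooth] using! this, fun u x => by
    simp only [ev_sh f h.smooth, ev_sh f h.smooth']
    exact (h.hasDerivAt _ x).comp_add_const u (ev x f)⟩

/-- The chain rule for x ↦ (u + f(x), x). The time-derivative term is the origin of every news
correction under supertranslations. -/
lemma TD.D_sh (h : TD F G) (i : Fin 3) (u : ℝ) :
    NullInfinity.D i (NullInfinity.sh f F u) =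
      NullInfinity.sh f (fun u => NullInfinity.D i (F u)) u +
      NullInfinity.sh f G u * NullInfinity.D i f := by
  refine ev_ext fun x => ?_
  have h1 := h.smooth.tder_shift f.2 i u x
  rw [map_add, map_mul, ev_sh f (h.D i).smooth, ev_sh f h.smooth', ev_D, coe_sh f h.smooth]
  refine h1.trans ?_
  congr 2
  exact (h.hasDerivAt _ x).deriv

lemma sh_add (h : SmoothOnScri (fun u => (F u).1)) (h' : SmoothOnScri (fun u => (F' u).1)) (u : ℝ) :
    sh f (fun u => F u + F' u) u = sh f F u + sh f F' u :=
  ev_ext fun x => by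
    rw [ev_sh f (h.add h'), map_add, map_add, ev_sh f h, ev_sh f h']

lemma sh_mul (h : SmoothOnScri (fun u => (F u).1)) (h' : SmoothOnScri (fun u => (F' u).1)) (u : ℝ) :
    sh f (fun u => F u * F' u) u = sh f F u * sh f F' u :=
  ev_ext fun x => by
    rw [ev_sh f (h.mul h'), map_mul, map_mul, ev_sh f h, ev_sh f h']

lemma sh_sum {F : Fin 3 → ℝ → smoothS2} (h : ∀ i, SmoothOnScri (fun u => (F i u).1)) (u : ℝ) :
    sh f (fun u => ∑ i, F i u) u = ∑ i, sh f (F i) u := by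
  simp only [Fin.sum_univ_three]
  rw [sh_add f ((h 0).add (h 1)) (h 2), sh_add f (h 0) (h 1)]

lemma sh_const (a : smoothS2) (u : ℝ) : sh f (fun _ => a) u = a :=
  ev_ext fun x => ev_sh f (SmoothOnS2.scri a.2) u x

end

/-! ### The vacuum equations -/

namespace ScriData

variable (S : ScriData)

/-- The mass aspect as a family of smooth functions. -/
def mA (u : ℝ) : smoothS2 := ⟨S.m u, S.smooth_m.slice u⟩

/-- The angular momentum aspect as a family of smooth functions. -/
def aA (k : Fin 3) (u : ℝ) : smoothS2 := ⟨S.aspect u k, (S.smooth_aspect k).slice u⟩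

/-- The shear as a family of smooth functions. -/
def CA (i j : Fin 3) (u : ℝ) : smoothS2 := ⟨S.shear u i j, (S.smooth_shear i j).slice u⟩

/-- The news as a family of smooth functions. -/
def NA (i j : Fin 3) (u : ℝ) : smoothS2 := ⟨S.news u i j, (S.smooth_shear i j).deriv.slice u⟩

/-- The shear at a fixed time. -/
def CT (u : ℝ) (i j : Fin 3) : smoothS2 := S.CA i j u

/-- The news at a fixed time. -/
def NT (u : ℝ) (i j : Fin 3) : smoothS2 := S.NA i j u

lemma td_CA (i j : Fin 3) : TD (S.CA i j) (S.NA i j) :=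
  ⟨S.smooth_shear i j, fun u x => (S.smooth_shear i j).hasDerivAt_deriv u x⟩

lemma stf_CT (u : ℝ) : STF (S.CT u) where
  tangent j := ev_ext fun x => by simpa using! S.shear_tangent u j x
  symm i j := ev_ext fun x => S.shear_symm u i j x
  traceless := ev_ext fun x => by simpa using! S.shear_traceless u x

lemma stf_NT (u : ℝ) : STF (S.NT u) where
  tangent j := by
    have h1 : TD (fun u => ∑ i, X i * S.CA i j u) (fun u => ∑ i, X i * S.NA i j u) :=
      TD.sum fun i => (S.td_CA i j).const_mul (X i)
    have h2 : (fun u => ∑ i, X i * S.CA i j u) = fun _ => 0 :=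
      funext fun u => (S.stf_CT u).tangent j
    rw [h2] at h1
    exact congrFun (h1.deriv_unique (td_const 0)) u
  symm i j := by
    have h1 := S.td_CA i j
    have h2 : S.CA i j = S.CA j i := funext fun u => (S.stf_CT u).symm i j
    rw [h2] at h1
    exact congrFun (h1.deriv_unique (S.td_CA j i)) u
  traceless := by
    have h1 : TD (fun u => ∑ i, S.CA i i u) (fun u => ∑ i, S.NA i i u) :=
      TD.sum fun i => S.td_CA i i
    have h2 : (fun u => ∑ i, S.CA i i u) = fun _ => 0 := funext fun u => (S.stf_CT u).traceless
    rw [h2] at h1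
    exact congrFun (h1.deriv_unique (td_const 0)) u

/-- The mass aspect without its exact part. -/
def MA (u : ℝ) : smoothS2 := S.mA u - (1 / 4 : ℝ) • DDv (S.CT u)

lemma td_DvC (j : Fin 3) : TD (fun u => Dv (S.CT u) j) (fun u => Dv (S.NT u) j) :=
  TD.Dv (fun i j => S.td_CA i j) j

lemma td_DDvC : TD (fun u => DDv (S.CT u)) (fun u => DDv (S.NT u)) :=
  TD.sum fun j => (S.td_DvC j).D j

lemma td_of_deriv {F G : ℝ → smoothS2} (h : SmoothOnScri (fun u => (F u).1))
    (h' : ∀ u x, deriv (fun s => (F s).1 x) u = ev x (G u)) : TD F G :=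
  ⟨h, fun u x => by
    have := h.hasDerivAt_deriv u x
    rwa [h' u x] at this⟩

variable {S}

lemma IsVacuum.td_mA (h : S.IsVacuum) :
    TD S.mA (fun u => (-(1 / 8) : ℝ) • dot (S.NT u) (S.NT u) + (1 / 4 : ℝ) • DDv (S.NT u)) := by
  refine td_of_deriv S.smooth_m fun u x => ?_
  have h1 : div2 (S.news u) = fun j => (Dv (S.NT u) j).1 :=
    funext fun j => funext fun x => (S.stf_NT u).div2_coe j x
  have h2 : contract (S.news u) (S.news u) x = ev x (dot (S.NT u) (S.NT u)) :=
    contract_coe (S.NT u) (S.NT u) x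
  refine (h.evolution_m u x).trans ?_
  rw [h1, h2, div1_coe, map_add, map_smul, map_smul]
  rfl

/-- The term of ∂_u m that is linear in the news is the time derivative of ¼∇∇C, so only the
quadratic loss remains. -/
lemma IsVacuum.td_MA (h : S.IsVacuum) :
    TD S.MA (fun u => (-(1 / 8) : ℝ) • dot (S.NT u) (S.NT u)) := by
  have := h.td_mA.sub (S.td_DDvC.smul (1 / 4))
  simp only [add_sub_cancel_right] at this
  exact this

lemma IsVacuum.td_aA (h : S.IsVacuum) (k : Fin 3) :
    TD (S.aA k) (fun u => D k (S.mA u)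
      - (1 / 4 : ℝ) • Dvg (fun d b => Cov (Dv (S.CT u)) d b - Cov (Dv (S.CT u)) b d) k
      + (1 / 4 : ℝ) • D k (dot (S.CT u) (S.NT u))
      - (1 / 4 : ℝ) • Dvg (fun b e => ∑ d, S.CT u b d * S.NT u d e) k
      + (1 / 2 : ℝ) • ∑ b, S.CT u k b * Dv (S.NT u) b) := by
  refine td_of_deriv (S.smooth_aspect k) fun u x => ?_
  have h1 : div2 (S.news u) = fun j => (Dv (S.NT u) j).1 :=
    funext fun j => funext fun x => (S.stf_NT u).div2_coe j x
  have h1' : div2 (S.shear u) = fun j => (Dv (S.CT u) j).1 :=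
    funext fun j => funext fun x => (S.stf_CT u).div2_coe j x
  have h2 : contract (S.shear u) (S.news u) = (dot (S.CT u) (S.NT u)).1 :=
    funext fun x => contract_coe (S.CT u) (S.NT u) x
  have h3 : (fun d b y => cov1 (div2 (S.shear u)) d b y - cov1 (div2 (S.shear u)) b d y) =
      fun d b => (Cov (Dv (S.CT u)) d b - Cov (Dv (S.CT u)) b d).1 := by
    funext d b y
    rw [h1', cov1_coe, cov1_coe]; rfl
  have h4 : (fun b e y => ∑ d, S.shear u b d y * S.news u d e y) =
      fun b e => (∑ d, S.CT u b d * S.NT u d e).1 := by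
    funext b e y
    rw [← ev_apply, map_sum]
    rfl
  refine (h.evolution_aspect u k x).trans ?_
  rw [h3, h4, h2, div2_coe', div2_coe', grad_coe, h1]
  simp only [map_add, map_sub, map_smul, smul_eq_mul, map_sum, map_mul]
  rfl

/-- The density of the flux of the classical center of mass. -/
def fluxA (S : ScriData) (k : Fin 3) (u : ℝ) : smoothS2 :=
  (u / 4) • (X k * dot (S.NT u) (S.NT u)) + (1 / 4 : ℝ) • pair k (S.CT u) (S.NT u)

/-- ∇X^k is the projection of the k-th basis vector, so contracting it with a tangential covector
selects the k-th Cartesian component. -/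
lemma sum_grad_coord (V : Fin 3 → smoothS2) (hV : X 0 * V 0 + X 1 * V 1 + X 2 * V 2 = 0)
    (k : Fin 3) (x : S2) : ∑ a, grad (coord k) a x * ev x (V a) = ev x (V k) := by
  have h1 := congrArg (ev x) (P_mul_of_tangent hV k)
  rw [← h1]
  have h2 : ∀ a, grad (coord k) a x = ev x (P k a) := fun a => by
    rw [P_symm, ← D_X]; rfl
  simp only [h2, Fin.sum_univ_three, map_add, map_mul]

/-! ### The classical center of mass and its time derivative -/

variable (S)

lemma aA_tangent (u : ℝ) : X 0 * S.aA 0 u + X 1 * S.aA 1 u + X 2 * S.aA 2 u = 0 :=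
  ev_ext fun x => by simpa [Fin.sum_univ_three] using! S.aspect_tangent u x

lemma classicalCenterOfMass_eq (k : Fin 3) (u : ℝ) :
    S.classicalCenterOfMass k u = I (S.aA k u - algebraMap ℝ smoothS2 u * D k (S.mA u)
      - (1 / 4 : ℝ) • ∑ d, S.CT u k d * Dv (S.CT u) d
      - (1 / 16 : ℝ) • D k (dot (S.CT u) (S.CT u))) := by
  have h1 : div2 (S.shear u) = fun j => (Dv (S.CT u) j).1 :=
    funext fun j => funext fun x => (S.stf_CT u).div2_coe j x
  have h2 : contract (S.shear u) (S.shear u) = (dot (S.CT u) (S.CT u)).1 :=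
    funext fun x => contract_coe (S.CT u) (S.CT u) x
  rw [classicalCenterOfMass, I_apply]
  congr 1
  funext x
  refine Eq.trans ?_ (sum_grad_coord (fun k => S.aA k u - algebraMap ℝ smoothS2 u * D k (S.mA u)
      - (1 / 4 : ℝ) • ∑ d, S.CT u k d * Dv (S.CT u) d
      - (1 / 16 : ℝ) • D k (dot (S.CT u) (S.CT u))) ?_ k x)
  · rw [h1, h2]
    refine Finset.sum_congr rfl fun a _ => ?_
    congr 1
  · have e1 := S.aA_tangent u
    have e2 := sum_X_D' (S.mA u)
    have e3 := sum_X_D' (dot (S.CT u) (S.CT u))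
    have e4 := fun d => (S.stf_CT u).tangent' d
    simp only [Algebra.smul_def, Fin.sum_univ_three]
    linear_combination e1 - algebraMap ℝ smoothS2 u * e2 - algebraMap ℝ smoothS2 (1 / 16) * e3
      - algebraMap ℝ smoothS2 (1 / 4) * (Dv (S.CT u) 0 * e4 0 + Dv (S.CT u) 1 * e4 1
        + Dv (S.CT u) 2 * e4 2)

variable {S}

/-- X^k lies in the kernel of the trace-free Hessian, the adjoint of the double divergence; here
this appears as ∫ D_i T_{ik} = 2∫ X_i T_{ik} = 0. -/
lemma I_X_mul_DDv {T : Fin 3 → Fin 3 → smoothS2} (h : STF T) (k : Fin 3) :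
    I (X k * DDv T) = 0 := by
  have e : ∑ j, Dv T j * D j (X k) = Dv T k := by
    rw [← P_mul_of_tangent h.tangent_Dv k]
    simp only [D_X, Fin.sum_univ_three, P_symm k]; ring
  rw [I_DDv_mul h, e, Dv, map_sum]
  simp only [I_D, ← Finset.mul_sum, ← map_sum, h.tangent, map_zero, mul_zero, neg_zero]

lemma I_DDv {T : Fin 3 → Fin 3 → smoothS2} (h : STF T) : I (DDv T) = 0 := by
  have := I_DDv_mul h 1
  simpa using this

/-- The ∇m terms cancel, and -u∇∂_u m integrates to (u/4)∫ X^k|N|² since the double divergence drops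
out. The multiples of ∫ X^k C·N add up to ½ - ¼ - ¼ = 0, and what is left of C∇·N and N∇·C is a
quarter of their antisymmetric pairing. -/
theorem IsVacuum.hasDerivAt_classicalCenterOfMass (h : S.IsVacuum) (k : Fin 3) (u : ℝ) :
    HasDerivAt (S.classicalCenterOfMass k) (I (S.fluxA k u)) u := by
  have hm := h.td_mA.D k
  have h1 := ((h.td_aA k).sub (td_id.mul hm)).sub
    ((TD.sum fun d => (S.td_CA k d).mul (S.td_DvC d)).smul (1 / 4))
  have h2 := h1.sub ((TD.D (TD.sum fun i => TD.sum fun j =>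
    (S.td_CA i j).mul (S.td_CA i j)) k).smul (1 / 16))
  have h3 := h2.hasDerivAt_I u
  have e0 : S.classicalCenterOfMass k = fun u => _ := funext (S.classicalCenterOfMass_eq k)
  rw [e0]
  refine h3.congr_deriv ?_
  have d1 : ∑ i, ∑ j, (S.NA i j u * S.CA i j u + S.CA i j u * S.NA i j u) =
      (2 : ℝ) • dot (S.CT u) (S.NT u) := by
    rw [dot, Finset.smul_sum]
    refine Finset.sum_congr rfl fun i _ => ?_
    rw [Finset.smul_sum]
    refine Finset.sum_congr rfl fun j _ => ?_
    rw [two_smul, mul_comm]; rfl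
  have d2 : ∑ d, (S.NA k d u * Dv (S.CT u) d + S.CA k d u * Dv (S.NT u) d) =
      ∑ d, S.NT u k d * Dv (S.CT u) d + ∑ d, S.CT u k d * Dv (S.NT u) d := by
    rw [← Finset.sum_add_distrib]; rfl
  have d3 : pair k (S.CT u) (S.NT u) =
      ∑ d, S.CT u k d * Dv (S.NT u) d - ∑ d, S.NT u k d * Dv (S.CT u) d := by
    rw [← Finset.sum_sub_distrib]; rfl
  have hV := (S.stf_CT u).tangent_Dv
  -- An antisymmetric tangential tensor has no trace, so by `I_Dvg` the curl term does not
  -- contribute.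
  have d4 : I (Dvg (fun d b => Cov (Dv (S.CT u)) d b - Cov (Dv (S.CT u)) b d) k) = 0 := by
    have t1 : ∀ n, X 0 * Cov (Dv (S.CT u)) 0 n + X 1 * Cov (Dv (S.CT u)) 1 n +
        X 2 * Cov (Dv (S.CT u)) 2 n = 0 := fun n => by
      have := fun l => sum_X_D' (Dv (S.CT u) l)
      simp only [Cov, Fin.sum_univ_three]
      linear_combination P n 0 * this 0 + P n 1 * this 1 + P n 2 * this 2
    have t2 : ∀ n, X 0 * Cov (Dv (S.CT u)) n 0 + X 1 * Cov (Dv (S.CT u)) n 1 +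
        X 2 * Cov (Dv (S.CT u)) n 2 = 0 := fun n => by
      have := sum_X_P
      simp only [Cov, Fin.sum_univ_three]
      linear_combination D n (Dv (S.CT u) 0) * this 0 + D n (Dv (S.CT u) 1) * this 1
        + D n (Dv (S.CT u) 2) * this 2
    rw [I_Dvg _ (fun n => by linear_combination t1 n - t2 n)
      (fun n => by linear_combination t2 n - t1 n)]
    simp
  have d5 : I (Dvg (fun b e => ∑ d, S.CT u b d * S.NT u d e) k) =
      I (X k * dot (S.CT u) (S.NT u)) := by
    have c1 := (S.stf_CT u).tangent'
    have n1 := (S.stf_NT u).tangent_right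
    rw [I_Dvg]
    · simp only [dot, (S.stf_NT u).symm]
    · intro n
      simp only [Fin.sum_univ_three]
      linear_combination S.NT u 0 n * c1 0 + S.NT u 1 n * c1 1 + S.NT u 2 n * c1 2
    · intro n
      simp only [Fin.sum_univ_three]
      linear_combination S.CT u n 0 * n1 0 + S.CT u n 1 * n1 1 + S.CT u n 2 * n1 2
  have d6 : ∀ a φ, I (algebraMap ℝ smoothS2 a * φ) = a * I φ := fun a φ => by
    rw [← Algebra.smul_def, map_smul, smul_eq_mul]
  rw [d1, d2, fluxA, d3]
  simp only [map_sub, map_add, map_smul, Derivation.map_smul, smul_eq_mul, one_mul, d4, d5, d6,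
    I_D, mul_add, mul_smul_comm, I_X_mul_DDv (S.stf_NT u)]
  ring

end ScriData

/-! ### Supertranslations -/

namespace ScriData

variable (S : ScriData)

/-- The time derivative of the news. -/
def N2A (i j : Fin 3) (u : ℝ) : smoothS2 := toA (fun x => deriv (fun s => ev x (S.NA i j s)) u)

lemma td_NA (i j : Fin 3) : TD (S.NA i j) (S.N2A i j) := td_of_smooth (S.td_CA i j).smooth'

lemma ev_N2A (i j : Fin 3) (u : ℝ) (x : S2) :
    ev x (S.N2A i j u) = deriv (fun s => S.news s i j x) u :=
  ((S.td_NA i j).hasDerivAt u x).deriv.symm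

lemma td_DvN (j : Fin 3) : TD (fun u => Dv (S.NT u) j)
    (fun u => Dv (fun i j => S.N2A i j u) j) :=
  TD.Dv (fun i j => S.td_NA i j) j

/-- The shifted shear at a fixed time. -/
def shC (f : smoothS2) (u : ℝ) (i j : Fin 3) : smoothS2 := sh f (S.CA i j) u

/-- The shifted news at a fixed time. -/
def shN (f : smoothS2) (u : ℝ) (i j : Fin 3) : smoothS2 := sh f (S.NA i j) u

variable (f : smoothS2)

lemma stf_shN (u : ℝ) : STF (S.shN f u) where
  tangent j := ev_ext fun x => by
    have := congrArg (ev x) ((S.stf_NT (u + ev x f)).tangent j)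
    simpa [shN, ev_sh f (S.td_CA _ _).smooth'] using! this
  symm i j := ev_ext fun x => by
    have := congrArg (ev x) ((S.stf_NT (u + ev x f)).symm i j)
    simpa [shN, ev_sh f (S.td_CA _ _).smooth'] using! this
  traceless := ev_ext fun x => by
    have := congrArg (ev x) ((S.stf_NT (u + ev x f)).traceless)
    simpa [shN, ev_sh f (S.td_CA _ _).smooth'] using! this

lemma stf_shC (u : ℝ) : STF (S.shC f u) where
  tangent j := ev_ext fun x => by
    have := congrArg (ev x) ((S.stf_CT (u + ev x f)).tangent j)
    simpa [shC, ev_sh f (S.td_CA _ _).smooth] using! this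
  symm i j := ev_ext fun x => by
    have := congrArg (ev x) ((S.stf_CT (u + ev x f)).symm i j)
    simpa [shC, ev_sh f (S.td_CA _ _).smooth] using! this
  traceless := ev_ext fun x => by
    have := congrArg (ev x) ((S.stf_CT (u + ev x f)).traceless)
    simpa [shC, ev_sh f (S.td_CA _ _).smooth] using! this

lemma Dv_shC (u : ℝ) (j : Fin 3) : Dv (S.shC f u) j =
    sh f (fun u => Dv (S.CT u) j) u + ∑ i, S.shN f u i j * D i f := by
  have h1 : sh f (fun u => Dv (S.CT u) j) u = ∑ i, sh f (fun u => D i (S.CA i j u)) u :=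
    sh_sum f (F := fun i u => D i (S.CA i j u)) (fun i => ((S.td_CA i j).D i).smooth) u
  rw [h1, ← Finset.sum_add_distrib]
  exact Finset.sum_congr rfl fun i _ => (S.td_CA i j).D_sh f i u

lemma Dv_shN (u : ℝ) (j : Fin 3) : Dv (S.shN f u) j =
    sh f (fun u => Dv (S.NT u) j) u + ∑ i, sh f (S.N2A i j) u * D i f := by
  have h1 : sh f (fun u => Dv (S.NT u) j) u = ∑ i, sh f (fun u => D i (S.NA i j u)) u :=
    sh_sum f (F := fun i u => D i (S.NA i j u)) (fun i => ((S.td_NA i j).D i).smooth) u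
  rw [h1, ← Finset.sum_add_distrib]
  exact Finset.sum_congr rfl fun i _ => (S.td_NA i j).D_sh f i u

/-- The chain rule applied twice. One quarter of the three correction terms is precisely the
correction in the transformation law of m. -/
lemma DDv_shC (u : ℝ) : DDv (S.shC f u) = sh f (fun u => DDv (S.CT u)) u
    + 2 * ∑ j, sh f (fun u => Dv (S.NT u) j) u * D j f
    + ∑ i, ∑ j, sh f (S.N2A i j) u * D i f * D j f
    + ∑ i, ∑ j, S.shN f u i j * D i (D j f) := by
  have h1 : sh f (fun u => DDv (S.CT u)) u = ∑ j, sh f (fun u => D j (Dv (S.CT u) j)) u :=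
    sh_sum f (F := fun j u => D j (Dv (S.CT u) j)) (fun j => ((S.td_DvC j).D j).smooth) u
  have h2 : ∀ j, D j (Dv (S.shC f u) j) = sh f (fun u => D j (Dv (S.CT u) j)) u
      + sh f (fun u => Dv (S.NT u) j) u * D j f
      + ∑ i, (D j (S.shN f u i j) * D i f + S.shN f u i j * D j (D i f)) := fun j => by
    rw [Dv_shC, map_add, (S.td_DvC j).D_sh f j u, map_sum]
    congr 1
    refine Finset.sum_congr rfl fun i _ => ?_
    rw [Derivation.leibniz, smul_eq_mul, smul_eq_mul]; ring
  have h3 : ∑ j, ∑ i, D j (S.shN f u i j) * D i f = ∑ i, Dv (S.shN f u) i * D i f := by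
    rw [Finset.sum_comm]
    refine Finset.sum_congr rfl fun i _ => ?_
    rw [(S.stf_shN f u).Dv_eq, Finset.sum_mul]
  have h4 : ∑ i, Dv (S.shN f u) i * D i f = ∑ j, sh f (fun u => Dv (S.NT u) j) u * D j f
      + ∑ i, ∑ j, sh f (S.N2A i j) u * D i f * D j f := by
    rw [Finset.sum_comm, ← Finset.sum_add_distrib]
    refine Finset.sum_congr rfl fun i _ => ?_
    rw [Dv_shN, add_mul, Finset.sum_mul]
  have h5 : ∑ j, ∑ i, S.shN f u i j * D j (D i f) = ∑ i, ∑ j, S.shN f u i j * D i (D j f) := by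
    refine Finset.sum_congr rfl fun i _ => Finset.sum_congr rfl fun j _ => ?_
    rw [(S.stf_shN f u).symm]
  rw [DDv, Finset.sum_congr rfl fun j _ => h2 j]
  simp only [Finset.sum_add_distrib]
  rw [h3, h4, h5, h1]
  ring

variable {S f} {S' : ScriData}

section

variable (hst : IsSupertranslate f.1 S S')

include hst

lemma IsSupertranslate.CA_eq (i j : Fin 3) :
    S'.CA i j = fun u => sh f (S.CA i j) u - (2 : ℝ) • Cl f i j := by
  funext u
  refine ev_ext fun x => ?_
  rw [map_sub, map_smul, ev_sh f (S.td_CA i j).smooth, ← closedPart_coe, closedPart, smul_eq_mul]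
  refine (hst.shear_eq u i j x).trans ?_
  change S.shear (u + f.1 x) i j x - 2 * _ + _ = S.shear (u + f.1 x) i j x - _
  ring

lemma IsSupertranslate.CT_eq (u : ℝ) :
    S'.CT u = fun i j => S.shC f u i j - (2 : ℝ) • Cl f i j := by
  funext i j
  exact congrFun (hst.CA_eq i j) u

lemma IsSupertranslate.NT_eq (u : ℝ) : S'.NT u = S.shN f u := by
  funext i j
  have h1 := S'.td_CA i j
  rw [hst.CA_eq i j] at h1
  have h2 := ((S.td_CA i j).sh f).sub (td_const ((2 : ℝ) • Cl f i j))
  simp only [sub_zero] at h2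
  exact congrFun (h1.deriv_unique h2) u

/-- The corrections of m and of ¼∇∇C cancel, leaving the shift and the time-independent contribution
of -2 Cl f to the shear. -/
lemma IsSupertranslate.MA_eq (u : ℝ) :
    S'.MA u = sh f S.MA u + (1 / 2 : ℝ) • DDv (Cl f) := by
  have h1 : DDv (S'.CT u) = DDv (S.shC f u) - (2 : ℝ) • DDv (Cl f) := by
    rw [hst.CT_eq]
    simp only [DDv, Dv, map_sub, map_sum, Derivation.map_smul, Finset.sum_sub_distrib,
      ← Finset.smul_sum]
  have hm : SmoothOnScri (fun u => (S.mA u).1) := S.smooth_m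
  have h2 : sh f S.MA u = sh f S.mA u - (1 / 4 : ℝ) • sh f (fun u => DDv (S.CT u)) u := by
    have hs := (S.td_DDvC.smul (-(1 / 4))).smooth
    have e := sh_add f hm hs u
    have e2 := sh_mul f (td_const (algebraMap ℝ smoothS2 (-(1 / 4)))).smooth S.td_DDvC.smooth u
    rw [sh_const] at e2
    simp only [Algebra.smul_def] at e
    rw [e2] at e
    have e3 : S.MA = fun u => S.mA u + algebraMap ℝ smoothS2 (-(1 / 4)) * DDv (S.CT u) := by
      funext u
      rw [MA, ← Algebra.smul_def, neg_smul, sub_eq_add_neg]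
    rw [e3, e, ← Algebra.smul_def, neg_smul, sub_eq_add_neg]
  have h3 : S'.mA u = sh f S.mA u + (1 / 2 : ℝ) • ∑ j, sh f (fun u => Dv (S.NT u) j) u * D j f
      + (1 / 4 : ℝ) • ∑ i, ∑ j, sh f (S.N2A i j) u * D i f * D j f
      + (1 / 4 : ℝ) • ∑ i, ∑ j, S.shN f u i j * D i (D j f) := by
    refine ev_ext fun x => (hst.m_eq u x).trans ?_
    have e1 : div2 (S.news (u + f.1 x)) = fun j => (Dv (S.NT (u + f.1 x)) j).1 :=
      funext fun j => funext fun x => (S.stf_NT _).div2_coe j x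
    have e2 : ∑ i, ∑ j, S.shN f u i j * D i (D j f) =
        ∑ i, ∑ j, S.shN f u i j * (D i (D j f) + X j * D i f) := by
      have := (S.stf_shN f u).tangent_right
      simp only [Fin.sum_univ_three]
      linear_combination - D 0 f * this 0 - D 1 f * this 1 - D 2 f * this 2
    rw [e1, e2]
    simp only [hess_coe, ← ev_N2A, grad_coe]
    rw [map_add, map_add, map_add, map_smul, map_smul, map_smul, ev_sh f hm]
    simp only [map_sum, map_mul, ev_sh f (S.td_DvN _).smooth, ev_sh f (S.td_NA _ _).smooth',
      shN, ev_sh f (S.td_NA _ _).smooth]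
    rfl
  rw [MA, h1, DDv_shC, h2, h3]
  simp only [Algebra.smul_def]
  have e1 : algebraMap ℝ smoothS2 (1 / 4) * 2 = algebraMap ℝ smoothS2 (1 / 2) := by
    rw [← map_ofNat (algebraMap ℝ smoothS2) 2, ← map_mul]; norm_num
  have e2 : algebraMap ℝ smoothS2 2 = 2 := map_ofNat _ 2
  rw [e2]
  linear_combination (DDv (Cl f) - ∑ j, sh f (fun u => Dv (S.NT u) j) u * D j f) * e1

end

/-- The boundary term in the change of the flux under a supertranslation. -/
def bdryA (S : ScriData) (f : smoothS2) (k : Fin 3) (u : ℝ) : smoothS2 :=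
  (2 : ℝ) • ((f * X k + D k f) * sh f S.MA u)
    + (1 / 4 : ℝ) • ∑ b, ∑ d, S.shC f u k b * S.shN f u d b * D d f
    - (1 / 2 : ℝ) • pair k (Cl f) (S.shC f u)

lemma IsVacuum.td_bdryA (h : S.IsVacuum) (k : Fin 3) :
    TD (S.bdryA f k) (fun u =>
      (2 : ℝ) • ((f * X k + D k f) * sh f (fun u => (-(1 / 8) : ℝ) • dot (S.NT u) (S.NT u)) u)
      + (1 / 4 : ℝ) • ∑ b, ∑ d, (S.shN f u k b * S.shN f u d b
        + S.shC f u k b * sh f (S.N2A d b) u) * D d f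
      - (1 / 2 : ℝ) • pair k (Cl f) (S.shN f u)) := by
  have hC := fun i j => (S.td_CA i j).sh f
  have hN := fun i j => (S.td_NA i j).sh f
  have h1 := ((h.td_MA.sh f).const_mul (f * X k + D k f)).smul 2
  have h2 : TD (fun u => ∑ b, ∑ d, S.shC f u k b * S.shN f u d b * D d f)
      (fun u => ∑ b, ∑ d, (S.shN f u k b * S.shN f u d b
        + S.shC f u k b * sh f (S.N2A d b) u) * D d f) :=
    TD.sum fun b => TD.sum fun d => by
      have := ((hC k b).mul (hN d b)).mul (td_const (D d f))
      simp only [mul_zero, add_zero] at this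
      exact this
  have h3 : TD (fun u => pair k (Cl f) (S.shC f u)) (fun u => pair k (Cl f) (S.shN f u)) :=
    TD.sum fun b => ((TD.Dv hC b).const_mul (Cl f k b)).sub (by
      have := (hC k b).mul (td_const (Dv (Cl f) b))
      simp only [mul_zero, add_zero] at this
      exact this)
  exact (h1.add (h2.smul (1 / 4))).sub (h3.smul (1 / 2))

/-! ### The flux density and its change under a supertranslation -/

lemma smooth_dotN (S : ScriData) : SmoothOnScri (fun u => (dot (S.NT u) (S.NT u)).1) :=
  (TD.sum fun i => TD.sum fun j => (S.td_NA i j).mul (S.td_NA i j)).smooth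

lemma smooth_pairCN (S : ScriData) (k : Fin 3) :
    SmoothOnScri (fun u => (pair k (S.CT u) (S.NT u)).1) :=
  (TD.sum fun b => ((S.td_CA k b).mul (S.td_DvN b)).sub ((S.td_NA k b).mul (S.td_DvC b))).smooth

lemma fluxA_eq (S : ScriData) (k : Fin 3) (u : ℝ) : S.fluxA k u =
    algebraMap ℝ smoothS2 (1 / 4) * X k * (algebraMap ℝ smoothS2 u * dot (S.NT u) (S.NT u))
    + algebraMap ℝ smoothS2 (1 / 4) * pair k (S.CT u) (S.NT u) := by
  rw [fluxA, Algebra.smul_def, Algebra.smul_def, div_eq_mul_one_div, map_mul]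
  ring

lemma smooth_fluxA (S : ScriData) (k : Fin 3) : SmoothOnScri (fun u => (S.fluxA k u).1) := by
  simp only [fluxA_eq]
  exact ((td_const _).smooth.mul (td_id.smooth.mul S.smooth_dotN)).add
    ((td_const _).smooth.mul (S.smooth_pairCN k))

lemma sh_fluxA (S : ScriData) (f : smoothS2) (k : Fin 3) (u : ℝ) : sh f (S.fluxA k) u =
    algebraMap ℝ smoothS2 (1 / 4) * (X k * ((algebraMap ℝ smoothS2 u + f) *
      dot (S.shN f u) (S.shN f u)) + ∑ b, (S.shC f u k b * sh f (fun u => Dv (S.NT u) b) u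
        - S.shN f u k b * sh f (fun u => Dv (S.CT u) b) u)) := by
  refine ev_ext fun x => ?_
  rw [ev_sh f (S.smooth_fluxA k), fluxA_eq]
  simp only [map_add, map_mul, pair, dot, map_sum, map_sub, ev_sh f (S.td_DvN _).smooth,
    ev_sh f (S.td_DvC _).smooth, shN, shC, ev_sh f (S.td_NA _ _).smooth,
    ev_sh f (S.td_CA _ _).smooth, AlgHom.commutes]
  simp only [Algebra.algebraMap_self, RingHom.id_apply]
  ring_nf
  rfl

/-- The bracket is the derivative of `bdryA` found in `td_bdryA`. The discrepancy between the
weights u and u + f gives the f X_k term. The D_k f term arises because the chain rule produces N N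
∇f with the opposite sign to the one in the derivative of `bdryA`; by `STF.sq_eq` twice that
expression equals |N|² D_k f. -/
theorem fluxA_supertranslate (hst : IsSupertranslate f.1 S S') (k : Fin 3)
    (u : ℝ) : S'.fluxA k u = sh f (S.fluxA k) u +
      ((2 : ℝ) • ((f * X k + D k f) * sh f (fun u => (-(1 / 8) : ℝ) • dot (S.NT u) (S.NT u)) u)
      + (1 / 4 : ℝ) • ∑ b, ∑ d, (S.shN f u k b * S.shN f u d b
        + S.shC f u k b * sh f (S.N2A d b) u) * D d f
      - (1 / 2 : ℝ) • pair k (Cl f) (S.shN f u)) := by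
  have e1 : sh f (fun u => (-(1 / 8) : ℝ) • dot (S.NT u) (S.NT u)) u =
      algebraMap ℝ smoothS2 (-(1 / 8)) * dot (S.shN f u) (S.shN f u) := by
    refine ev_ext fun x => ?_
    rw [ev_sh f (((td_of_smooth S.smooth_dotN).smul _).smooth)]
    simp only [map_smul, map_mul, dot, map_sum, shN, ev_sh f (S.td_NA _ _).smooth,
      AlgHom.commutes]
    rfl
  have e2 : pair k (S'.CT u) (S.shN f u) =
      ∑ b, (S.shC f u k b * sh f (fun u => Dv (S.NT u) b) u
        - S.shN f u k b * sh f (fun u => Dv (S.CT u) b) u)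
      + ∑ b, ∑ d, (S.shC f u k b * sh f (S.N2A d b) u) * D d f
      - ∑ b, ∑ d, (S.shN f u k b * S.shN f u d b) * D d f
      - 2 * pair k (Cl f) (S.shN f u) := by
    have t1 : ∀ b, Dv (S'.CT u) b = Dv (S.shC f u) b - 2 * Dv (Cl f) b := fun b => by
      have e3 : ∀ φ : smoothS2, (2 : ℝ) • φ = 2 * φ := fun φ => by rw [two_smul, two_mul]
      rw [hst.CT_eq]
      simp only [Dv, map_sub, Derivation.map_smul, Finset.sum_sub_distrib, ← Finset.smul_sum]
      rw [e3]
    have t2 : ∀ b, S'.CT u k b = S.shC f u k b - 2 * Cl f k b := fun b => by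
      rw [hst.CT_eq]
      show S.shC f u k b - (2 : ℝ) • Cl f k b = _
      rw [two_smul, two_mul]
    simp only [pair, Finset.mul_sum, ← Finset.sum_add_distrib, ← Finset.sum_sub_distrib]
    refine Finset.sum_congr rfl fun b _ => ?_
    rw [t1, t2, Dv_shC, Dv_shN]
    simp only [Fin.sum_univ_three]
    ring
  have e3 : 2 * ∑ b, ∑ d, (S.shN f u k b * S.shN f u d b) * D d f =
      dot (S.shN f u) (S.shN f u) * D k f := by
    rw [← P_mul_D' k f, Finset.sum_comm, Finset.mul_sum, Finset.mul_sum]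
    refine Finset.sum_congr rfl fun d _ => ?_
    rw [← mul_assoc, ← (S.stf_shN f u).sq_eq k d, Finset.mul_sum, Finset.mul_sum, Finset.sum_mul]
    refine Finset.sum_congr rfl fun b _ => ?_
    rw [(S.stf_shN f u).symm d b]
    ring
  have a1 : algebraMap ℝ smoothS2 2 = 2 := map_ofNat _ 2
  have a2 : algebraMap ℝ smoothS2 (-(1 / 8)) * 2 = - algebraMap ℝ smoothS2 (1 / 4) := by
    rw [← a1, ← map_mul, ← map_neg]; norm_num
  have a3 : algebraMap ℝ smoothS2 (1 / 2) = 2 * algebraMap ℝ smoothS2 (1 / 4) := by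
    rw [← a1, ← map_mul]; norm_num
  have e4 : ∑ b, ∑ d, (S.shN f u k b * S.shN f u d b
      + S.shC f u k b * sh f (S.N2A d b) u) * D d f =
      ∑ b, ∑ d, (S.shN f u k b * S.shN f u d b) * D d f
      + ∑ b, ∑ d, (S.shC f u k b * sh f (S.N2A d b) u) * D d f := by
    simp only [add_mul, Finset.sum_add_distrib]
  rw [fluxA_eq, hst.NT_eq, sh_fluxA, e1, e2, e4]
  simp only [Algebra.smul_def]
  rw [a1, a3]
  linear_combination (-(algebraMap ℝ smoothS2 (1 / 4))) * e3
    - (f * X k + D k f) * dot (S.shN f u) (S.shN f u) * a2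

end ScriData

/-! ### Limits at infinity, uniform on the sphere -/

lemma eventually_prod_top {α : Type*} {l : Filter α} {p : α × S2 → Prop} :
    (∀ᶠ q in l ×ˢ (⊤ : Filter S2), p q) ↔ ∀ᶠ u in l, ∀ x, p (u, x) := by
  rw [← principal_univ, eventually_prod_principal_iff]
  simp

/-- `h (u, x)` tends to zero along `l`, uniformly on the sphere. -/
def UZero (l : Filter ℝ) (h : ℝ → S2 → ℝ) : Prop :=
  Tendsto (fun p : ℝ × S2 => h p.1 p.2) (l ×ˢ ⊤) (𝓝 0)

/-- `h (u, x)` is Cauchy along `l`, uniformly on the sphere. -/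
def UCauchy (l : Filter ℝ) (h : ℝ → S2 → ℝ) : Prop :=
  Tendsto (fun p : (ℝ × ℝ) × S2 => h p.1.1 p.2 - h p.1.2 p.2) ((l ×ˢ l) ×ˢ ⊤) (𝓝 0)

lemma tendsto_prod_top_zero {α : Type*} {l : Filter α} {h : α × S2 → ℝ} :
    Tendsto h (l ×ˢ ⊤) (𝓝 0) ↔ ∀ η > 0, ∀ᶠ u in l, ∀ x, |h (u, x)| ≤ η := by
  rw [Metric.tendsto_nhds]
  simp only [eventually_prod_top, Real.dist_eq, sub_zero]
  refine ⟨fun H η hη => (H η hη).mono fun u hu x => (hu x).le, fun H η hη => ?_⟩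
  exact (H (η / 2) (half_pos hη)).mono fun u hu x => (hu x).trans_lt (half_lt_self hη)

/-- Mean value inequality against the explicit primitive of K t^(-1-ε); the bound is independent of
x and tends to zero with v → ∞. -/
lemma abs_sub_le_of_deriv_le {h h' : ℝ → ℝ} {K ε v u : ℝ} (hε : 0 < ε) (hv : 0 < v) (huv : v ≤ u)
    (hd : ∀ t, HasDerivAt h (h' t) t) (hb : ∀ t, v ≤ t → |h' t| ≤ K * t ^ (-1 - ε)) :
    |h u - h v| ≤ K / ε * (v ^ (-ε) - u ^ (-ε)) := by
  have hB : ∀ t, v ≤ t → HasDerivAt (fun t : ℝ => K / ε * (v ^ (-ε) - t ^ (-ε)))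
      (K * t ^ (-1 - ε)) t := fun t ht => by
    have h1 := Real.hasDerivAt_rpow_const (x := t) (p := -ε) (Or.inl (hv.trans_le ht).ne')
    have h2 := (h1.const_sub (v ^ (-ε))).const_mul (K / ε)
    refine h2.congr_deriv ?_
    rw [show -ε - 1 = -1 - ε by ring]
    field_simp
  have := image_norm_le_of_norm_deriv_right_le_deriv_boundary' (a := v) (b := u)
    (f := fun t => h t - h v) (f' := h')
    (fun t _ => ((hd t).sub_const _).continuousAt.continuousWithinAt)
    (fun t _ => ((hd t).sub_const _).hasDerivWithinAt)
    (B := fun t : ℝ => K / ε * (v ^ (-ε) - t ^ (-ε))) (B' := fun t => K * t ^ (-1 - ε)) (by simp)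
    (fun t ht => (hB t ht.1).continuousAt.continuousWithinAt)
    (fun t ht => (hB t ht.1).hasDerivWithinAt) (fun t ht => hb t ht.1)
    (x := u) ⟨huv, le_rfl⟩
  exact this

lemma uCauchy_atTop_of_deriv {h h' : ℝ → S2 → ℝ} {ε : ℝ} (hε : 0 < ε)
    (hd : ∀ u x, HasDerivAt (fun s => h s x) (h' u x) u)
    (hO : (fun p : ℝ × S2 => h' p.1 p.2) =O[atTop ×ˢ ⊤] fun p => |p.1| ^ (-1 - ε)) :
    UCauchy atTop h := by
  obtain ⟨K, hK, hO⟩ := hO.exists_pos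
  rw [Asymptotics.isBigOWith_iff, eventually_prod_top] at hO
  obtain ⟨R, hR⟩ := eventually_atTop.1 (hO.and (eventually_ge_atTop 1))
  have hb : ∀ t, R ≤ t → ∀ x, |h' t x| ≤ K * t ^ (-1 - ε) := fun t ht x => by
    have h1 := (hR t ht).1 x
    have h2 : (0 : ℝ) ≤ t := zero_le_one.trans (hR t ht).2
    simpa [abs_of_nonneg h2, abs_of_nonneg (Real.rpow_nonneg h2 _)] using h1
  refine tendsto_prod_top_zero.2 fun η hη => ?_
  have hlim : Tendsto (fun t : ℝ => K / ε * t ^ (-ε)) atTop (𝓝 0) := by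
    simpa using (tendsto_rpow_neg_atTop hε).const_mul (K / ε)
  obtain ⟨B, hB⟩ := eventually_atTop.1 ((hlim.eventually (gt_mem_nhds hη)).and
    ((eventually_ge_atTop R).and (eventually_ge_atTop 1)))
  have key : ∀ u v, B ≤ v → v ≤ u → ∀ x, |h u x - h v x| ≤ η := fun u v hv hu x => by
    obtain ⟨h1, h2, h3⟩ := hB v hv
    have hv0 : 0 < v := by linarith
    refine (abs_sub_le_of_deriv_le hε hv0 hu (fun t => hd t x)
      (fun t ht => hb t (h2.trans ht) x)).trans (le_trans ?_ h1.le)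
    have := Real.rpow_nonneg (hv0.le.trans hu) (-ε)
    gcongr
    linarith
  filter_upwards [(eventually_ge_atTop B).prod_mk (eventually_ge_atTop B)] with p hp x
  rcases le_total p.1 p.2 with h1 | h1
  · rw [abs_sub_comm]
    exact key _ _ hp.1 h1 x
  · exact key _ _ hp.2 h1 x

lemma UCauchy.comp_neg {h : ℝ → S2 → ℝ} (H : UCauchy atTop (fun u => h (-u))) :
    UCauchy atBot h := by
  have h1 : Tendsto (fun p : (ℝ × ℝ) × S2 => ((-p.1.1, -p.1.2), p.2))
      ((atBot ×ˢ atBot) ×ˢ ⊤) ((atTop ×ˢ atTop) ×ˢ ⊤) :=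
    (tendsto_neg_atBot_atTop.prodMap tendsto_neg_atBot_atTop).prodMap tendsto_id
  simpa [Function.comp_def] using! H.comp h1

variable {l : Filter ℝ}

lemma uCauchy_of_deriv (hl : l = atTop ∨ l = atBot) {h h' : ℝ → S2 → ℝ} {ε : ℝ} (hε : 0 < ε)
    (hd : ∀ u x, HasDerivAt (fun s => h s x) (h' u x) u)
    (hO : (fun p : ℝ × S2 => h' p.1 p.2) =O[l ×ˢ ⊤] fun p => |p.1| ^ (-1 - ε)) :
    UCauchy l h := by
  rcases hl with rfl | rfl
  · exact uCauchy_atTop_of_deriv hε hd hO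
  · refine UCauchy.comp_neg (uCauchy_atTop_of_deriv hε (h' := fun u x => - h' (-u) x)
      (fun u x => ?_) ?_)
    · simpa using! (hd (-u) x).comp u (hasDerivAt_neg u)
    · have h1 : Tendsto (fun p : ℝ × S2 => (-p.1, p.2)) (atTop ×ˢ ⊤) (atBot ×ˢ ⊤) :=
        tendsto_neg_atTop_atBot.prodMap tendsto_id
      simpa [Function.comp_def] using (hO.comp_tendsto h1).neg_left

lemma tendsto_add_bounded (hl : l = atTop ∨ l = atBot) {f : S2 → ℝ} (hf : Continuous f) :
    Tendsto (fun p : ℝ × S2 => p.1 + f p.2) (l ×ˢ ⊤) l := by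
  obtain ⟨B, hB⟩ := (isCompact_univ (X := S2)).exists_bound_of_continuousOn hf.continuousOn
  have hB' : ∀ x, |f x| ≤ B := fun x => hB x (Set.mem_univ x)
  rcases hl with rfl | rfl
  · refine tendsto_atTop_mono (f := fun p : ℝ × S2 => p.1 + -B)
      (fun p => add_le_add_right (neg_le_of_abs_le (hB' p.2)) _) ?_
    exact tendsto_atTop_add_const_right _ _ tendsto_fst
  · refine tendsto_atBot_mono (g := fun p : ℝ × S2 => p.1 + f p.2)
      (f := fun p : ℝ × S2 => p.1 + B)
      (fun p => add_le_add_right (le_of_abs_le (hB' p.2)) _) ?_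
    exact tendsto_atBot_add_const_right _ _ tendsto_fst

section

variable {h : ℝ → S2 → ℝ} {f : S2 → ℝ} (hl : l = atTop ∨ l = atBot)

include hl

/-- f is bounded by compactness, so u and u + f(x) reach the end together, uniformly in x. This is
why a supertranslation does not change limits along the generators. -/
lemma UCauchy.shift (H : UCauchy l h) (hf : Continuous f) :
    UZero l (fun u x => h (u + f x) x - h u x) :=
  H.comp (((tendsto_add_bounded hl hf).prodMk tendsto_fst).prodMk tendsto_snd)

lemma UZero.shift (H : UZero l h) (hf : Continuous f) : UZero l (fun u x => h (u + f x) x) :=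
  H.comp ((tendsto_add_bounded hl hf).prodMk tendsto_snd)

lemma neBot_of_atTop_or_atBot : l.NeBot := by
  rcases hl with rfl | rfl <;> infer_instance

lemma UCauchy.isBigO_one (H : UCauchy l h) (hc : ∀ u, Continuous (h u)) :
    (fun p : ℝ × S2 => h p.1 p.2) =O[l ×ˢ ⊤] fun _ => (1 : ℝ) := by
  have := neBot_of_atTop_or_atBot hl
  -- Freeze one reference time v: for later u the function stays within 1 of `h v`, which is bounded
  -- on the compact sphere.
  have h1 := (tendsto_prod_top_zero.1 H 1 one_pos).curry
  obtain ⟨v, hv⟩ := (h1.mono fun u hu => hu).exists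
  obtain ⟨B, hB⟩ := (isCompact_univ (X := S2)).exists_bound_of_continuousOn (hc v).continuousOn
  refine Asymptotics.IsBigO.of_bound (B + 1) ?_
  rw [eventually_prod_top]
  filter_upwards [hv] with u hu x
  have h2 : |h v x| ≤ B := hB x (Set.mem_univ x)
  have h3 : |h v x - h u x| ≤ 1 := hu x
  rw [norm_one, mul_one, Real.norm_eq_abs]
  have := abs_sub_abs_le_abs_sub (h u x) (h v x)
  rw [abs_sub_comm] at this
  linarith

end

/-! ### From uniform limits to limits in L² and of integrals -/

lemma UZero.tendsto_ι {F : ℝ → smoothS2} (H : UZero l (fun u x => ev x (F u))) :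
    Tendsto (fun u => ι (F u)) l (𝓝 0) := by
  rw [tendsto_zero_iff_norm_tendsto_zero, Metric.tendsto_nhds]
  intro η hη
  have h0 : 0 ≤ √(I 1) := Real.sqrt_nonneg _
  filter_upwards [tendsto_prod_top_zero.1 H (η / (√(I 1) + 1)) (by positivity)] with u hu
  have h1 := norm_ι_le_of_forall_abs_le (φ := F u) (by positivity) hu
  rw [Real.dist_eq, sub_zero, abs_norm]
  refine h1.trans_lt ?_
  rw [mul_div_assoc', div_lt_iff₀ (by positivity)]
  nlinarith

lemma exists_tendsto_of_dist [l.NeBot] {F : ℝ → H}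
    (h : Tendsto (fun p : ℝ × ℝ => ‖F p.1 - F p.2‖) (l ×ˢ l) (𝓝 0)) :
    ∃ y, Tendsto F l (𝓝 y) := by
  rw [← cauchy_map_iff_exists_tendsto, cauchy_map_iff]
  refine ⟨inferInstance, tendsto_uniformity_iff_dist_tendsto_zero.2 ?_⟩
  simpa only [dist_eq_norm] using h

lemma tendsto_norm_sub {F : ℝ → H} {y : H} (h : Tendsto F l (𝓝 y)) :
    Tendsto (fun p : ℝ × ℝ => ‖F p.1 - F p.2‖) (l ×ˢ l) (𝓝 0) := by
  simpa using ((h.comp tendsto_fst).sub (h.comp tendsto_snd)).norm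

lemma UCauchy.exists_tendsto_ι [l.NeBot] {F : ℝ → smoothS2}
    (H : UCauchy l (fun u x => ev x (F u))) : ∃ y, Tendsto (fun u => ι (F u)) l (𝓝 y) := by
  refine exists_tendsto_of_dist ?_
  rw [Metric.tendsto_nhds]
  intro η hη
  have h0 : 0 ≤ √(I 1) := Real.sqrt_nonneg _
  filter_upwards [tendsto_prod_top_zero.1 H (η / (√(I 1) + 1)) (by positivity)] with p hp
  have h1 := norm_ι_le_of_forall_abs_le (φ := F p.1 - F p.2) (by positivity) hp
  rw [Real.dist_eq, sub_zero, abs_norm, ← map_sub]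
  refine h1.trans_lt ?_
  rw [mul_div_assoc', div_lt_iff₀ (by positivity)]
  nlinarith

lemma abs_sphereInt_le {φ : S2 → ℝ} {a : ℝ} (h : ∀ x, |φ x| ≤ a) :
    |sphereInt φ| ≤ a * σ.real Set.univ := by
  rw [sphereInt, ← Real.norm_eq_abs]
  exact norm_integral_le_of_norm_le_const (μ := σ) (Eventually.of_forall h)

lemma UZero.tendsto_sphereInt {h : ℝ → S2 → ℝ} (H : UZero l h) :
    Tendsto (fun u => sphereInt (h u)) l (𝓝 0) := by
  rw [Metric.tendsto_nhds]
  intro η hη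
  have h0 : 0 ≤ σ.real Set.univ := measureReal_nonneg
  filter_upwards [tendsto_prod_top_zero.1 H (η / (σ.real Set.univ + 1)) (by positivity)] with u hu
  rw [Real.dist_eq, sub_zero]
  refine (abs_sphereInt_le hu).trans_lt ?_
  rw [div_mul_eq_mul_div, div_lt_iff₀ (by positivity)]
  nlinarith

lemma UCauchy.exists_tendsto_sphereInt [l.NeBot] {h : ℝ → S2 → ℝ} (H : UCauchy l h)
    (hc : ∀ u, Continuous (h u)) : ∃ y, Tendsto (fun u => sphereInt (h u)) l (𝓝 y) := by
  rw [← cauchy_map_iff_exists_tendsto, cauchy_map_iff]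
  refine ⟨inferInstance, tendsto_uniformity_iff_dist_tendsto_zero.2 ?_⟩
  rw [Metric.tendsto_nhds]
  intro η hη
  have h0 : 0 ≤ σ.real Set.univ := measureReal_nonneg
  filter_upwards [tendsto_prod_top_zero.1 H (η / (σ.real Set.univ + 1)) (by positivity)] with p hp
  rw [Real.dist_eq, sub_zero, abs_of_nonneg dist_nonneg, Real.dist_eq, sphereInt, sphereInt,
    ← integral_sub (integrable_of_continuous (hc _)) (integrable_of_continuous (hc _))]
  refine (abs_sphereInt_le hp).trans_lt ?_
  rw [div_mul_eq_mul_div, div_lt_iff₀ (by positivity)]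
  nlinarith

/-! ### Decaying and bounded families -/

/-- The family `F` is `O(|u| ^ (-1 - ε))` along `l`, uniformly on the sphere. -/
def Dec (l : Filter ℝ) (ε : ℝ) (F : ℝ → smoothS2) : Prop :=
  (fun p : ℝ × S2 => ev p.2 (F p.1)) =O[l ×ˢ ⊤] fun p => |p.1| ^ (-1 - ε)

/-- The family `F` is bounded along `l`, uniformly on the sphere. -/
def Bd (l : Filter ℝ) (F : ℝ → smoothS2) : Prop :=
  (fun p : ℝ × S2 => ev p.2 (F p.1)) =O[l ×ˢ ⊤] fun _ => (1 : ℝ)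

section

variable {l : Filter ℝ} {ε : ℝ} {F G : ℝ → smoothS2}

lemma Dec.add (h : Dec l ε F) (h' : Dec l ε G) : Dec l ε (fun u => F u + G u) := by
  simpa only [Dec, map_add] using! Asymptotics.IsBigO.add h h'

lemma Dec.sub (h : Dec l ε F) (h' : Dec l ε G) : Dec l ε (fun u => F u - G u) := by
  simpa only [Dec, map_sub] using! Asymptotics.IsBigO.sub h h'

lemma Dec.sum {F : Fin 3 → ℝ → smoothS2} (h : ∀ i, Dec l ε (F i)) :
    Dec l ε (fun u => ∑ i, F i u) := by
  simpa only [Fin.sum_univ_three] using! ((h 0).add (h 1)).add (h 2)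

lemma Bd.mul_dec (h : Bd l F) (h' : Dec l ε G) : Dec l ε (fun u => F u * G u) := by
  simpa only [Dec, map_mul, one_mul] using! Asymptotics.IsBigO.mul h h'

lemma bd_const (a : smoothS2) : Bd l (fun _ => a) := by
  obtain ⟨B, hB⟩ := (isCompact_univ (X := S2)).exists_bound_of_continuousOn
    (SmoothOnS2.continuous a.2).continuousOn
  refine Asymptotics.IsBigO.of_bound B (Eventually.of_forall fun p => ?_)
  rw [norm_one, mul_one]
  exact hB p.2 (Set.mem_univ _)

lemma Dec.smul (h : Dec l ε F) (a : ℝ) : Dec l ε (fun u => a • F u) := by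
  simpa only [Algebra.smul_def] using (bd_const (algebraMap ℝ smoothS2 a)).mul_dec h

lemma tendsto_abs_atTop (hl : l = atTop ∨ l = atBot) : Tendsto (fun u : ℝ => |u|) l atTop := by
  rcases hl with rfl | rfl
  · exact tendsto_abs_atTop_atTop
  · exact tendsto_abs_atBot_atTop

variable (hl : l = atTop ∨ l = atBot) (hε : 0 < ε)

include hl hε

/-- The decay beats the explicit factor u in the flux: uN is bounded, so u|N|² still decays like N.
-/
lemma Dec.bd_id_mul (h : Dec l ε F) : Bd l (fun u => algebraMap ℝ smoothS2 u * F u) := by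
  have h1 : (fun p : ℝ × S2 => p.1 * ev p.2 (F p.1)) =O[l ×ˢ ⊤]
      fun p => p.1 * |p.1| ^ (-1 - ε) := (Asymptotics.isBigO_refl _ _).mul h
  have h2 : (fun p : ℝ × S2 => p.1 * |p.1| ^ (-1 - ε)) =O[l ×ˢ ⊤] fun _ => (1 : ℝ) := by
    refine Asymptotics.IsBigO.of_bound 1 ?_
    filter_upwards [((tendsto_abs_atTop hl).eventually_ge_atTop 1).prod_inl ⊤] with p hp
    have hp0 : 0 < |p.1| := by linarith
    rw [norm_mul, Real.norm_eq_abs, Real.norm_of_nonneg (Real.rpow_nonneg hp0.le _), norm_one,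
      mul_one]
    calc |p.1| * |p.1| ^ (-1 - ε) = |p.1| ^ (-ε) := by
          rw [← Real.rpow_one_add' hp0.le (by linarith)]; ring_nf
      _ ≤ 1 := Real.rpow_le_one_of_one_le_of_nonpos hp (by linarith)
  have h3 := h1.trans h2
  simpa [Bd] using h3

lemma Dec.uZero (h : Dec l ε F) : UZero l (fun u x => ev x (F u)) := by
  refine Asymptotics.IsBigO.trans_tendsto h ?_
  have h1 := (tendsto_rpow_neg_atTop (y := 1 + ε) (by linarith)).comp (tendsto_abs_atTop hl)
  have h2 := h1.comp (tendsto_fst (f := l) (g := (⊤ : Filter S2)))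
  simpa [Function.comp_def, sub_eq_add_neg, add_comm] using h2

lemma Dec.bd (h : Dec l ε F) : Bd l F := by
  refine Asymptotics.IsBigO.trans h (Asymptotics.IsBigO.of_bound 1 ?_)
  filter_upwards [((tendsto_abs_atTop hl).eventually_ge_atTop 1).prod_inl ⊤] with p hp
  rw [Real.norm_of_nonneg (Real.rpow_nonneg (abs_nonneg _) _), norm_one, mul_one]
  exact Real.rpow_le_one_of_one_le_of_nonpos hp (by linarith)

lemma TD.uCauchy (h : TD F G) (h' : Dec l ε G) : UCauchy l (fun u x => ev x (F u)) :=
  uCauchy_of_deriv hl hε h.hasDerivAt h'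

end

lemma UCauchy.bd {l : Filter ℝ} {F : ℝ → smoothS2} (hl : l = atTop ∨ l = atBot)
    (h : UCauchy l (fun u x => ev x (F u))) : Bd l F :=
  h.isBigO_one hl fun u => SmoothOnS2.continuous (F u).2

/-! ### Consequences of the decay of the news at one end -/

namespace ScriData

variable {S : ScriData}

lemma NewsDecay.exists_dec (h : S.NewsDecay) : ∃ ε > 0, ∀ l, l = atTop ∨ l = atBot →
    ∀ i j, Dec l ε (S.NA i j) ∧ ∀ a, Dec l ε (fun u => D a (S.NA i j u)) := by
  obtain ⟨ε, hε, K, R, -, hK⟩ := h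
  refine ⟨ε, hε, fun l hl i j => ?_⟩
  have hR := ((tendsto_abs_atTop hl).eventually_ge_atTop R).prod_inl (⊤ : Filter S2)
  refine ⟨Asymptotics.IsBigO.of_bound K ?_, fun a => Asymptotics.IsBigO.of_bound K ?_⟩ <;>
    filter_upwards [hR] with p hp <;>
    rw [Real.norm_of_nonneg (Real.rpow_nonneg (abs_nonneg _) _)]
  · exact (hK p.1 p.2 i j 0 0 hp).1
  · exact (hK p.1 p.2 i j a 0 hp).2.1

/-- The time integral of the density of the flux. -/
def fluxPrim (S : ScriData) (k : Fin 3) (u : ℝ) (x : S2) : ℝ :=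
  ∫ s in (0 : ℝ)..u, ev x (S.fluxA k s)

lemma continuous_fluxA (S : ScriData) (k : Fin 3) :
    Continuous (fun p : ℝ × S2 => ev p.2 (S.fluxA k p.1)) := (S.smooth_fluxA k).continuous

lemma hasDerivAt_fluxPrim (S : ScriData) (k : Fin 3) (u : ℝ) (x : S2) :
    HasDerivAt (fun s => S.fluxPrim k s x) (ev x (S.fluxA k u)) u := by
  have hc : Continuous (fun s => ev x (S.fluxA k s)) :=
    (S.continuous_fluxA k).comp (Continuous.prodMk_left x)
  exact intervalIntegral.integral_hasDerivAt_right (hc.intervalIntegrable _ _)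
    hc.stronglyMeasurable.stronglyMeasurableAtFilter hc.continuousAt

lemma continuous_fluxPrim (S : ScriData) (k : Fin 3) {f : S2 → ℝ} (hf : Continuous f) (u : ℝ) :
    Continuous (fun x => S.fluxPrim k (u + f x) x) :=
  intervalIntegral.continuous_parametric_intervalIntegral_of_continuous
    (f := fun x s => ev x (S.fluxA k s))
    ((S.continuous_fluxA k).comp continuous_swap) (by fun_prop)

section

variable {l : Filter ℝ} {ε : ℝ} (hl : l = atTop ∨ l = atBot) (hε : 0 < ε)
  (hN : ∀ i j, Dec l ε (S.NA i j) ∧ ∀ a, Dec l ε (fun u => D a (S.NA i j u)))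

include hN in
lemma dec_DvN (j : Fin 3) : Dec l ε (fun u => Dv (S.NT u) j) :=
  Dec.sum fun i => (hN i j).2 i

include hl hε hN

lemma uCauchy_CA (i j : Fin 3) : UCauchy l (fun u x => ev x (S.CA i j u)) :=
  (S.td_CA i j).uCauchy hl hε (hN i j).1

lemma uCauchy_DvC (j : Fin 3) : UCauchy l (fun u x => ev x (Dv (S.CT u) j)) :=
  (S.td_DvC j).uCauchy hl hε (dec_DvN hN j)

lemma dec_dotN : Dec l ε (fun u => dot (S.NT u) (S.NT u)) :=
  Dec.sum fun i => Dec.sum fun j => ((hN i j).1.bd hl hε).mul_dec (hN i j).1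

lemma IsVacuum.uCauchy_MA (h : S.IsVacuum) : UCauchy l (fun u x => ev x (S.MA u)) :=
  h.td_MA.uCauchy hl hε ((dec_dotN hl hε hN).smul _)

/-- Each term is a bounded factor times the news or its divergence; the shear and its divergence are
bounded because they are uniformly Cauchy. -/
lemma dec_fluxA (k : Fin 3) : Dec l ε (S.fluxA k) := by
  have h1 : Dec l ε (fun u => algebraMap ℝ smoothS2 u * dot (S.NT u) (S.NT u)) := by
    have : Dec l ε (fun u => ∑ i, ∑ j, (algebraMap ℝ smoothS2 u * S.NA i j u) * S.NA i j u) :=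
      Dec.sum fun i => Dec.sum fun j => ((hN i j).1.bd_id_mul hl hε).mul_dec (hN i j).1
    convert this using 2 with u
    simp only [dot, Finset.mul_sum, mul_assoc]
    rfl
  have h2 : Dec l ε (fun u => pair k (S.CT u) (S.NT u)) := by
    refine Dec.sum fun b => Dec.sub ?_ ?_
    · exact ((uCauchy_CA hl hε hN k b).bd hl).mul_dec (dec_DvN hN b)
    · simpa only [mul_comm] using! ((uCauchy_DvC hl hε hN b).bd hl).mul_dec (hN k b).1
  have h3 := ((bd_const (algebraMap ℝ smoothS2 (1 / 4) * X k)).mul_dec h1).add ((bd_const (algebraMap ℝ smoothS2 (1 / 4))).mul_dec h2)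
  convert h3 using 2 with u
  exact S.fluxA_eq k u

lemma uCauchy_fluxPrim (k : Fin 3) : UCauchy l (S.fluxPrim k) :=
  uCauchy_of_deriv hl hε (S.hasDerivAt_fluxPrim k) (dec_fluxA hl hε hN k)

end

/-- The center of mass of a supertranslate differs from the original one by a boundary term and the
integral of the change of a primitive of the flux. -/
lemma IsVacuum.exists_classicalCenterOfMass_eq {S' : ScriData} {f : smoothS2} (h : S.IsVacuum)
    (h' : S'.IsVacuum) (hst : IsSupertranslate f.1 S S') (k : Fin 3) :
    ∃ a b, ∀ u, S.classicalCenterOfMass k u = sphereInt (S.fluxPrim k u) + a ∧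
      S'.classicalCenterOfMass k u =
        sphereInt (fun x => S.fluxPrim k (u + f.1 x) x) + I (S.bdryA f k u) + b := by
  have hf := SmoothOnS2.continuous f.2
  have c0 : ∀ u, Continuous (S.fluxPrim k u) := fun u => by
    simpa using S.continuous_fluxPrim k (continuous_const (y := (0 : ℝ))) u
  -- Both differences have zero derivative, so a and b are their values at u = 0 and serve all times
  -- at once.
  have d1 : ∀ u, HasDerivAt (fun u => S.classicalCenterOfMass k u - sphereInt (S.fluxPrim k u))
      0 u := fun u => by
    have := (h.hasDerivAt_classicalCenterOfMass k u).fun_sub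
      (hasDerivAt_sphereInt c0 (S.continuous_fluxA k) (S.hasDerivAt_fluxPrim k) u)
    refine this.congr_deriv ?_
    rw [I_apply]
    exact sub_self _
  have d2 : ∀ u, HasDerivAt (fun u => S'.classicalCenterOfMass k u -
      sphereInt (fun x => S.fluxPrim k (u + f.1 x) x) - I (S.bdryA f k u)) 0 u := fun u => by
    have hc : Continuous (fun p : ℝ × S2 => ev p.2 (S.fluxA k (p.1 + f.1 p.2))) :=
      (S.continuous_fluxA k).comp
        ((continuous_fst.add (hf.comp continuous_snd)).prodMk continuous_snd)
    have := ((h'.hasDerivAt_classicalCenterOfMass k u).fun_sub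
      (hasDerivAt_sphereInt (φ := fun u x => S.fluxPrim k (u + f.1 x) x)
        (fun u => S.continuous_fluxPrim k hf u) hc
        (fun u x => (S.hasDerivAt_fluxPrim k _ x).comp_add_const u (f.1 x)) u)).fun_sub
      ((h.td_bdryA (f := f) k).hasDerivAt_I u)
    refine this.congr_deriv ?_
    rw [fluxA_supertranslate hst, map_add, add_sub_right_comm, add_sub_cancel_right, I_apply,
      coe_sh f (S.smooth_fluxA k)]
    exact sub_self _
  refine ⟨S.classicalCenterOfMass k 0 - sphereInt (S.fluxPrim k 0),
    S'.classicalCenterOfMass k 0 - sphereInt (fun x => S.fluxPrim k (0 + f.1 x) x) -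
      I (S.bdryA f k 0), fun u => ⟨?_, ?_⟩⟩
  · have := is_const_of_deriv_eq_zero (fun u => (d1 u).differentiableAt) (fun u => (d1 u).deriv) u 0
    linarith
  · have := is_const_of_deriv_eq_zero (fun u => (d2 u).differentiableAt) (fun u => (d2 u).deriv) u 0
    linarith

end ScriData

/-! ### Potentials and the correction term in the center of mass -/

lemma Lap_X (i : Fin 3) : Lap (X i) = -(2 * X i) := by
  have := Lap_X_mul i 1
  simpa [Lap] using this

lemma perp_of_supportedInModesGE {c : smoothS2} (h : SupportedInModesGE 2 c.1) : Perp c := by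
  have h0 : ∀ a : ℝ, Lap (algebraMap ℝ smoothS2 a) = 0 := fun a => by simp [Lap]
  constructor
  · have := h 0 (by norm_num) (1 : smoothS2).1 ⟨(1 : smoothS2).2, fun x => by
      rw [lap_coe, ← map_one (algebraMap ℝ smoothS2), h0]; simp⟩
    rw [← mul_one c]
    exact this
  · intro i
    have := h 1 (by norm_num) (X i).1 ⟨(X i).2, fun x => by
      rw [lap_coe, Lap_X, map_neg, map_mul, map_ofNat, ev_apply]; norm_num⟩
    rw [mul_comm]
    exact this

lemma IsPotentials.isPot {T : Fin 3 → Fin 3 → smoothS2} {c cc : smoothS2}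
    (h : IsPotentials (fun i j => (T i j).1) c.1 cc.1) : IsPot T c cc where
  perp := perp_of_supportedInModesGE h.modes_closed
  perp' := perp_of_supportedInModesGE h.modes_coclosed
  eq i j := ev_ext fun x => by
    rw [map_add, ← closedPart_coe, ← coclosedPart_coe]
    exact h.decomposition i j x

/-- The difference between the Chen-Wang-Yau and the classical center of mass, in terms of the mass
aspect without its exact part. -/
def corr (M : smoothS2) (T : Fin 3 → Fin 3 → smoothS2) (c cc : smoothS2) (k : Fin 3) : ℝ :=
  I (M * ell k c cc) - 1 / 4 * ∑ j, I (Dv T j * D j (ell k c cc))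
    - 1 / 4 * ∑ j, I (Dv (Co cc) j * (X k * Dv (Co cc) j))

/-- Integrating D_k(c m) by parts turns -c D_k m + 3 X_k c m into m(D_k c + X_k c), and with the ε
term this is m · ell. In m = M + ¼∇∇C one divergence is then moved onto `ell`, so that only
quantities with L² limits remain. -/
lemma ScriData.cwyCenterOfMass_eq (S : ScriData) (c cc : ℝ → smoothS2) (k : Fin 3) (u : ℝ) :
    S.cwyCenterOfMass (fun u => (c u).1) (fun u => (cc u).1) k u =
      S.classicalCenterOfMass k u + corr (S.MA u) (S.CT u) (c u) (cc u) k := by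
  set V : Fin 3 → smoothS2 := fun a =>
    - c u * D a (S.mA u) + 2 * (∑ b, eps a b * D b (cc u)) * S.mA u with hV
  have hV0 : X 0 * V 0 + X 1 * V 1 + X 2 * V 2 = 0 := by
    have e1 := sum_X_D' (S.mA u)
    have e2 := sum_X_eps
    simp only [hV, Fin.sum_univ_three]
    linear_combination (- c u) * e1 + 2 * S.mA u * (D 0 (cc u) * e2 0 + D 1 (cc u) * e2 1
      + D 2 (cc u) * e2 2)
  have h1 : sphereInt (fun x => ∑ a, grad (coord k) a x *
      (-((c u).1 x) * grad (S.m u) a x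
        + 2 * (∑ b, volForm a b x * grad (cc u).1 b x) * S.m u x)) = I (V k) := by
    rw [I_apply]
    congr 1
    funext x
    refine Eq.trans (Finset.sum_congr rfl fun a _ => ?_) (sum_grad_coord V hV0 k x)
    simp only [hV, map_add, map_mul, map_neg, map_sum, map_ofNat, ev_eps]
    rfl
  have h2 : sphereInt (fun x => 3 * coord k x * (c u).1 x * S.m u x
      - 1 / 4 * coord k x *
        ∑ b, div2 (coclosedPart (cc u).1) b x * div2 (coclosedPart (cc u).1) b x) =
      I (3 * (X k * c u * S.mA u)
        - (1 / 4 : ℝ) • ∑ b, Dv (Co (cc u)) b * (X k * Dv (Co (cc u)) b)) := by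
    have e1 : ∀ b x, div2 (coclosedPart (cc u).1) b x = ev x (Dv (Co (cc u)) b) := fun b x => by
      have : coclosedPart (cc u).1 = fun i j => (Co (cc u) i j).1 :=
        funext fun i => funext fun j => funext fun x => coclosedPart_coe (cc u) i j x
      rw [this, (stf_Co (cc u)).div2_coe]
    rw [I_apply]
    congr 1
    funext x
    refine Eq.trans ?_ (ev_apply x _)
    simp only [e1, map_sub, map_mul, map_smul, map_sum, map_ofNat, ev_X, smul_eq_mul,
      Finset.mul_sum]
    congr 1
    · change 3 * coord k x * ev x (c u) * ev x (S.mA u) = _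
      ring
    · refine Finset.sum_congr rfl fun b _ => ?_
      ring
  have h3 : I (D k (c u * S.mA u)) = 2 * I (X k * (c u * S.mA u)) := I_D k _
  have h4 : I (ell k (c u) (cc u) * DDv (S.CT u)) = _ := I_DDv_mul (S.stf_CT u) _
  have h5 : S.mA u = S.MA u + (1 / 4 : ℝ) • DDv (S.CT u) := by rw [ScriData.MA, sub_add_cancel]
  have h6 : I (V k) + I (3 * (X k * c u * S.mA u)) = I (S.mA u * ell k (c u) (cc u)) := by
    have e : V k + 3 * (X k * c u * S.mA u) = S.mA u * ell k (c u) (cc u)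
        - D k (c u * S.mA u) + (2 : ℝ) • (X k * (c u * S.mA u)) := by
      rw [Derivation.leibniz, smul_eq_mul, smul_eq_mul, two_smul, hV, ell]
      ring
    rw [← map_add, e, map_add, map_sub, map_smul, h3, smul_eq_mul]
    ring
  have h7 : I (S.mA u * ell k (c u) (cc u)) = I (S.MA u * ell k (c u) (cc u))
      - 1 / 4 * ∑ j, I (Dv (S.CT u) j * D j (ell k (c u) (cc u))) := by
    rw [h5, add_mul, map_add, smul_mul_assoc, map_smul, mul_comm (DDv _), h4, map_sum, smul_eq_mul]
    ring
  rw [ScriData.cwyCenterOfMass]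
  refine (congrArg₂ (· + ·) (congrArg₂ (· + ·) rfl h1) h2).trans ?_
  rw [corr, map_sub, map_smul, map_sum, smul_eq_mul]
  linarith

/-! ### Limits in `L²` -/

section

variable {l : Filter ℝ} {F G : ℝ → smoothS2}

lemma tendsto_I_mul {y z : H} (hF : Tendsto (fun u => ι (F u)) l (𝓝 y))
    (hG : Tendsto (fun u => ι (G u)) l (𝓝 z)) :
    Tendsto (fun u => I (F u * G u)) l (𝓝 (inner ℝ y z)) := by
  simpa only [inner_ι] using hF.inner (𝕜 := ℝ) hG

lemma tendsto_ι_mul_zero (a : smoothS2) (hF : Tendsto (fun u => ι (F u)) l (𝓝 0)) :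
    Tendsto (fun u => ι (a * F u)) l (𝓝 0) := by
  obtain ⟨K, -, hK⟩ := exists_norm_ι_mul_le a
  refine squeeze_zero_norm (fun u => hK (F u)) ?_
  simpa using hF.norm.const_mul K

lemma exists_tendsto_of_norm_sub_le [l.NeBot] {b : ℝ × ℝ → ℝ} (hb : Tendsto b (l ×ˢ l) (𝓝 0))
    (h : ∀ u v, ‖ι (F u - F v)‖ ≤ b (u, v)) : ∃ y, Tendsto (fun u => ι (F u)) l (𝓝 y) := by
  refine exists_tendsto_of_dist (squeeze_zero (fun _ => norm_nonneg _) (fun p => ?_) hb)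
  rw [← map_sub]
  exact h p.1 p.2

lemma exists_tendsto_ι_mul [l.NeBot] (a : smoothS2) {y : H}
    (hF : Tendsto (fun u => ι (F u)) l (𝓝 y)) :
    ∃ z, Tendsto (fun u => ι (a * F u)) l (𝓝 z) := by
  obtain ⟨K, -, hK⟩ := exists_norm_ι_mul_le a
  refine exists_tendsto_of_norm_sub_le (b := fun p => K * ‖ι (F p.1) - ι (F p.2)‖) ?_ fun u v => ?_
  · simpa using (tendsto_norm_sub hF).const_mul K
  · rw [← mul_sub, ← map_sub]
    exact hK _

lemma tendsto_ι_of_sub {y : H} {b : ℝ → ℝ} (hF : Tendsto (fun u => ι (F u)) l (𝓝 y)) (a : smoothS2)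
    (hb : Tendsto b l (𝓝 0)) (h : ∀ u, ‖ι (G u - F u - a)‖ ≤ b u) :
    Tendsto (fun u => ι (G u)) l (𝓝 (y + ι a)) := by
  have h1 := (hF.add_const (ι a)).add (squeeze_zero_norm h hb)
  simpa using h1

lemma tendsto_ι_sh (hl : l = atTop ∨ l = atBot) (f : smoothS2) {y : H}
    (hF : Tendsto (fun u => ι (F u)) l (𝓝 y)) (hs : SmoothOnScri (fun u => (F u).1))
    (hc : UCauchy l (fun u x => ev x (F u))) : Tendsto (fun u => ι (sh f F u)) l (𝓝 y) := by
  have h1 : Tendsto (fun u => ι (sh f F u - F u)) l (𝓝 0) := by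
    refine UZero.tendsto_ι ?_
    have := hc.shift hl (SmoothOnS2.continuous f.2)
    simp only [map_sub, ev_sh f hs]
    exact this
  simpa using hF.add h1

lemma tendsto_size {T : ℝ → Fin 3 → Fin 3 → smoothS2}
    (h : ∀ i j, Tendsto (fun u => ι (T u i j)) l (𝓝 0)) : Tendsto (fun u => size (T u)) l (𝓝 0) := by
  have := tendsto_finsetSum Finset.univ fun i _ =>
    tendsto_finsetSum Finset.univ fun j _ => (h i j).norm
  simpa [size] using this

/-- The limit of the correction term in terms of limits of its constituents. -/
def corrLim (m L : H) (d e w z : Fin 3 → H) : ℝ :=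
  inner ℝ m L - 1 / 4 * ∑ j, inner ℝ (d j) (e j) - 1 / 4 * ∑ j, inner ℝ (w j) (z j)

lemma tendsto_corr {M c cc : ℝ → smoothS2} {T : ℝ → Fin 3 → Fin 3 → smoothS2} {k : Fin 3}
    {m L : H} {d e w z : Fin 3 → H} (hm : Tendsto (fun u => ι (M u)) l (𝓝 m))
    (hL : Tendsto (fun u => ι (ell k (c u) (cc u))) l (𝓝 L))
    (hd : ∀ j, Tendsto (fun u => ι (Dv (T u) j)) l (𝓝 (d j)))
    (he : ∀ j, Tendsto (fun u => ι (D j (ell k (c u) (cc u)))) l (𝓝 (e j)))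
    (hw : ∀ j, Tendsto (fun u => ι (Dv (Co (cc u)) j)) l (𝓝 (w j)))
    (hz : ∀ j, Tendsto (fun u => ι (X k * Dv (Co (cc u)) j)) l (𝓝 (z j))) :
    Tendsto (fun u => corr (M u) (T u) (c u) (cc u) k) l (𝓝 (corrLim m L d e w z)) :=
  ((tendsto_I_mul hm hL).sub ((tendsto_finsetSum _ fun j _ =>
    tendsto_I_mul (hd j) (he j)).const_mul _)).sub ((tendsto_finsetSum _ fun j _ =>
    tendsto_I_mul (hw j) (hz j)).const_mul _)

end

lemma Dv_Co_sub (φ ψ : smoothS2) (j : Fin 3) :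
    Dv (Co (φ - ψ)) j = Dv (Co φ) j - Dv (Co ψ) j := by
  have h : ∀ i, Co (φ - ψ) i j = Co φ i j - Co ψ i j := fun i => by
    have := Co_add φ ((-1 : ℝ) • ψ) i j
    rw [Co_smul] at this
    simpa [sub_eq_add_neg] using this
  simp only [Dv, h, map_sub, Finset.sum_sub_distrib]

lemma Cl_algebraMap (a : ℝ) (i j : Fin 3) : Cl (algebraMap ℝ smoothS2 a) i j = 0 := by
  simp [Cl, Lap]

lemma Cl_X (a i j : Fin 3) : Cl (X a) i j = 0 := by
  rw [Cl, Lap_X, D_X, D_X, D_P]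
  linear_combination X a * P i j * two_mul_half

/-- The limits, along one end of null infinity, of the potentials and of the quantities entering the
correction term. -/
lemma exists_tendsto_of_isPot {l : Filter ℝ} [l.NeBot] {T : ℝ → Fin 3 → Fin 3 → smoothS2}
    {c cc : ℝ → smoothS2} (hp : ∀ u, IsPot (T u) (c u) (cc u)) (k : Fin 3)
    {y : Fin 3 → Fin 3 → H} {d : Fin 3 → H}
    (hT : ∀ i j, Tendsto (fun u => ι (T u i j)) l (𝓝 (y i j)))
    (hd : ∀ j, Tendsto (fun u => ι (Dv (T u) j)) l (𝓝 (d j))) :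
    ∃ (L : H) (e w : Fin 3 → H), Tendsto (fun u => ι (ell k (c u) (cc u))) l (𝓝 L) ∧
      (∀ j, Tendsto (fun u => ι (D j (ell k (c u) (cc u)))) l (𝓝 (e j))) ∧
      (∀ j, Tendsto (fun u => ι (Dv (Co (cc u)) j)) l (𝓝 (w j))) := by
  obtain ⟨K, hK, hell⟩ := exists_norm_ell_le k
  have hs : Tendsto (fun p : ℝ × ℝ => K * size (fun i j => T p.1 i j - T p.2 i j))
      (l ×ˢ l) (𝓝 0) := by
    have := (tendsto_finsetSum Finset.univ fun i _ =>
      tendsto_finsetSum Finset.univ fun j _ => tendsto_norm_sub (hT i j)).const_mul K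
    simpa [size] using this
  have hw : Tendsto (fun p : ℝ × ℝ => ∑ j, ‖ι (Dv (T p.1) j) - ι (Dv (T p.2) j)‖)
      (l ×ˢ l) (𝓝 0) := by
    have := tendsto_finsetSum Finset.univ fun j _ => tendsto_norm_sub (hd j)
    simpa using this
  obtain ⟨L, hL⟩ := exists_tendsto_of_norm_sub_le (F := fun u => ell k (c u) (cc u)) hs
    fun u v => by
      rw [← ell_sub]
      exact (hell _ _ _ ((hp u).sub (hp v))).1
  choose e he using fun j => exists_tendsto_of_norm_sub_le
    (F := fun u => D j (ell k (c u) (cc u))) hs fun u v => by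
      rw [← map_sub, ← ell_sub]
      exact (hell _ _ _ ((hp u).sub (hp v))).2 j
  choose w hw using fun j => exists_tendsto_of_norm_sub_le
    (F := fun u => Dv (Co (cc u)) j) hw fun u v => by
      rw [← Dv_Co_sub]
      refine (((hp u).sub (hp v)).norm_Dv_Co_le j).trans (le_of_eq ?_)
      refine Finset.sum_congr rfl fun j _ => ?_
      simp only [Dv, map_sub, Finset.sum_sub_distrib, map_sum]
  exact ⟨L, e, w, hL, he, hw⟩

/-- The effect on the limits of a change of the tensor which tends to `-2 Cl g`. -/
lemma tendsto_of_isPot_sub {l : Filter ℝ} {T T' : ℝ → Fin 3 → Fin 3 → smoothS2}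
    {c cc c' cc' : ℝ → smoothS2} (hp : ∀ u, IsPot (T u) (c u) (cc u))
    (hp' : ∀ u, IsPot (T' u) (c' u) (cc' u)) (k : Fin 3) {g : smoothS2} (hg : Perp g)
    (hT : ∀ i j, Tendsto (fun u => ι (T' u i j - T u i j + (2 : ℝ) • Cl g i j)) l (𝓝 0))
    (hDv : ∀ j, Tendsto (fun u => ι (Dv (T' u) j - Dv (T u) j + (2 : ℝ) • Dv (Cl g) j)) l (𝓝 0))
    {L : H} {e w : Fin 3 → H} (hL : Tendsto (fun u => ι (ell k (c u) (cc u))) l (𝓝 L))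
    (he : ∀ j, Tendsto (fun u => ι (D j (ell k (c u) (cc u)))) l (𝓝 (e j)))
    (hw : ∀ j, Tendsto (fun u => ι (Dv (Co (cc u)) j)) l (𝓝 (w j))) :
    Tendsto (fun u => ι (ell k (c' u) (cc' u))) l (𝓝 (L + ι ((-2 : ℝ) • ell k g 0))) ∧
      (∀ j, Tendsto (fun u => ι (D j (ell k (c' u) (cc' u)))) l
        (𝓝 (e j + ι ((-2 : ℝ) • D j (ell k g 0))))) ∧
      (∀ j, Tendsto (fun u => ι (Dv (Co (cc' u)) j)) l (𝓝 (w j))) := by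
  obtain ⟨K, hK, hell⟩ := exists_norm_ell_le k
  -- T' - T + 2 Cl g tends to zero and has the potentials c' - c + 2g and cc' - cc; the elliptic
  -- estimates apply to these directly.
  have hpot := fun u => ((hp' u).sub (hp u)).add ((isPot_Cl hg).smul 2)
  have hs : Tendsto (fun u => K * size (fun i j => T' u i j - T u i j + (2 : ℝ) • Cl g i j))
      l (𝓝 0) := by
    simpa using (tendsto_size hT).const_mul K
  have hD : Tendsto (fun u => ∑ j, ‖ι (Dv (T' u) j - Dv (T u) j + (2 : ℝ) • Dv (Cl g) j)‖)
      l (𝓝 0) := by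
    simpa using tendsto_finsetSum Finset.univ fun j _ => (hDv j).norm
  have e1 : ∀ u, ell k (c' u) (cc' u) - ell k (c u) (cc u) - (-2 : ℝ) • ell k g 0 =
      ell k (c' u - c u + (2 : ℝ) • g) (cc' u - cc u + (2 : ℝ) • 0) := fun u => by
    rw [ell_add, ell_smul, ell_sub, neg_smul, sub_neg_eq_add]
  refine ⟨tendsto_ι_of_sub hL _ hs fun u => ?_, fun j => tendsto_ι_of_sub (he j) _ hs fun u => ?_,
    fun j => ?_⟩
  · rw [e1]
    exact (hell _ _ _ (hpot u)).1
  · rw [← Derivation.map_smul, ← map_sub, ← map_sub, e1]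
    exact (hell _ _ _ (hpot u)).2 j
  · have := tendsto_ι_of_sub (G := fun u => Dv (Co (cc' u)) j) (hw j) 0 hD fun u => by
      have h1 := (hpot u).norm_Dv_Co_le j
      rw [smul_zero, add_zero, Dv_Co_sub] at h1
      rw [sub_zero]
      refine h1.trans (le_of_eq (Finset.sum_congr rfl fun j _ => ?_))
      simp only [Dv, map_sub, map_add, Derivation.map_smul, Finset.sum_sub_distrib,
        Finset.sum_add_distrib, ← Finset.smul_sum]
    simpa using this

/-! ### The centers of mass of a supertranslate at the ends of null infinity -/

/-- Constants and the X_i span directions in the kernel of the trace-free Hessian: ordinary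
translations do not change the shear. -/
lemma Cl_eq_of_modes {f g : smoothS2} {α₀ : ℝ} {α : Fin 3 → ℝ}
    (hfg : f = algebraMap ℝ smoothS2 α₀ + ∑ i, α i • X i + g) : Cl f = Cl g := by
  funext i j
  rw [hfg]
  simp only [Fin.sum_univ_three, Cl_add, Cl_smul, Cl_X, Cl_algebraMap, smul_zero, add_zero,
    zero_add]

/-- X_i X_k + D_k X_i = δ_ik. The coefficients α₀ and α_k in the theorem originate here. -/
lemma mul_X_add_D_of_modes {f g : smoothS2} {α₀ : ℝ} {α : Fin 3 → ℝ}
    (hfg : f = algebraMap ℝ smoothS2 α₀ + ∑ i, α i • X i + g) (k : Fin 3) :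
    f * X k + D k f = ell k g 0 + α₀ • X k + α k • (1 : smoothS2) := by
  have h1 : ∑ i, α i • D k (X i) = α k • (1 : smoothS2) - ∑ i, α i • (X k * X i) := by
    simp only [D_X, P, smul_sub, Finset.sum_sub_distrib]
    simp
  rw [hfg, ell]
  simp only [map_add, map_sum, Derivation.map_smul, h1, Derivation.map_algebraMap, map_zero,
    mul_zero, Finset.sum_const_zero, add_mul, Finset.sum_mul, smul_mul_assoc,
    ← Algebra.smul_def, mul_comm (X k)]
  abel

namespace ScriData

variable {S S' : ScriData} {l : Filter ℝ} {ε : ℝ}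

/-- m and M differ by a double divergence, which is orthogonal to 1; the product with 1 puts the
energy in the form of an L² pairing. -/
lemma energy_eq (S : ScriData) (u : ℝ) : S.energy u = 2 * I (S.MA u * 1) := by
  have h : I (S.MA u) = I (S.mA u) := by
    rw [MA, map_sub, map_smul, I_DDv (S.stf_CT u), smul_zero, sub_zero]
  rw [mul_one, h, energy, I_apply]
  exact integral_const_mul _ _

lemma momentum_eq (S : ScriData) (k : Fin 3) (u : ℝ) :
    S.momentum k u = 2 * I (S.MA u * X k) := by
  have h : I (S.MA u * X k) = I (S.mA u * X k) := by
    rw [MA, sub_mul, map_sub, smul_mul_assoc, map_smul, mul_comm (DDv _),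
      I_X_mul_DDv (S.stf_CT u), smul_zero, sub_zero]
  rw [h, momentum, I_apply, sphereInt, sphereInt, ← integral_const_mul]
  congr 1
  funext x
  exact mul_assoc _ _ _

section

variable (hl : l = atTop ∨ l = atBot) (hε : 0 < ε)
  (hN : ∀ i j, Dec l ε (S.NA i j) ∧ ∀ a, Dec l ε (fun u => D a (S.NA i j u)))

include hl hε hN

lemma tendsto_shN (f : smoothS2) (i j : Fin 3) :
    Tendsto (fun u => ι (S.shN f u i j)) l (𝓝 0) := by
  refine UZero.tendsto_ι ?_
  have := ((hN i j).1.uZero hl hε).shift hl (SmoothOnS2.continuous f.2)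
  simp only [shN, ev_sh f (S.td_NA i j).smooth]
  exact this

lemma tendsto_shC (f : smoothS2) (i j : Fin 3) {y : H}
    (h : Tendsto (fun u => ι (S.CA i j u)) l (𝓝 y)) :
    Tendsto (fun u => ι (S.shC f u i j)) l (𝓝 y) :=
  tendsto_ι_sh hl f h (S.td_CA i j).smooth (uCauchy_CA hl hε hN i j)

lemma tendsto_Dv_shC (f : smoothS2) (j : Fin 3) {d : H}
    (h : Tendsto (fun u => ι (Dv (S.CT u) j)) l (𝓝 d)) :
    Tendsto (fun u => ι (Dv (S.shC f u) j)) l (𝓝 d) := by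
  have h1 := tendsto_ι_sh hl f h (S.td_DvC j).smooth (uCauchy_DvC hl hε hN j)
  have h2 := tendsto_finsetSum Finset.univ fun i _ =>
    tendsto_ι_mul_zero (D i f) (tendsto_shN hl hε hN f i j)
  simpa [Dv_shC, mul_comm] using h1.add h2

/-- The C N ∇f term dies with the news, and `I_pair_Cl` followed by one integration by parts puts
the pairing term in the same form as the correction term. -/
lemma tendsto_bdryA {f g : smoothS2} (hfg : Cl f = Cl g) (k : Fin 3) {m : H} {d : Fin 3 → H}
    (hm : Tendsto (fun u => ι (sh f S.MA u)) l (𝓝 m))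
    (hd : ∀ j, Tendsto (fun u => ι (Dv (S.CT u) j)) l (𝓝 (d j))) :
    Tendsto (fun u => I (S.bdryA f k u)) l (𝓝 (2 * inner ℝ (ι (f * X k + D k f)) m
      - 1 / 2 * ∑ j, inner ℝ (d j) (ι (D j (ell k g 0))))) := by
  have := neBot_of_atTop_or_atBot hl
  have h1 := (tendsto_I_mul (F := fun _ => f * X k + D k f) tendsto_const_nhds hm).const_mul 2
  have h2 : Tendsto (fun u => ∑ b, ∑ d, I (S.shC f u k b * S.shN f u d b * D d f)) l (𝓝 0) := by
    have : ∀ b d, Tendsto (fun u => I (S.shC f u k b * S.shN f u d b * D d f)) l (𝓝 0) :=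
      fun b d => by
        obtain ⟨y, hy⟩ := (uCauchy_CA hl hε hN k b).exists_tendsto_ι
        have := tendsto_I_mul (tendsto_shC hl hε hN f k b hy)
          (tendsto_ι_mul_zero (D d f) (tendsto_shN hl hε hN f d b))
        simpa [mul_comm, mul_assoc, mul_left_comm] using this
    simpa using tendsto_finsetSum Finset.univ fun b _ =>
      tendsto_finsetSum Finset.univ fun d _ => this b d
  have h3 : Tendsto (fun u => I (pair k (Cl f) (S.shC f u))) l
      (𝓝 (∑ j, inner ℝ (d j) (ι (D j (ell k g 0))))) := by
    have e : ∀ u, I (pair k (Cl f) (S.shC f u)) = ∑ j, I (Dv (S.shC f u) j * D j (ell k g 0)) :=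
      fun u => by
        rw [hfg, I_pair_Cl (S.stf_shC f u), I_DDv_mul (S.stf_shC f u), neg_neg, map_sum]
    simp only [e]
    exact tendsto_finsetSum _ fun j _ => tendsto_I_mul (tendsto_Dv_shC hl hε hN f j (hd j))
      tendsto_const_nhds
  have h4 := (h1.add (h2.const_mul (1 / 4))).sub (h3.const_mul (1 / 2))
  simpa [bdryA] using h4

/-- The heart of the cancellation. In the limit M gains ½∇∇Cl g, ∇·C loses 2∇·Cl g, and `ell` loses
2 ell(g). The terms quadratic in g and those coupling g to the limit of `ell` cancel by parts; the
terms linear in M and in ∇·C cancel against those of the boundary term, leaving only the ℓ ≤ 1 part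
of f. -/
theorem IsVacuum.exists_limits (h : S.IsVacuum) {f g : smoothS2}
    (hst : IsSupertranslate f.1 S S') {c cc c' cc' : ℝ → smoothS2}
    (hp : ∀ u, IsPot (S.CT u) (c u) (cc u)) (hp' : ∀ u, IsPot (S'.CT u) (c' u) (cc' u))
    (hg : Perp g) {α₀ : ℝ} {α : Fin 3 → ℝ}
    (hfg : f = algebraMap ℝ smoothS2 α₀ + ∑ i, α i • X i + g) (k : Fin 3) :
    ∃ E P R R' B, Tendsto S.energy l (𝓝 E) ∧ Tendsto (S.momentum k) l (𝓝 P) ∧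
      Tendsto (fun u => corr (S.MA u) (S.CT u) (c u) (cc u) k) l (𝓝 R) ∧
      Tendsto (fun u => corr (S'.MA u) (S'.CT u) (c' u) (cc' u) k) l (𝓝 R') ∧
      Tendsto (fun u => I (S.bdryA f k u)) l (𝓝 B) ∧ R' - R + B = α₀ * P + α k * E := by
  have := neBot_of_atTop_or_atBot hl
  have hCl := Cl_eq_of_modes hfg
  obtain ⟨m, hm⟩ := (h.uCauchy_MA hl hε hN).exists_tendsto_ι
  have hm' := tendsto_ι_sh hl f hm h.td_MA.smooth (h.uCauchy_MA hl hε hN)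
  choose y hy using fun i j => (uCauchy_CA hl hε hN i j).exists_tendsto_ι
  choose d hd using fun j => (uCauchy_DvC hl hε hN j).exists_tendsto_ι
  obtain ⟨L, e, w, hL, he, hw⟩ := exists_tendsto_of_isPot hp k hy hd
  choose z hz using fun j => exists_tendsto_ι_mul (X k) (hw j)
  have hT : ∀ i j, Tendsto (fun u => ι (S'.CT u i j - S.CT u i j + (2 : ℝ) • Cl g i j)) l
      (𝓝 0) := fun i j => by
    have := (tendsto_shC hl hε hN f i j (hy i j)).sub (hy i j)
    simp only [sub_self, ← map_sub] at this
    refine this.congr fun u => congrArg ι ?_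
    rw [hst.CT_eq, hCl]
    change _ = S.shC f u i j - (2 : ℝ) • Cl g i j - S.CA i j u + (2 : ℝ) • Cl g i j
    generalize (2 : ℝ) • Cl g i j = t
    abel
  have eDv : ∀ u j, Dv (S'.CT u) j = Dv (S.shC f u) j - (2 : ℝ) • Dv (Cl g) j := fun u j => by
    rw [hst.CT_eq, hCl]
    simp only [Dv, map_sub, Derivation.map_smul, Finset.sum_sub_distrib, ← Finset.smul_sum]
  have hDv : ∀ j, Tendsto (fun u => ι (Dv (S'.CT u) j - Dv (S.CT u) j + (2 : ℝ) • Dv (Cl g) j)) l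
      (𝓝 0) := fun j => by
    have := (tendsto_Dv_shC hl hε hN f j (hd j)).sub (hd j)
    simp only [sub_self, ← map_sub] at this
    refine this.congr fun u => congrArg ι ?_
    rw [eDv]
    generalize (2 : ℝ) • Dv (Cl g) j = t
    abel
  obtain ⟨hL', he', hw'⟩ := tendsto_of_isPot_sub hp hp' k hg hT hDv hL he hw
  have hz' : ∀ j, Tendsto (fun u => ι (X k * Dv (Co (cc' u)) j)) l (𝓝 (z j)) := fun j => by
    have := tendsto_ι_mul_zero (X k) (F := fun u => Dv (Co (cc' u)) j - Dv (Co (cc u)) j)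
      (by simpa using (hw' j).sub (hw j))
    simpa [mul_sub] using (hz j).add this
  have hM' : Tendsto (fun u => ι (S'.MA u)) l (𝓝 (m + ι ((1 / 2 : ℝ) • DDv (Cl g)))) := by
    simp only [hst.MA_eq, hCl, map_add]
    exact hm'.add_const _
  have hd' : ∀ j, Tendsto (fun u => ι (Dv (S'.CT u) j)) l
      (𝓝 (d j - ι ((2 : ℝ) • Dv (Cl g) j))) := fun j => by
    simp only [eDv, map_sub]
    exact (tendsto_Dv_shC hl hε hN f j (hd j)).sub_const _
  have hR := tendsto_corr hm hL hd he hw hz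
  have hR' := tendsto_corr hM' hL' hd' he' hw' hz'
  have hB := tendsto_bdryA hl hε hN hCl k hm' hd
  have hE : Tendsto S.energy l (𝓝 (2 * inner ℝ m (ι 1))) := by
    have := (tendsto_I_mul hm (G := fun _ => 1) tendsto_const_nhds).const_mul 2
    exact this.congr fun u => (S.energy_eq u).symm
  have hP : Tendsto (S.momentum k) l (𝓝 (2 * inner ℝ m (ι (X k)))) := by
    have := (tendsto_I_mul hm (G := fun _ => X k) tendsto_const_nhds).const_mul 2
    exact this.congr fun u => (S.momentum_eq k u).symm
  refine ⟨_, _, _, _, _, hE, hP, hR, hR', hB, ?_⟩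
  -- L and e are only L² limits, so integration by parts between them is obtained by passing to the
  -- limit in the smooth identity.
  have r1 : inner ℝ L (ι (DDv (Cl g))) = - ∑ j, inner ℝ (ι (Dv (Cl g) j)) (e j) := by
    refine tendsto_nhds_unique (tendsto_I_mul hL (G := fun _ => DDv (Cl g)) tendsto_const_nhds) ?_
    simp only [I_DDv_mul (stf_Cl g), map_sum]
    exact (tendsto_finsetSum _ fun j _ => tendsto_I_mul (F := fun _ => Dv (Cl g) j)
      tendsto_const_nhds (he j)).neg
  have r2 : inner ℝ (ι (DDv (Cl g))) (ι (ell k g 0)) =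
      - ∑ j, inner ℝ (ι (Dv (Cl g) j)) (ι (D j (ell k g 0))) := by
    simp only [inner_ι]
    rw [mul_comm, I_DDv_mul (stf_Cl g), map_sum]
  rw [real_inner_comm] at r1
  rw [mul_X_add_D_of_modes hfg]
  simp only [corrLim, map_add, map_smul, inner_add_left, inner_add_right, inner_sub_left,
    real_inner_smul_left, real_inner_smul_right, Finset.sum_add_distrib, Finset.sum_sub_distrib,
    ← Finset.mul_sum, r1, r2, real_inner_comm m]
  ring

end

end ScriData

end

end NullInfinity

/-! ### Assembly at the two ends -/

open NullInfinity
theorem mainTheorem6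
    (D D' : ScriData) (f : S2 → ℝ)
    (hD : D.IsVacuum) (hD' : D'.IsVacuum)
    (hdecay : D.NewsDecay)
    (hf : SmoothOnS2 f) (hst : ScriData.IsSupertranslate f D D')
    (c cc c' cc' : ℝ → S2 → ℝ)
    (hc : ∀ u, IsPotentials (D.shear u) (c u) (cc u))
    (hc' : ∀ u, IsPotentials (D'.shear u) (c' u) (cc' u))
    (α₀ : ℝ) (α : Fin 3 → ℝ) (g : S2 → ℝ)
    (hg : SupportedInModesGE 2 g)
    (hfg : ∀ x, f x = α₀ + ∑ i, α i * coord i x + g x)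
    (k : Fin 3) :
    ∃ Ep Em Pp Pm Cp Cm Cfp Cfm : ℝ,
      Tendsto D.energy atTop (𝓝 Ep) ∧ Tendsto D.energy atBot (𝓝 Em) ∧
      Tendsto (D.momentum k) atTop (𝓝 Pp) ∧ Tendsto (D.momentum k) atBot (𝓝 Pm) ∧
      Tendsto (D.cwyCenterOfMass c cc k) atTop (𝓝 Cp) ∧
      Tendsto (D.cwyCenterOfMass c cc k) atBot (𝓝 Cm) ∧
      Tendsto (D'.cwyCenterOfMass c' cc' k) atTop (𝓝 Cfp) ∧
      Tendsto (D'.cwyCenterOfMass c' cc' k) atBot (𝓝 Cfm) ∧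
      (Cfp - Cfm) - (Cp - Cm) = α₀ * (Pp - Pm) + α k * (Ep - Em) := by
  set F : smoothS2 := ⟨f, hf⟩ with hF
  -- Smoothness of f_{ℓ≥2} follows from that of f by subtracting the explicit ℓ ≤ 1 part.
  set G : smoothS2 := F - algebraMap ℝ smoothS2 α₀ - ∑ i, α i • X i with hG
  have hGg : G.1 = g := funext fun x => by
    have e : ev x G = f x - α₀ - ∑ i, α i * coord i x := by
      rw [hG, map_sub, map_sub, map_sum, AlgHom.commutes]
      simp only [map_smul, ev_X, smul_eq_mul]
      rfl
    refine e.trans ?_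
    rw [hfg x]
    ring
  have hFG : F = algebraMap ℝ smoothS2 α₀ + ∑ i, α i • X i + G := by rw [hG]; abel
  have hpG : Perp G := perp_of_supportedInModesGE (by rwa [hGg])
  set cA : ℝ → smoothS2 := fun u => ⟨c u, (hc u).smooth_closed⟩
  set ccA : ℝ → smoothS2 := fun u => ⟨cc u, (hc u).smooth_coclosed⟩
  set cA' : ℝ → smoothS2 := fun u => ⟨c' u, (hc' u).smooth_closed⟩
  set ccA' : ℝ → smoothS2 := fun u => ⟨cc' u, (hc' u).smooth_coclosed⟩
  have hp : ∀ u, IsPot (D.CT u) (cA u) (ccA u) := fun u => IsPotentials.isPot (hc u)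
  have hp' : ∀ u, IsPot (D'.CT u) (cA' u) (ccA' u) := fun u => IsPotentials.isPot (hc' u)
  obtain ⟨ε, hε, hN⟩ := hdecay.exists_dec
  -- These integration constants are chosen before the end l, so b - a is the same at both ends and
  -- drops out of the final difference.
  obtain ⟨a, b, hab⟩ := ScriData.IsVacuum.exists_classicalCenterOfMass_eq (f := F) hD hD' hst k
  have key : ∀ l : Filter ℝ, l = atTop ∨ l = atBot → ∃ E P C C', Tendsto D.energy l (𝓝 E) ∧
      Tendsto (D.momentum k) l (𝓝 P) ∧ Tendsto (D.cwyCenterOfMass c cc k) l (𝓝 C) ∧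
      Tendsto (D'.cwyCenterOfMass c' cc' k) l (𝓝 C') ∧
      C' - C = α₀ * P + α k * E + (b - a) := fun l hl => by
    have := neBot_of_atTop_or_atBot hl
    obtain ⟨E, P, R, R', B, hE, hP, hR, hR', hB, hlim⟩ :=
      hD.exists_limits hl hε (hN l hl) (f := F) hst hp hp' hpG hFG k
    have hc0 : ∀ u, Continuous (D.fluxPrim k u) := fun u => by
      simpa using D.continuous_fluxPrim k (continuous_const (y := (0 : ℝ))) u
    have hcf := D.continuous_fluxPrim k (SmoothOnS2.continuous hf)
    have hJ := ScriData.uCauchy_fluxPrim hl hε (hN l hl) k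
    obtain ⟨q, hq⟩ := hJ.exists_tendsto_sphereInt hc0
    have hq' : Tendsto (fun u => sphereInt (fun x => D.fluxPrim k (u + f x) x)) l (𝓝 q) := by
      have h1 := hq.add (hJ.shift hl (SmoothOnS2.continuous hf)).tendsto_sphereInt
      rw [add_zero] at h1
      refine h1.congr fun u => ?_
      have e := integral_sub (integrable_of_continuous (hcf u)) (integrable_of_continuous (hc0 u))
      simp only [sphereInt] at e ⊢
      rw [e]
      ring
    refine ⟨E, P, q + a + R, q + B + b + R', hE, hP, ?_, ?_, by linarith⟩
    · refine ((hq.add_const a).add hR).congr fun u => ?_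
      rw [← (hab u).1]
      exact (D.cwyCenterOfMass_eq cA ccA k u).symm
    · refine (((hq'.add hB).add_const b).add hR').congr fun u => ?_
      refine Eq.trans ?_ (D'.cwyCenterOfMass_eq cA' ccA' k u).symm
      rw [(hab u).2]
  obtain ⟨Ep, Pp, Cp, Cfp, h1, h2, h3, h4, h5⟩ := key atTop (Or.inl rfl)
  obtain ⟨Em, Pm, Cm, Cfm, g1, g2, g3, g4, g5⟩ := key atBot (Or.inr rfl)
  exact ⟨Ep, Em, Pp, Pm, Cp, Cm, Cfp, Cfm, h1, g1, h2, g2, h3, g3, h4, g4, by linarith⟩
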